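/- **Conventions.** Let $M$ be a transitive set with $M\models\mathsf{ZFC}$. A class over $M$ is a subset of $M$; a world over $M$ is a collection $\mathcal X$ of classes over $M$, identified with the two-sorted structure $(M,\mathcal X)$; a class potentialist system over $M$ is a set of worlds over $M$, ordered by inclusion. A formula of class theory is elementary if it has no class quantifiers. $(M,\mathcal X)\models\mathsf{GB}$ (and $\mathcal X$ is then called a $\mathsf{GB}$-expansion of $M$) means: $\mathsf{ZFC}$ holds for the sets, $\mathcal X$ is closed under comprehension for elementary formulas with set and class parameters, and the image of a set under a class function is a set. $\mathrm{Def}(M)$ is the collection of classes first-order definable over $(M,\in)$ with parameters, and $\mathcal X[A]$ is the collection of classes definable with set parameters from $A$ and finitely many classes of $\mathcal X$. For $A\subseteq M$, $\mathrm{Tr}(A)$ is the truth predicate of $(M,\in,A)$: the class of pairs $(\varphi,a)$, with $\varphi$ a first-order formula in the language of this structure and $a$ a finite tuple from $M$, such that $(M,\in,A)\models\varphi[a]$. For a class well-order $\Gamma$, $\mathrm{Tr}_\Gamma(A)$ is the unique class $\Theta$ of triples $(\xi,\varphi,a)$, with $\xi$ in the field of $\Gamma$ and $\varphi$ a first-order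 formula with predicates for $A$ and $\Theta$, such that $(\xi,\varphi,a)\in\Theta$ if and only if $(M,\in,A,\{(\eta,\psi,b)\in\Theta:\eta<_\Gamma\xi\})\models\varphi[a]$. For $\xi$ in the field of $\Lambda$ (written $\xi<\Lambda$), $\mathrm{Tr}_\xi(A)=\mathrm{Tr}_{\Lambda\restriction\{\eta:\eta<\xi\}}(A)$. A *truth potentialist system* over $M$ is a set $\mathfrak T$ of worlds such that (1) $\mathrm{Def}(M)\in\mathfrak T$; (2) every $\mathcal X\in\mathfrak T$ satisfies $\mathsf{GB}$; (3) if $\mathcal X\in\mathfrak T$ and $A\in\mathcal X$ then $\mathcal X[\mathrm{Tr}(A)]\in\mathfrak T$. A *$<\Lambda$ truth potentialist system* is defined with (3) replaced by: if $\mathcal X\in\mathfrak T$, $\xi<\Lambda$ and $A\in\mathcal X$ then $\mathcal X[\mathrm{Tr}_\xi(A)]\in\mathfrak T$. A system $\mathfrak S$ *covers* $\mathfrak T$ if every world of $\mathfrak T$ is contained in a world of $\mathfrak S$. A $<\Lambda$ truth potentialist system $\mathfrak A$ is *least up to covering* if every $<\Lambda$ truth potentialist system covers it; it is *the smallest* one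 if moreover it is refined, i.e. there is no $<\Lambda$ truth potentialist system that properly contains $\mathfrak A$ and is covered by $\mathfrak A$. A condition is a set in $M$ that is a well-order of a set; $p$ is stronger than $q$ if $p$ end-extends $q$. A class $H$ is a *generic global well-order* over $(M,\mathcal X)$ if $H=\bigcup G$ for a filter $G$ of conditions meeting every dense class of conditions in $\mathcal X$. For a world $\mathcal X$ of a system $\mathfrak B$ and a formula $\varphi$ with parameters, $\Diamond\varphi$ (resp. $\Box\varphi$) holds at $\mathcal X$ if $\varphi$ holds at some (resp. every) $\mathcal Y\in\mathfrak B$ with $\mathcal X\subseteq\mathcal Y$. The axiom $.2$ is valid at $\mathcal X$ with parameters allowed if $\Diamond\Box\varphi\Rightarrow\Box\Diamond\varphi$ holds at $\mathcal X$ for every formula $\varphi$ of class theory with set parameters from $M$ and class parameters from $\mathcal X$. **Statement.** Let $M$ be a countable transitive model of $\mathsf{ZFC}$, and let $\Lambda\in\mathrm{Def}(M)$ be a (genuinely well-founded) class well-order of limit length (nonempty and without largest element) such that $M$ has a $<\Lambda$ truth potentialist system. Then there is a unique smallest $<\Lambda$ truth potentialist system over $M$. Let $\mathfrak A$ be this system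 or, more generally, any $<\Lambda$ truth potentialist system over $M$ that is least up to covering, and let $$\mathfrak B=\mathfrak A\cup\{\mathcal X[H] : \mathcal X\in\mathfrak A,\ H \text{ a generic global well-order over }(M,\mathcal X)\}.$$ Then: 1. for every world $\mathcal X\in\mathfrak A$, the axiom $.2$, with parameters allowed, is not valid in $\mathfrak B$ at $\mathcal X$; 2. for every $\mathcal X\in\mathfrak A$ there are a world $\mathcal Y\in\mathfrak B$ with $\mathcal X\subseteq\mathcal Y$ and a class $A\in\mathcal Y$ such that no $\mathsf{GB}$-expansion $\mathcal Z\supseteq\mathcal Y$ of $M$ contains $\mathrm{Tr}(A)$; 3. consequently, no truth potentialist system over $M$ contains all worlds of $\mathfrak B$. -/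

import Mathlib

universe u

/-! ### Formulas of class theory

`ClassFormula n m` is the type of formulas of two-sorted class theory whose free variables are among
the set variables `x₀, …, xₙ₋₁` and the class variables `X₀, …, Xₘ₋₁`. The set quantifier binds `xₙ`
in a formula of `ClassFormula (n + 1) m`; the class quantifier binds `Xₘ` in a formula of
`ClassFormula n (m + 1)`. Equality of classes is expressed by extensionality. -/

inductive ClassFormula : ℕ → ℕ → Type
  | mem {n m : ℕ} (i j : Fin n) : ClassFormula n m
  | eq {n m : ℕ} (i j : Fin n) : ClassFormula n m
  | memClass {n m : ℕ} (i : Fin n) (k : Fin m) : ClassFormula n m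
  | neg {n m : ℕ} (φ : ClassFormula n m) : ClassFormula n m
  | conj {n m : ℕ} (φ ψ : ClassFormula n m) : ClassFormula n m
  | allSet {n m : ℕ} (φ : ClassFormula (n + 1) m) : ClassFormula n m
  | allClass {n m : ℕ} (φ : ClassFormula n (m + 1)) : ClassFormula n m

/-- A formula is elementary if it has no class quantifier (class variables may occur free). -/
def ClassFormula.IsElementary : {n m : ℕ} → ClassFormula n m → Prop
  | _, _, .mem _ _ => True
  | _, _, .eq _ _ => True
  | _, _, .memClass _ _ => True
  | _, _, .neg φ => φ.IsElementary
  | _, _, .conj φ ψ => φ.IsElementary ∧ ψ.IsElementary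
  | _, _, .allSet φ => φ.IsElementary
  | _, _, .allClass _ => False

/-- The von Neumann numeral `n`. -/
def natCode : ℕ → ZFSet.{u}
  | 0 => ∅
  | n + 1 => insert (natCode n) (natCode n)

/-- The hereditarily finite set coding a formula. -/
noncomputable def ClassFormula.code : {n m : ℕ} → ClassFormula n m → ZFSet.{u}
  | _, _, .mem i j => (natCode 0).pair ((natCode i).pair (natCode j))
  | _, _, .eq i j => (natCode 1).pair ((natCode i).pair (natCode j))
  | _, _, .memClass i k => (natCode 2).pair ((natCode i).pair (natCode k))
  | _, _, .neg φ => (natCode 3).pair φ.code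
  | _, _, .conj φ ψ => (natCode 4).pair (φ.code.pair ψ.code)
  | _, _, .allSet φ => (natCode 5).pair φ.code
  | _, _, .allClass φ => (natCode 6).pair φ.code

/-- The finite sequence `a`, as the set-theoretic function `{(i, a i) : i < n}`. -/
noncomputable def tupleCode : {n : ℕ} → (Fin n → ZFSet.{u}) → ZFSet.{u}
  | 0, _ => ∅
  | n + 1, a => insert ((natCode n).pair (a (Fin.last n))) (tupleCode fun i : Fin n => a i.castSucc)

/-! ### Classes over a set `M` -/

/-- The elements of `M`. -/
abbrev Elt (M : ZFSet.{u}) : Type _ := {x : ZFSet.{u} // x ∈ M}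

/-- A class over `M` is a subset of `M`. -/
abbrev ClassOver (M : ZFSet.{u}) : Type _ := Set (Elt M)

/-- A world over `M` is given by its collection of classes; the sets are always those of `M`. -/
abbrev World (M : ZFSet.{u}) : Type _ := Set (ClassOver M)

/-- Satisfaction of a formula in the model `(M, 𝒳)` of class theory. -/
def Sat {M : ZFSet.{u}} (𝒳 : World M) :
    {n m : ℕ} → ClassFormula n m → (Fin n → Elt M) → (Fin m → ClassOver M) → Prop
  | _, _, .mem i j, v, _ => (v i).1 ∈ (v j).1
  | _, _, .eq i j, v, _ => v i = v j
  | _, _, .memClass i k, v, V => v i ∈ V k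
  | _, _, .neg φ, v, V => ¬ Sat 𝒳 φ v V
  | _, _, .conj φ ψ, v, V => Sat 𝒳 φ v V ∧ Sat 𝒳 ψ v V
  | n, _, .allSet φ, v, V =>
      ∀ x : Elt M, Sat 𝒳 φ (Fin.snoc (α := fun _ : Fin (n + 1) => Elt M) v x) V
  | _, m, .allClass φ, v, V =>
      ∀ A ∈ 𝒳, Sat 𝒳 φ v (Fin.snoc (α := fun _ : Fin (m + 1) => ClassOver M) V A)

/-- Satisfaction of an elementary formula in the structure `(M, ∈, V₀, …, Vₘ₋₁)`. It is only used for
formulas without class quantifiers, for which the collection of classes is irrelevant. -/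
def ElemSat {M : ZFSet.{u}} {n m : ℕ} (φ : ClassFormula n m) (v : Fin n → Elt M)
    (V : Fin m → ClassOver M) : Prop :=
  Sat ∅ φ v V

/-- The classes over `M` that are first-order definable over `(M, ∈)` from finitely many members of
`𝒮` as predicates, and parameters from `M`. -/
def definableFrom {M : ZFSet.{u}} (𝒮 : Set (ClassOver M)) : World M :=
  {B | ∃ (n m : ℕ) (φ : ClassFormula (n + 1) m) (v : Fin n → Elt M) (V : Fin m → ClassOver M),
    φ.IsElementary ∧ (∀ k, V k ∈ 𝒮) ∧
      B = {x | ElemSat φ (Fin.snoc (α := fun _ : Fin (n + 1) => Elt M) v x) V}}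

/-- `Def(M)`. -/
def defClasses (M : ZFSet.{u}) : World M := definableFrom ∅

/-- `𝒳[A]`: the classes definable from `A` and finitely many classes of `𝒳`. -/
def adjoinClass {M : ZFSet.{u}} (𝒳 : World M) (A : ClassOver M) : World M :=
  definableFrom (insert A 𝒳)

/-! ### The theories `ZFC` and `GB` -/

/-- `(M, ∈)` is a model of `ZFC`. -/
structure ModelsZFC (M : ZFSet.{u}) : Prop where
  extensionality : ∀ x y : Elt M, (∀ z : Elt M, z.1 ∈ x.1 ↔ z.1 ∈ y.1) → x = y
  foundation : ∀ x : Elt M, (∃ y : Elt M, y.1 ∈ x.1) →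
    ∃ y : Elt M, y.1 ∈ x.1 ∧ ∀ z : Elt M, z.1 ∈ x.1 → z.1 ∉ y.1
  pairing : ∀ x y : Elt M, ∃ p : Elt M, ∀ z : Elt M, z.1 ∈ p.1 ↔ z = x ∨ z = y
  union : ∀ x : Elt M, ∃ s : Elt M, ∀ z : Elt M, z.1 ∈ s.1 ↔ ∃ y : Elt M, y.1 ∈ x.1 ∧ z.1 ∈ y.1
  powerset : ∀ x : Elt M, ∃ p : Elt M, ∀ y : Elt M,
    y.1 ∈ p.1 ↔ ∀ z : Elt M, z.1 ∈ y.1 → z.1 ∈ x.1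
  infinity : ∃ w : Elt M, (∃ e : Elt M, e.1 ∈ w.1 ∧ ∀ z : Elt M, z.1 ∉ e.1) ∧
    ∀ x : Elt M, x.1 ∈ w.1 →
      ∃ y : Elt M, y.1 ∈ w.1 ∧ ∀ z : Elt M, z.1 ∈ y.1 ↔ z.1 ∈ x.1 ∨ z = x
  separation : ∀ (n : ℕ) (φ : ClassFormula (n + 1) 0), φ.IsElementary →
    ∀ (v : Fin n → Elt M) (a : Elt M), ∃ b : Elt M, ∀ x : Elt M,
      x.1 ∈ b.1 ↔ x.1 ∈ a.1 ∧
        ElemSat φ (Fin.snoc (α := fun _ : Fin (n + 1) => Elt M) v x) Fin.elim0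
  replacement : ∀ (n : ℕ) (φ : ClassFormula (n + 2) 0), φ.IsElementary →
    ∀ (v : Fin n → Elt M) (F : Elt M → Elt M → Prop),
      (∀ x y, F x y ↔ ElemSat φ (Fin.snoc (α := fun _ : Fin (n + 2) => Elt M)
        (Fin.snoc (α := fun _ : Fin (n + 1) => Elt M) v x) y) Fin.elim0) →
      ∀ a : Elt M, (∀ x : Elt M, x.1 ∈ a.1 → ∃! y, F x y) →
        ∃ b : Elt M, ∀ y : Elt M, y.1 ∈ b.1 ↔ ∃ x : Elt M, x.1 ∈ a.1 ∧ F x y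
  choice : ∀ a : Elt M, (∀ x : Elt M, x.1 ∈ a.1 → ∃ z : Elt M, z.1 ∈ x.1) →
    (∀ x y : Elt M, x.1 ∈ a.1 → y.1 ∈ a.1 → x ≠ y → ¬ ∃ z : Elt M, z.1 ∈ x.1 ∧ z.1 ∈ y.1) →
    ∃ c : Elt M, ∀ x : Elt M, x.1 ∈ a.1 → ∃! z : Elt M, z.1 ∈ x.1 ∧ z.1 ∈ c.1

/-- The binary relation coded by a class `R` of ordered pairs. -/
def ClassOver.Rel {M : ZFSet.{u}} (R : ClassOver M) (x y : Elt M) : Prop :=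
  ∃ z ∈ R, z.1 = x.1.pair y.1

/-- `(M, 𝒳)` is a model of `GB`. Extensionality for classes holds automatically. -/
structure IsGBExpansion (M : ZFSet.{u}) (𝒳 : World M) : Prop where
  zfc : ModelsZFC M
  comprehension : definableFrom 𝒳 ⊆ 𝒳
  replacement : ∀ F ∈ 𝒳, (∀ x y y' : Elt M, F.Rel x y → F.Rel x y' → y = y') →
    ∀ a : Elt M, ∃ b : Elt M, ∀ y : Elt M, y.1 ∈ b.1 ↔ ∃ x : Elt M, x.1 ∈ a.1 ∧ F.Rel x y

/-! ### Class well-orders -/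

/-- `R` is a class of ordered pairs which is a (reflexive) well-order of its field `{x | R.Rel x x}`.
The well-foundedness is genuine: all subsets of the field are considered. -/
structure ClassOver.IsWellOrder {M : ZFSet.{u}} (R : ClassOver M) : Prop where
  pairs : ∀ z ∈ R, ∃ x y : Elt M, z.1 = x.1.pair y.1
  refl : ∀ x y, R.Rel x y → R.Rel x x ∧ R.Rel y y
  antisymm : ∀ x y, R.Rel x y → R.Rel y x → x = y
  trans : ∀ x y z, R.Rel x y → R.Rel y z → R.Rel x z
  total : ∀ x y, R.Rel x x → R.Rel y y → R.Rel x y ∨ R.Rel y x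
  wf : ∀ S : Set (Elt M), S.Nonempty → (∀ x ∈ S, R.Rel x x) → ∃ m ∈ S, ∀ x ∈ S, R.Rel m x

/-- The strict order of `R`. -/
def ClassOver.Lt {M : ZFSet.{u}} (R : ClassOver M) (x y : Elt M) : Prop :=
  R.Rel x y ∧ x ≠ y

/-- The order has limit length: it is nonempty and has no largest element. -/
def ClassOver.HasLimitLength {M : ZFSet.{u}} (R : ClassOver M) : Prop :=
  (∃ x, R.Rel x x) ∧ ∀ x, R.Rel x x → ∃ y, R.Lt x y

/-- `R ↾ ξ`, the restriction of the order to the predecessors of `ξ`. -/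
def ClassOver.below {M : ZFSet.{u}} (R : ClassOver M) (ξ : Elt M) : ClassOver M :=
  {z | z ∈ R ∧ ∃ x y : Elt M, R.Lt x ξ ∧ R.Lt y ξ ∧ z.1 = x.1.pair y.1}

/-! ### Truth predicates -/

/-- `Tr(A)`, the truth predicate for `(M, ∈, A)`: the class of all `(φ, a)` such that `φ` is a
first-order formula in the language with `∈` and a predicate for `A`, and `φ` holds of `a`. -/
def truthPredicate {M : ZFSet.{u}} (A : ClassOver M) : ClassOver M :=
  {z | ∃ (n : ℕ) (φ : ClassFormula n 1) (a : Fin n → Elt M), φ.IsElementary ∧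
    z.1 = φ.code.pair (tupleCode fun i => (a i).1) ∧ ElemSat φ a ![A]}

/-- `Θ` is the `Γ`-iterated truth predicate relative to `A`: it is a class of triples `(ξ, φ, a)` with
`ξ` in the field of `Γ` and `φ` a first-order formula with predicates for `A` and `Θ`, and
`(ξ, φ, a) ∈ Θ` iff `φ` holds of `a` when the second predicate is read as the class of those members
`(η, ψ, b)` of `Θ` with `η < ξ`. For a well-order `Γ` there is exactly one such `Θ`. -/
def IsIteratedTruthPredicate {M : ZFSet.{u}} (Γ A Θ : ClassOver M) : Prop :=
  ∀ z : Elt M, z ∈ Θ ↔ ∃ (ξ : Elt M) (n : ℕ) (φ : ClassFormula n 2) (a : Fin n → Elt M),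
    Γ.Rel ξ ξ ∧ φ.IsElementary ∧
    z.1 = ξ.1.pair (φ.code.pair (tupleCode fun i => (a i).1)) ∧
    ElemSat φ a ![A, {t | t ∈ Θ ∧ ∃ (η : Elt M) (w : ZFSet.{u}), Γ.Lt η ξ ∧ t.1 = η.1.pair w}]

/-! ### Truth potentialist systems -/

/-- Truth potentialist systems over `M`. The accessibility relation is inclusion of worlds. -/
structure IsTruthPotentialistSystem (M : ZFSet.{u}) (𝔗 : Set (World M)) : Prop where
  base : defClasses M ∈ 𝔗
  gb : ∀ 𝒳 ∈ 𝔗, IsGBExpansion M 𝒳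
  truth : ∀ 𝒳 ∈ 𝔗, ∀ A ∈ 𝒳, adjoinClass 𝒳 (truthPredicate A) ∈ 𝔗

/-- `<Λ`-length truth potentialist systems over `M`: in the last clause `Θ` is `Tr_ξ(A)`. -/
structure IsTruthPotentialistSystemLT (M : ZFSet.{u}) (Λ : ClassOver M) (𝔗 : Set (World M)) :
    Prop where
  base : defClasses M ∈ 𝔗
  gb : ∀ 𝒳 ∈ 𝔗, IsGBExpansion M 𝒳
  truth : ∀ 𝒳 ∈ 𝔗, ∀ ξ : Elt M, Λ.Rel ξ ξ → ∀ A ∈ 𝒳,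
    ∃ Θ, IsIteratedTruthPredicate (Λ.below ξ) A Θ ∧ adjoinClass 𝒳 Θ ∈ 𝔗

/-- `𝔄` covers `𝔅`: every world of `𝔅` is contained in a world of `𝔄`. -/
def Covers {M : ZFSet.{u}} (𝔄 𝔅 : Set (World M)) : Prop :=
  ∀ 𝒳 ∈ 𝔅, ∃ 𝒴 ∈ 𝔄, 𝒳 ⊆ 𝒴

/-- `𝔄` is a `<Λ` truth potentialist system which is covered by every such system. -/
def IsLeastUpToCovering (M : ZFSet.{u}) (Λ : ClassOver M) (𝔄 : Set (World M)) : Prop :=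
  IsTruthPotentialistSystemLT M Λ 𝔄 ∧ ∀ 𝔗, IsTruthPotentialistSystemLT M Λ 𝔗 → Covers 𝔗 𝔄

/-- `𝔄` is the smallest `<Λ` truth potentialist system: it is covered by every such system, and it is
refined, that is, no such system properly containing `𝔄` is covered by `𝔄`. -/
def IsSmallest (M : ZFSet.{u}) (Λ : ClassOver M) (𝔄 : Set (World M)) : Prop :=
  IsLeastUpToCovering M Λ 𝔄 ∧
    ∀ 𝔗, IsTruthPotentialistSystemLT M Λ 𝔗 → 𝔄 ⊆ 𝔗 → Covers 𝔄 𝔗 → 𝔗 = 𝔄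

/-! ### Generic global well-orders -/

/-- The conditions: sets of `M` that are well-orders (of a set). -/
def IsCondition {M : ZFSet.{u}} (p : Elt M) : Prop :=
  ClassOver.IsWellOrder {z : Elt M | z.1 ∈ p.1}

/-- The order `p` end-extends the order `q`, i.e. `p` is a stronger condition than `q`. -/
def EndExtends {M : ZFSet.{u}} (p q : Elt M) : Prop :=
  q.1 ⊆ p.1 ∧ ∀ x y : Elt M, x.1.pair x.1 ∈ q.1 → y.1.pair x.1 ∈ p.1 → y.1.pair x.1 ∈ q.1

/-- `D` is a dense class of conditions. -/
def IsDenseClass {M : ZFSet.{u}} (D : ClassOver M) : Prop :=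
  (∀ p ∈ D, IsCondition p) ∧ ∀ q : Elt M, IsCondition q → ∃ p ∈ D, EndExtends p q

/-- `G` is a filter of conditions which is generic over `(M, 𝒳)`. -/
structure IsGenericFilter {M : ZFSet.{u}} (𝒳 : World M) (G : ClassOver M) : Prop where
  conditions : ∀ p ∈ G, IsCondition p
  upward : ∀ p ∈ G, ∀ q, IsCondition q → EndExtends p q → q ∈ G
  directed : ∀ p ∈ G, ∀ q ∈ G, ∃ r ∈ G, EndExtends r p ∧ EndExtends r q
  generic : ∀ D ∈ 𝒳, IsDenseClass D → ∃ p ∈ G, p ∈ D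

/-- `H` is a global well-order generic over `(M, 𝒳)`: the union of a generic filter. -/
def IsGenericGlobalWellOrder {M : ZFSet.{u}} (𝒳 : World M) (H : ClassOver M) : Prop :=
  ∃ G, IsGenericFilter 𝒳 G ∧ H = {z | ∃ p ∈ G, z.1 ∈ p.1}

/-- The system obtained from `𝔄` by adding all extensions of worlds of `𝔄` by a generic global
well-order. -/
def addGenericWellOrders {M : ZFSet.{u}} (𝔄 : Set (World M)) : Set (World M) :=
  𝔄 ∪ {𝒴 | ∃ 𝒳 ∈ 𝔄, ∃ H, IsGenericGlobalWellOrder 𝒳 H ∧ 𝒴 = adjoinClass 𝒳 H}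

/-! ### Modal semantics -/

/-- `□ P` at the world `𝒳` of the potentialist system `𝔅`. -/
def Necessarily {M : ZFSet.{u}} (𝔅 : Set (World M)) (P : World M → Prop) (𝒳 : World M) : Prop :=
  ∀ 𝒴 ∈ 𝔅, 𝒳 ⊆ 𝒴 → P 𝒴

/-- `◇ P` at the world `𝒳` of the potentialist system `𝔅`. -/
def Possibly {M : ZFSet.{u}} (𝔅 : Set (World M)) (P : World M → Prop) (𝒳 : World M) : Prop :=
  ∃ 𝒴 ∈ 𝔅, 𝒳 ⊆ 𝒴 ∧ P 𝒴

/-- The axiom `.2`, `◇ □ φ → □ ◇ φ`, is valid at the world `𝒳` of `𝔅`: it holds for every formula `φ`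
of class theory, with set parameters from `M` and class parameters from `𝒳`. -/
def DotTwoValidAt {M : ZFSet.{u}} (𝔅 : Set (World M)) (𝒳 : World M) : Prop :=
  ∀ (n m : ℕ) (φ : ClassFormula n m) (v : Fin n → Elt M) (V : Fin m → ClassOver M),
    (∀ k, V k ∈ 𝒳) →
    Possibly 𝔅 (Necessarily 𝔅 fun 𝒴 => Sat 𝒴 φ v V) 𝒳 →
      Necessarily 𝔅 (Possibly 𝔅 fun 𝒴 => Sat 𝒴 φ v V) 𝒳

/-! The smallest system comes from two closure arguments. Iterated truth predicates along a
well-founded order are unique, so all `<Λ` systems adjoin the same classes and their intersection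
`generatedWorlds` is again a system, hence least. The closure clause concerns one world at a time,
so the union of all systems covered by this intersection is also a system. It is still covered by
the intersection, so it is refined, and any other smallest system is contained in it and covers it.

The negative results rest on a conflict between a generic order and a truth predicate. Every world
of the intersection is generated by one class `U` which an elementary formula with set parameters
defines implicitly (`exists_isGenerator`), because Tarski's clauses are elementary. Let `𝒢` be such
a world. Since `M` is countable, the dense properties of conditions definable from `U`, and the
elements of `M`, can be listed in type `ω`. Build a chain of conditions: at step `n` append to `p n`
a marker which codes the `n`-th dense property and the `n`-th element of `M`, then extend minimally
into that property. The union `H` is generic over `𝒢`. From `H` and the truth predicate of `(M, ∈,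
U)` the chain can be recovered: the point of `H` after `p n` is the marker, it names the formula to
be met, and truth for `U` recognizes the least initial segment that meets it. Reading the markers
enumerates `M` in type `ω`, which contradicts replacement (`exists_catastrophic_generic`,
`IsGBExpansion.not_surjective`). Hence no `GB`-expansion contains both `𝒢[H]` and `Tr(U)`.

A least system is covered by the intersection and contains it, so such a `𝒢` lies above each of its
worlds. For `.2` take `ξ₀ < ξ` in `Λ` and the formula "some class satisfies the implicit definition
of `U` together with `Tr_ξ(U)`". It is necessary from `𝒢[Tr_ξ(U)]` on. In a world above `𝒢[H]` it
would provide truth for `U`, through stage `ξ₀`, and so an enumeration of `M`. No world of `𝔅` has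
one: worlds of `𝔄` satisfy `GB`, and forcing with set well-orders is closed under `ω`-sequences, so
it adds no function on `ω` (`not_surjective_of_generic`).

Much of the work is definability over `(M, ∈)`: of the cumulative hierarchy, of well-foundedness, of
the forcing relation, and of being an iterated truth predicate. -/

/-! ### Renaming of variables -/

/-- Extend a renaming of variables by fixing the last variable. -/
def liftFin {n n' : ℕ} (f : Fin n → Fin n') : Fin (n + 1) → Fin (n' + 1) :=
  Fin.lastCases (Fin.last n') fun i => (f i).castSucc

theorem snoc_comp_liftFin {α : Type*} {n n' : ℕ} (f : Fin n → Fin n') (v : Fin n' → α) (x : α) :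
    (Fin.snoc (α := fun _ : Fin (n' + 1) => α) v x) ∘ liftFin f =
      Fin.snoc (α := fun _ : Fin (n + 1) => α) (v ∘ f) x := by
  funext i
  refine Fin.lastCases ?_ (fun i => ?_) i <;> simp [liftFin]

namespace ClassFormula

/-- Simultaneous renaming of the set and class variables of a formula. -/
def rename : {n m n' m' : ℕ} → ClassFormula n m → (Fin n → Fin n') → (Fin m → Fin m') →
    ClassFormula n' m'
  | _, _, _, _, .mem i j, f, _ => .mem (f i) (f j)
  | _, _, _, _, .eq i j, f, _ => .eq (f i) (f j)
  | _, _, _, _, .memClass i k, f, g => .memClass (f i) (g k)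
  | _, _, _, _, .neg φ, f, g => .neg (φ.rename f g)
  | _, _, _, _, .conj φ ψ, f, g => .conj (φ.rename f g) (ψ.rename f g)
  | _, _, _, _, .allSet φ, f, g => .allSet (φ.rename (liftFin f) g)
  | _, _, _, _, .allClass φ, f, g => .allClass (φ.rename f (liftFin g))

theorem IsElementary.conj {n m : ℕ} {φ ψ : ClassFormula n m} (h : φ.IsElementary)
    (h' : ψ.IsElementary) : (φ.conj ψ).IsElementary :=
  ⟨h, h'⟩

theorem IsElementary.rename {n m : ℕ} {φ : ClassFormula n m} (h : φ.IsElementary) :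
    ∀ {n' m' : ℕ} (f : Fin n → Fin n') (g : Fin m → Fin m'), (φ.rename f g).IsElementary := by
  induction φ with
  | mem | eq | memClass => intros; trivial
  | neg φ ih => exact fun f g => ih h f g
  | conj φ ψ ih₁ ih₂ => exact fun f g => ⟨ih₁ h.1 f g, ih₂ h.2 f g⟩
  | allSet φ ih => exact fun f g => ih h _ _
  | allClass => exact h.elim

end ClassFormula

variable {M : ZFSet.{u}}

theorem sat_rename (𝒳 : World M) {n m : ℕ} (φ : ClassFormula n m) :
    ∀ {n' m' : ℕ} (f : Fin n → Fin n') (g : Fin m → Fin m') (v : Fin n' → Elt M)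
      (V : Fin m' → ClassOver M), Sat 𝒳 (φ.rename f g) v V ↔ Sat 𝒳 φ (v ∘ f) (V ∘ g) := by
  induction φ with
  | mem | eq | memClass => intros; rfl
  | neg φ ih => intros; exact not_congr (ih _ _ _ _)
  | conj φ ψ ih₁ ih₂ => intros; exact and_congr (ih₁ _ _ _ _) (ih₂ _ _ _ _)
  | allSet φ ih =>
    intros
    refine forall_congr' fun x => ?_
    rw [ih, snoc_comp_liftFin]
  | allClass φ ih =>
    intros
    refine forall₂_congr fun A _ => ?_
    rw [ih, snoc_comp_liftFin]

theorem elemSat_rename {n m n' m' : ℕ} (φ : ClassFormula n m) (f : Fin n → Fin n')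
    (g : Fin m → Fin m') (v : Fin n' → Elt M) (V : Fin m' → ClassOver M) :
    ElemSat (φ.rename f g) v V ↔ ElemSat φ (v ∘ f) (V ∘ g) :=
  sat_rename ∅ φ f g v V

theorem sat_iff_elemSat (𝒳 : World M) {n m : ℕ} (φ : ClassFormula n m) (h : φ.IsElementary) :
    ∀ (v : Fin n → Elt M) (V : Fin m → ClassOver M), Sat 𝒳 φ v V ↔ ElemSat φ v V := by
  induction φ with
  | mem | eq | memClass => intros; rfl
  | neg φ ih => exact fun v V => not_congr (ih h v V)
  | conj φ ψ ih₁ ih₂ => exact fun v V => and_congr (ih₁ h.1 v V) (ih₂ h.2 v V)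
  | allSet φ ih => exact fun v V => forall_congr' fun x => ih h _ V
  | allClass => exact h.elim

/-! ### Definable predicates -/

/-- The predicate `P` of finitely many sets and classes is defined by an elementary formula with
parameters from `M` and class parameters from `𝒮`. -/
def Dfn (𝒮 : Set (ClassOver M)) {n m : ℕ}
    (P : (Fin n → Elt M) → (Fin m → ClassOver M) → Prop) : Prop :=
  ∃ (k l : ℕ) (w : Fin k → Elt M) (C : Fin l → ClassOver M) (φ : ClassFormula (k + n) (m + l)),
    φ.IsElementary ∧ (∀ i, C i ∈ 𝒮) ∧
      ∀ v V, P v V ↔ ElemSat φ (Fin.append w v) (Fin.append V C)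

/-- A definable operation with values in `M`. -/
def DfnTerm (𝒮 : Set (ClassOver M)) {n m : ℕ}
    (t : (Fin n → Elt M) → (Fin m → ClassOver M) → ZFSet.{u}) : Prop :=
  (∀ v V, t v V ∈ M) ∧
    Dfn 𝒮 (n := n + 1) (m := m) fun v V => (v (Fin.last n)).1 = t (Fin.init v) V

/-- A definable operation whose values are classes. -/
def DfnClass (𝒮 : Set (ClassOver M)) {n m : ℕ}
    (c : (Fin n → Elt M) → (Fin m → ClassOver M) → ClassOver M) : Prop :=
  Dfn 𝒮 (n := n + 1) (m := m) fun v V => v (Fin.last n) ∈ c (Fin.init v) V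

section Calculus

variable {𝒮 : Set (ClassOver M)} {n m : ℕ} {P Q : (Fin n → Elt M) → (Fin m → ClassOver M) → Prop}

theorem Dfn.congr (h : Dfn 𝒮 P) (hPQ : ∀ v V, Q v V ↔ P v V) : Dfn 𝒮 Q := by
  obtain ⟨k, l, w, C, φ, h₁, h₂, h₃⟩ := h
  exact ⟨k, l, w, C, φ, h₁, h₂, fun v V => (hPQ v V).trans (h₃ v V)⟩

theorem Dfn.of_formula (φ : ClassFormula n m) (h : φ.IsElementary) :
    Dfn 𝒮 fun v V => ElemSat (M := M) φ v V := by
  refine ⟨0, 0, Fin.elim0, Fin.elim0, φ.rename (Fin.natAdd 0) id, h.rename _ _,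
    fun i => i.elim0, fun v V => ?_⟩
  rw [elemSat_rename]
  have h₁ : Fin.append (Fin.elim0 : Fin 0 → Elt M) v ∘ Fin.natAdd 0 = v := by
    funext i; simp
  have h₂ : Fin.append V (Fin.elim0 : Fin 0 → ClassOver M) ∘ id = V := by
    funext i; exact Fin.append_left V (Fin.elim0 : Fin 0 → ClassOver M) i
  rw [h₁, h₂]

theorem Dfn.reindex (h : Dfn 𝒮 P) {n' : ℕ} (f : Fin n → Fin n') :
    Dfn 𝒮 (n := n') (m := m) fun v V => P (v ∘ f) V := by
  obtain ⟨k, l, w, C, φ, h₁, h₂, h₃⟩ := h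
  refine ⟨k, l, w, C, φ.rename (Fin.addCases (Fin.castAdd n') fun j => Fin.natAdd k (f j)) id,
    h₁.rename _ _, h₂, fun v V => ?_⟩
  refine (h₃ _ V).trans (Iff.trans ?_ (elemSat_rename φ _ _ _ _).symm)
  have h₄ : Fin.append w v ∘ (Fin.addCases (Fin.castAdd n') fun j => Fin.natAdd k (f j)) =
      Fin.append w (v ∘ f) := by
    funext i
    refine Fin.addCases (fun i => ?_) (fun i => ?_) i <;> simp
  rw [h₄]; rfl

theorem Dfn.not (h : Dfn 𝒮 P) : Dfn 𝒮 fun v V => ¬ P v V := by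
  obtain ⟨k, l, w, C, φ, h₁, h₂, h₃⟩ := h
  exact ⟨k, l, w, C, φ.neg, h₁, h₂, fun v V => not_congr (h₃ v V)⟩

theorem Dfn.and (h : Dfn 𝒮 P) (h' : Dfn 𝒮 Q) : Dfn 𝒮 fun v V => P v V ∧ Q v V := by
  obtain ⟨k, l, w, C, φ, h₁, h₂, h₃⟩ := h
  obtain ⟨k', l', w', C', ψ, h₁', h₂', h₃'⟩ := h'
  refine ⟨k + k', l + l', Fin.append w w', Fin.append C C',
    (φ.rename (Fin.addCases (fun i => Fin.castAdd n (Fin.castAdd k' i)) (Fin.natAdd (k + k')))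
        (Fin.addCases (Fin.castAdd (l + l')) fun i => Fin.natAdd m (Fin.castAdd l' i))).conj
      (ψ.rename (Fin.addCases (fun i => Fin.castAdd n (Fin.natAdd k i)) (Fin.natAdd (k + k')))
        (Fin.addCases (Fin.castAdd (l + l')) fun i => Fin.natAdd m (Fin.natAdd l i))),
    (h₁.rename _ _).conj (h₁'.rename _ _), ?_, fun v V => ?_⟩
  · intro i
    refine Fin.addCases (fun i => ?_) (fun i => ?_) i
    · simpa using h₂ i
    · simpa using h₂' i
  · refine and_congr ?_ ?_
    · refine (h₃ v V).trans (Iff.trans ?_ (elemSat_rename φ _ _ _ _).symm)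
      apply iff_of_eq
      congr 1 <;> funext i <;> refine Fin.addCases (fun i => ?_) (fun i => ?_) i <;> simp
    · refine (h₃' v V).trans (Iff.trans ?_ (elemSat_rename ψ _ _ _ _).symm)
      apply iff_of_eq
      congr 1 <;> funext i <;> refine Fin.addCases (fun i => ?_) (fun i => ?_) i <;> simp

theorem Dfn.or (h : Dfn 𝒮 P) (h' : Dfn 𝒮 Q) : Dfn 𝒮 fun v V => P v V ∨ Q v V :=
  (h.not.and h'.not).not.congr fun _ _ => by tauto

theorem Dfn.imp (h : Dfn 𝒮 P) (h' : Dfn 𝒮 Q) : Dfn 𝒮 fun v V => P v V → Q v V :=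
  (h.and h'.not).not.congr fun _ _ => by tauto

theorem Dfn.iff (h : Dfn 𝒮 P) (h' : Dfn 𝒮 Q) : Dfn 𝒮 fun v V => P v V ↔ Q v V :=
  ((h.imp h').and (h'.imp h)).congr fun _ _ => by tauto

theorem Dfn.all {P : (Fin n → Elt M) → Elt M → (Fin m → ClassOver M) → Prop}
    (h : Dfn 𝒮 (n := n + 1) (m := m) fun v V => P (Fin.init v) (v (Fin.last n)) V) :
    Dfn 𝒮 fun v V => ∀ x : Elt M, P v x V := by
  obtain ⟨k, l, w, C, φ, h₁, h₂, h₃⟩ := h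
  -- In `Dfn` the set parameters precede the free variables, so the last free variable is the one
  -- that `allSet` binds.
  refine ⟨k, l, w, C, .allSet φ, h₁, h₂, fun v V => forall_congr' fun x => ?_⟩
  have := h₃ (Fin.snoc (α := fun _ : Fin (n + 1) => Elt M) v x) V
  beta_reduce at this
  rw [Fin.init_snoc, Fin.snoc_last, Fin.append_snoc] at this
  exact this

theorem Dfn.ex {P : (Fin n → Elt M) → Elt M → (Fin m → ClassOver M) → Prop}
    (h : Dfn 𝒮 (n := n + 1) (m := m) fun v V => P (Fin.init v) (v (Fin.last n)) V) :
    Dfn 𝒮 fun v V => ∃ x : Elt M, P v x V :=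
  (Dfn.all (P := fun v x V => ¬ P v x V) h.not).not.congr fun _ _ => by simp

theorem Dfn.varMem (i j : Fin n) : Dfn (M := M) 𝒮 (m := m) fun v _ => (v i).1 ∈ (v j).1 :=
  Dfn.of_formula (.mem i j) trivial

theorem Dfn.varEq (i j : Fin n) : Dfn (M := M) 𝒮 (m := m) fun v _ => v i = v j :=
  Dfn.of_formula (.eq i j) trivial

theorem Dfn.varMemClass (i : Fin n) (k : Fin m) : Dfn (M := M) 𝒮 fun v V => v i ∈ V k :=
  Dfn.of_formula (.memClass i k) trivial

theorem Dfn.eqConst (i : Fin n) (a : Elt M) : Dfn 𝒮 (m := m) fun v _ => v i = a :=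
  ⟨1, 0, ![a], Fin.elim0, .eq (Fin.natAdd 1 i) (Fin.castAdd n 0), trivial, fun i => i.elim0,
    fun v V => by simp [ElemSat, Sat]⟩

theorem Dfn.memConstClass (i : Fin n) {C : ClassOver M} (hC : C ∈ 𝒮) :
    Dfn 𝒮 (m := m) fun v _ => v i ∈ C :=
  ⟨0, 1, Fin.elim0, ![C], .memClass (Fin.natAdd 0 i) (Fin.natAdd m 0), trivial, fun _ => by simpa,
    fun v V => by simp [ElemSat, Sat]⟩

theorem Dfn.prop (p : Prop) : Dfn 𝒮 (M := M) (n := n) (m := m) fun _ _ => p := by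
  -- There may be no free variable available, so the constantly true formula has to be quantified.
  have hx : Dfn 𝒮 (M := M) (n := n) (m := m) fun v _ => ∀ x : Elt M, x = x :=
    Dfn.all (P := fun _ x _ => x = x) (Dfn.varEq _ _)
  by_cases hp : p
  · exact hx.congr fun _ _ => by simp [hp]
  · exact hx.not.congr fun _ _ => by simp [hp]

theorem DfnTerm.weaken {t : (Fin n → Elt M) → (Fin m → ClassOver M) → ZFSet.{u}}
    (h : DfnTerm 𝒮 t) : DfnTerm 𝒮 (n := n + 1) (m := m) fun v V => t (Fin.init v) V := by
  refine ⟨fun v V => h.1 _ _,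
    (h.2.reindex (liftFin Fin.castSucc)).congr fun v V => ?_⟩
  have h₁ : Fin.init (v ∘ liftFin Fin.castSucc) = Fin.init (Fin.init v) := by
    funext i; simp [liftFin, Fin.init]
  rw [h₁]; simp [liftFin]

theorem DfnClass.weaken {c : (Fin n → Elt M) → (Fin m → ClassOver M) → ClassOver M}
    (h : DfnClass 𝒮 c) : DfnClass 𝒮 (n := n + 1) (m := m) fun v V => c (Fin.init v) V := by
  refine Dfn.congr (h.reindex (liftFin Fin.castSucc)) fun v V => ?_
  have h₁ : Fin.init (v ∘ liftFin Fin.castSucc) = Fin.init (Fin.init v) := by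
    funext i; simp [liftFin, Fin.init]
  rw [h₁]; simp [liftFin]

theorem DfnTerm.var (i : Fin n) : DfnTerm 𝒮 (M := M) (m := m) fun v _ => (v i).1 :=
  ⟨fun v _ => (v i).2, (Dfn.varEq (Fin.last n) i.castSucc).congr fun _ _ => Subtype.ext_iff.symm⟩

theorem DfnTerm.const (a : Elt M) : DfnTerm 𝒮 (n := n) (m := m) fun _ _ => a.1 :=
  ⟨fun _ _ => a.2, (Dfn.eqConst (Fin.last n) a).congr fun _ _ => Subtype.ext_iff.symm⟩

theorem DfnTerm.const' {a : ZFSet.{u}} (ha : a ∈ M) : DfnTerm 𝒮 (n := n) (m := m) fun _ _ => a :=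
  DfnTerm.const ⟨a, ha⟩

theorem DfnClass.var (k : Fin m) : DfnClass 𝒮 (M := M) (n := n) fun _ V => V k :=
  Dfn.varMemClass _ _

theorem DfnClass.const {C : ClassOver M} (hC : C ∈ 𝒮) : DfnClass 𝒮 (n := n) (m := m) fun _ _ => C :=
  Dfn.memConstClass _ hC

theorem DfnClass.set {t : (Fin n → Elt M) → (Fin m → ClassOver M) → Elt M → Prop}
    (h : Dfn 𝒮 (n := n + 1) (m := m) fun v V => t (Fin.init v) V (v (Fin.last n))) :
    DfnClass 𝒮 fun v V => {x | t v V x} :=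
  h

/-- A term enters a formula only through its graph: since its value lies in `M`, an atomic statement
about terms becomes an existential statement about their values. -/
theorem Dfn.eq {s t : (Fin n → Elt M) → (Fin m → ClassOver M) → ZFSet.{u}} (hs : DfnTerm 𝒮 s)
    (ht : DfnTerm 𝒮 t) : Dfn 𝒮 fun v V => s v V = t v V :=
  (Dfn.ex (P := fun v x V => x.1 = s v V ∧ x.1 = t v V) (hs.2.and ht.2)).congr fun v V =>
    ⟨fun h => ⟨⟨s v V, hs.1 v V⟩, rfl, h⟩, fun ⟨_, h₁, h₂⟩ => h₁.symm.trans h₂⟩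

theorem Dfn.eqElt {s t : (Fin n → Elt M) → (Fin m → ClassOver M) → Elt M}
    (hs : DfnTerm 𝒮 fun v V => (s v V).1) (ht : DfnTerm 𝒮 fun v V => (t v V).1) :
    Dfn 𝒮 fun v V => s v V = t v V :=
  (Dfn.eq hs ht).congr fun _ _ => Subtype.ext_iff

theorem Dfn.mem {s t : (Fin n → Elt M) → (Fin m → ClassOver M) → ZFSet.{u}} (hs : DfnTerm 𝒮 s)
    (ht : DfnTerm 𝒮 t) : Dfn 𝒮 fun v V => s v V ∈ t v V :=
  (Dfn.ex (P := fun v x V => x.1 = s v V ∧ ∃ y : Elt M, y.1 = t v V ∧ x.1 ∈ y.1)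
    (hs.2.and (Dfn.ex (P := fun v y V => y.1 = t (Fin.init v) V ∧ (v (Fin.last n)).1 ∈ y.1)
      (ht.weaken.2.and (Dfn.varMem (Fin.last n).castSucc _))))).congr fun v V =>
    ⟨fun h => ⟨⟨s v V, hs.1 v V⟩, rfl, ⟨t v V, ht.1 v V⟩, rfl, h⟩,
      fun ⟨_, h₁, _, h₂, h₃⟩ => h₁ ▸ h₂ ▸ h₃⟩

theorem Dfn.memClass {s : (Fin n → Elt M) → (Fin m → ClassOver M) → Elt M}
    {c : (Fin n → Elt M) → (Fin m → ClassOver M) → ClassOver M}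
    (hs : DfnTerm 𝒮 fun v V => (s v V).1) (hc : DfnClass 𝒮 c) : Dfn 𝒮 fun v V => s v V ∈ c v V :=
  (Dfn.ex (P := fun v x V => x.1 = (s v V).1 ∧ x ∈ c v V) (hs.2.and hc)).congr fun v V =>
    ⟨fun h => ⟨s v V, rfl, h⟩, fun ⟨_, h₁, h₂⟩ => Subtype.ext h₁ ▸ h₂⟩

/-- Substitution of definable terms and classes for the variables of a formula. -/
theorem Dfn.sat {N K : ℕ} (φ : ClassFormula N K) (hφ : φ.IsElementary) : ∀ {n m : ℕ}
    {s : Fin N → (Fin n → Elt M) → (Fin m → ClassOver M) → Elt M}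
    (_ : ∀ i, DfnTerm 𝒮 fun v V => (s i v V).1)
    {c : Fin K → (Fin n → Elt M) → (Fin m → ClassOver M) → ClassOver M}
    (_ : ∀ k, DfnClass 𝒮 (c k)),
    Dfn 𝒮 fun v V => ElemSat φ (fun i => s i v V) fun k => c k v V := by
  induction φ with
  | mem i j => exact fun hs _ _ => Dfn.mem (hs i) (hs j)
  | eq i j => exact fun hs _ _ => Dfn.eqElt (hs i) (hs j)
  | memClass i k => exact fun hs _ hc => Dfn.memClass (hs i) (hc k)
  | neg φ ih => exact fun hs _ hc => (ih hφ hs hc).not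
  | conj φ ψ ih₁ ih₂ => exact fun hs _ hc => (ih₁ hφ.1 hs hc).and (ih₂ hφ.2 hs hc)
  | @allSet N K φ ih =>
    intro n m s hs c hc
    refine Dfn.all (P := fun v x V => ElemSat φ
      (Fin.snoc (α := fun _ : Fin (N + 1) => Elt M) (fun i => s i v V) x) fun k => c k v V) ?_
    refine (ih hφ (s := Fin.snoc (α := fun _ => (Fin (n + 1) → Elt M) → (Fin m → ClassOver M) →
      Elt M) (fun i v V => s i (Fin.init v) V) fun v _ => v (Fin.last n)) (fun i => ?_)
      (c := fun k v V => c k (Fin.init v) V) fun k => (hc k).weaken).congr fun v V => ?_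
    · refine Fin.lastCases ?_ (fun i => ?_) i
      · simpa using DfnTerm.var (Fin.last n)
      · simpa using (hs i).weaken
    · apply iff_of_eq
      congr 1
      funext i
      refine Fin.lastCases ?_ (fun i => ?_) i <;> simp
  | allClass => exact hφ.elim

/-- The parameters hidden in `P` are substituted along with its variables. Allowing `𝒮'` to differ
from `𝒮` is what makes relative definability transitive. -/
theorem Dfn.subst {𝒮' : Set (ClassOver M)} {N K : ℕ}
    {P : (Fin N → Elt M) → (Fin K → ClassOver M) → Prop}
    (h : Dfn 𝒮' P) (h𝒮 : ∀ C ∈ 𝒮', DfnClass 𝒮 (n := n) (m := m) fun _ _ => C)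
    (s : Fin N → (Fin n → Elt M) → (Fin m → ClassOver M) → Elt M)
    (c : Fin K → (Fin n → Elt M) → (Fin m → ClassOver M) → ClassOver M)
    (hs : ∀ i, DfnTerm 𝒮 fun v V => (s i v V).1)
    (hc : ∀ k, DfnClass 𝒮 (c k)) :
    Dfn 𝒮 fun v V => P (fun i => s i v V) fun k => c k v V := by
  obtain ⟨k, l, w, C, φ, h₁, h₂, h₃⟩ := h
  refine (Dfn.sat φ h₁ (n := n) (m := m) (s := Fin.addCases (fun i _ _ => w i) s)
    (fun i => ?_) (c := Fin.addCases c (fun i _ _ => C i)) fun i => ?_).congr fun v V => ?_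
  · refine Fin.addCases (fun i => ?_) (fun i => ?_) i
    · simpa using DfnTerm.const (w i)
    · simpa using hs i
  · refine Fin.addCases (fun i => ?_) (fun i => ?_) i
    · simpa using hc i
    · simpa using h𝒮 _ (h₂ i)
  · rw [h₃]
    apply iff_of_eq
    congr 1 <;> funext i <;> refine Fin.addCases (fun i => ?_) (fun i => ?_) i <;> simp

end Calculus

theorem mem_definableFrom_iff {𝒮 : Set (ClassOver M)} {B : ClassOver M} :
    B ∈ definableFrom 𝒮 ↔ DfnClass 𝒮 (n := 0) (m := 0) fun _ _ => B := by
  constructor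
  · rintro ⟨n, m, φ, v, V, hφ, hV, rfl⟩
    refine (Dfn.sat φ hφ (n := 1) (m := 0) (s := Fin.snoc (α := fun _ =>
      (Fin 1 → Elt M) → (Fin 0 → ClassOver M) → Elt M) (fun i _ _ => v i) fun w _ => w 0)
      (fun i => ?_) (c := fun k _ _ => V k) fun k => DfnClass.const (hV k)).congr fun w _ => ?_
    · refine Fin.lastCases ?_ (fun i => ?_) i
      · simpa using DfnTerm.var (0 : Fin 1)
      · simpa using DfnTerm.const (v i)
    · simp only [Set.mem_ofPred_eq]
      apply iff_of_eq
      congr 1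
      funext i
      refine Fin.lastCases ?_ (fun i => ?_) i <;> simp
  · rintro ⟨k, l, w, C, φ, h₁, h₂, h₃⟩
    refine ⟨k, 0 + l, φ, w, Fin.append Fin.elim0 C, h₁, fun i => ?_, ?_⟩
    · refine Fin.addCases (fun i => i.elim0) (fun i => ?_) i
      simpa using h₂ i
    · ext x
      have h := h₃ ![x] Fin.elim0
      rw [Fin.append_right_eq_snoc] at h
      exact h

theorem subset_definableFrom (𝒮 : Set (ClassOver M)) : 𝒮 ⊆ definableFrom 𝒮 := fun _ h =>
  mem_definableFrom_iff.2 (DfnClass.const h)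

theorem DfnClass.of_mem_definableFrom {𝒮 : Set (ClassOver M)} {n m : ℕ} {B : ClassOver M}
    (h : B ∈ definableFrom 𝒮) : DfnClass 𝒮 (n := n) (m := m) fun _ _ => B :=
  Dfn.subst (mem_definableFrom_iff.1 h) (fun _ => DfnClass.const) (fun _ v _ => v (Fin.last n))
    (fun i => i.elim0) (fun _ => DfnTerm.var _) fun i => i.elim0

theorem definableFrom_definableFrom {𝒮 𝒮' : Set (ClassOver M)} (h : 𝒮 ⊆ definableFrom 𝒮') :
    definableFrom 𝒮 ⊆ definableFrom 𝒮' := fun _ hB =>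
  mem_definableFrom_iff.2 ((mem_definableFrom_iff.1 hB).subst
    (fun _ hC => DfnClass.of_mem_definableFrom (h hC)) (fun i v _ => v i) (fun k _ V => V k)
    (fun _ => DfnTerm.var _) fun _ => DfnClass.var _)

/-! ### Transitive models of `ZFC` -/

/-- `M` is a transitive model of `ZFC`. -/
class TransitiveModel (M : ZFSet.{u}) : Prop where
  trans : M.IsTransitive
  zfc : ModelsZFC M

section Closure

variable [hM : TransitiveModel M]

theorem mem_of_mem {x y : ZFSet.{u}} (h : x ∈ y) (hy : y ∈ M) : x ∈ M :=
  hM.trans.mem_trans h hy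

theorem elt_ext {x y : ZFSet.{u}} (hx : x ∈ M) (hy : y ∈ M)
    (h : ∀ z : Elt M, z.1 ∈ x ↔ z.1 ∈ y) : x = y := by
  ext z
  exact ⟨fun hz => (h ⟨z, mem_of_mem hz hx⟩).1 hz, fun hz => (h ⟨z, mem_of_mem hz hy⟩).2 hz⟩

theorem upair_mem {x y : ZFSet.{u}} (hx : x ∈ M) (hy : y ∈ M) : ({x, y} : ZFSet) ∈ M := by
  obtain ⟨p, hp⟩ := hM.zfc.pairing ⟨x, hx⟩ ⟨y, hy⟩
  have : p.1 = {x, y} := by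
    ext z
    rw [ZFSet.mem_pair]
    constructor
    · intro hz
      simpa [Subtype.ext_iff] using (hp ⟨z, mem_of_mem hz p.2⟩).1 hz
    · rintro (rfl | rfl)
      · exact (hp ⟨_, hx⟩).2 (Or.inl rfl)
      · exact (hp ⟨_, hy⟩).2 (Or.inr rfl)
  exact this ▸ p.2

theorem singleton_mem {x : ZFSet.{u}} (hx : x ∈ M) : ({x} : ZFSet) ∈ M := by
  simpa using upair_mem hx hx

theorem pair_mem {x y : ZFSet.{u}} (hx : x ∈ M) (hy : y ∈ M) : x.pair y ∈ M :=
  upair_mem (singleton_mem hx) (upair_mem hx hy)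

theorem sUnion_mem {x : ZFSet.{u}} (hx : x ∈ M) : (ZFSet.sUnion x) ∈ M := by
  obtain ⟨s, hs⟩ := hM.zfc.union ⟨x, hx⟩
  have : s.1 = ZFSet.sUnion x := by
    ext z
    rw [ZFSet.mem_sUnion]
    constructor
    · intro hz
      obtain ⟨y, h₁, h₂⟩ := (hs ⟨z, mem_of_mem hz s.2⟩).1 hz
      exact ⟨y, h₁, h₂⟩
    · rintro ⟨y, h₁, h₂⟩
      have hy := mem_of_mem h₁ hx
      exact (hs ⟨z, mem_of_mem h₂ hy⟩).2 ⟨⟨y, hy⟩, h₁, h₂⟩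
  exact this ▸ s.2

theorem union_mem {x y : ZFSet.{u}} (hx : x ∈ M) (hy : y ∈ M) : x ∪ y ∈ M := by
  rw [← ZFSet.sUnion_pair]; exact sUnion_mem (upair_mem hx hy)

theorem insert_mem {x y : ZFSet.{u}} (hx : x ∈ M) (hy : y ∈ M) : insert x y ∈ M := by
  have : insert x y = {x} ∪ y := by ext; simp
  exact this ▸ union_mem (singleton_mem hx) hy

theorem right_mem_of_pair_mem {x y : ZFSet.{u}} (h : x.pair y ∈ M) : y ∈ M :=
  mem_of_mem (ZFSet.mem_pair.2 (Or.inr rfl)) (mem_of_mem (ZFSet.mem_pair.2 (Or.inr rfl)) h)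

theorem empty_mem : (∅ : ZFSet.{u}) ∈ M := by
  obtain ⟨w, ⟨e, -, he⟩, -⟩ := hM.zfc.infinity
  have : e.1 = ∅ := (ZFSet.eq_empty _).2 fun z hz => he ⟨z, mem_of_mem hz e.2⟩ hz
  exact this ▸ e.2

theorem natCode_mem (n : ℕ) : natCode n ∈ M := by
  induction n with
  | zero => exact empty_mem
  | succ n ih => exact insert_mem ih ih

variable (M) in
/-- The set of natural numbers of `M`. -/
theorem exists_natCode_mem : ∃ w : Elt M, ∀ n : ℕ, natCode n ∈ w.1 := by
  obtain ⟨w, ⟨e, he, he'⟩, hw⟩ := hM.zfc.infinity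
  refine ⟨w, fun n => ?_⟩
  induction n with
  | zero =>
    have : e.1 = ∅ := (ZFSet.eq_empty _).2 fun z hz => he' ⟨z, mem_of_mem hz e.2⟩ hz
    rw [this] at he
    exact he
  | succ n ih =>
    obtain ⟨y, hy, hy'⟩ := hw ⟨_, natCode_mem n⟩ ih
    have : y.1 = insert (natCode n) (natCode n) := by
      refine elt_ext y.2 (insert_mem (natCode_mem n) (natCode_mem n)) fun z => ?_
      rw [hy', ZFSet.mem_insert_iff, or_comm, Subtype.ext_iff]
    rw [this] at hy
    exact hy

/-- The ordered pair, as an operation on the elements of `M`. -/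
def epair (x y : Elt M) : Elt M := ⟨x.1.pair y.1, pair_mem x.2 y.2⟩

/-- `{x} ∪ y`, as an operation on the elements of `M`. -/
def einsert (x y : Elt M) : Elt M := ⟨insert x.1 y.1, insert_mem x.2 y.2⟩

variable (M) in
/-- The numeral `n`, as an element of `M`. -/
noncomputable def enat (n : ℕ) : Elt M := ⟨natCode n, natCode_mem n⟩

variable (M) in
/-- The empty set, as an element of `M`. -/
def eempty : Elt M := ⟨∅, empty_mem⟩

@[simp] theorem epair_val (x y : Elt M) : (epair x y).1 = x.1.pair y.1 := rfl
@[simp] theorem einsert_val (x y : Elt M) : (einsert x y).1 = insert x.1 y.1 := rfl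
@[simp] theorem enat_val (n : ℕ) : (enat M n).1 = natCode n := rfl
@[simp] theorem eempty_val : (eempty M).1 = ∅ := rfl

@[simp] theorem epair_inj {x y x' y' : Elt M} : epair x y = epair x' y' ↔ x = x' ∧ y = y' := by
  rw [Subtype.ext_iff, Subtype.ext_iff, Subtype.ext_iff]
  exact ZFSet.pair_inj

@[simp] theorem not_mem_eempty (x : Elt M) : x.1 ∉ (eempty M).1 := ZFSet.notMem_empty _

theorem mem_einsert {x y z : Elt M} : z.1 ∈ (einsert x y).1 ↔ z = x ∨ z.1 ∈ y.1 := by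
  rw [Subtype.ext_iff]
  exact ZFSet.mem_insert_iff

theorem rel_iff {R : ClassOver M} {x y : Elt M} : R.Rel x y ↔ epair x y ∈ R :=
  ⟨fun ⟨_, hz, h⟩ => (Subtype.ext h : _ = epair x y) ▸ hz, fun h => ⟨_, h, rfl⟩⟩

theorem natCode_mem_natCode {i j : ℕ} : natCode.{u} i ∈ natCode j ↔ i < j := by
  induction j with
  | zero => simp [natCode]
  | succ j ih =>
    rw [natCode, ZFSet.mem_insert_iff, ih, Nat.lt_succ_iff_lt_or_eq, or_comm]
    refine or_congr_right ⟨fun h => ?_, fun h => h ▸ rfl⟩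
    have key : ∀ i j : ℕ, i < j → natCode.{u} i ∈ natCode j := by
      intro i j hij
      induction j with
      | zero => omega
      | succ j ihj =>
        rw [natCode, ZFSet.mem_insert_iff]
        rcases Nat.lt_succ_iff_lt_or_eq.1 hij with h | rfl
        · exact Or.inr (ihj h)
        · exact Or.inl rfl
    rcases lt_trichotomy i j with h' | h' | h'
    · exact (ZFSet.mem_irrefl _ (h ▸ key _ _ h')).elim
    · exact h'
    · exact (ZFSet.mem_irrefl _ (h ▸ key _ _ h')).elim

theorem natCode_injective : Function.Injective natCode.{u} := by
  intro i j h
  rcases lt_trichotomy i j with h' | h' | h'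
  · exact (ZFSet.mem_irrefl _ (h ▸ natCode_mem_natCode.2 h')).elim
  · exact h'
  · exact (ZFSet.mem_irrefl _ (h ▸ natCode_mem_natCode.2 h')).elim

theorem mem_natCode {x : ZFSet.{u}} {n : ℕ} : x ∈ natCode n ↔ ∃ i < n, x = natCode i := by
  induction n with
  | zero => simp [natCode]
  | succ n ih =>
    rw [natCode, ZFSet.mem_insert_iff, ih]
    constructor
    · rintro (rfl | ⟨i, hi, rfl⟩)
      · exact ⟨n, by omega, rfl⟩
      · exact ⟨i, by omega, rfl⟩
    · rintro ⟨i, hi, rfl⟩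
      rcases Nat.lt_succ_iff_lt_or_eq.1 hi with h | rfl
      · exact Or.inr ⟨i, h, rfl⟩
      · exact Or.inl rfl

@[simp] theorem enat_inj {i j : ℕ} : enat M i = enat M j ↔ i = j := by
  rw [Subtype.ext_iff]
  exact natCode_injective.eq_iff

end Closure

/-! ### Substitution into predicates of fixed arity -/

section Arity

variable {𝒮 : Set (ClassOver M)} {n m : ℕ}
  {x y z : (Fin n → Elt M) → (Fin m → ClassOver M) → Elt M}

/-- Definability of a unary, binary, ternary predicate of sets. -/
abbrev Dfn₁ (𝒮 : Set (ClassOver M)) (P : Elt M → Prop) : Prop :=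
  Dfn 𝒮 (n := 1) (m := 0) fun v _ => P (v 0)

/-- Definability of a predicate of several sets. -/
abbrev Dfn₂ (𝒮 : Set (ClassOver M)) (P : Elt M → Elt M → Prop) : Prop :=
  Dfn 𝒮 (n := 2) (m := 0) fun v _ => P (v 0) (v 1)

/-- Definability of a predicate of several sets. -/
abbrev Dfn₃ (𝒮 : Set (ClassOver M)) (P : Elt M → Elt M → Elt M → Prop) : Prop :=
  Dfn 𝒮 (n := 3) (m := 0) fun v _ => P (v 0) (v 1) (v 2)

theorem Dfn₁.comp {P : Elt M → Prop} (h : Dfn₁ 𝒮 P) (hx : DfnTerm 𝒮 fun v V => (x v V).1) :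
    Dfn 𝒮 fun v V => P (x v V) :=
  Dfn.subst h (fun _ => .const) (fun _ => x) (fun i => i.elim0) (fun _ => hx) fun i => i.elim0

theorem Dfn₂.comp {P : Elt M → Elt M → Prop} (h : Dfn₂ 𝒮 P)
    (hx : DfnTerm 𝒮 fun v V => (x v V).1) (hy : DfnTerm 𝒮 fun v V => (y v V).1) :
    Dfn 𝒮 fun v V => P (x v V) (y v V) :=
  Dfn.subst h (fun _ => .const) ![x, y] (fun i => i.elim0) (fun i => by fin_cases i <;> assumption)
    fun i => i.elim0

theorem Dfn₃.comp {P : Elt M → Elt M → Elt M → Prop} (h : Dfn₃ 𝒮 P)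
    (hx : DfnTerm 𝒮 fun v V => (x v V).1) (hy : DfnTerm 𝒮 fun v V => (y v V).1)
    (hz : DfnTerm 𝒮 fun v V => (z v V).1) :
    Dfn 𝒮 fun v V => P (x v V) (y v V) (z v V) :=
  Dfn.subst h (fun _ => .const) ![x, y, z] (fun i => i.elim0)
    (fun i => by fin_cases i <;> assumption) fun i => i.elim0

theorem dfnClass_iff {C : ClassOver M} : C ∈ definableFrom 𝒮 ↔ Dfn₁ 𝒮 fun x => x ∈ C :=
  mem_definableFrom_iff

end Arity

/-! ### Set-theoretic operations as definable terms -/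

section Terms

variable [hM : TransitiveModel M] {𝒮 : Set (ClassOver M)} {n m : ℕ}
  {s t : (Fin n → Elt M) → (Fin m → ClassOver M) → ZFSet.{u}}
  {x y z : (Fin n → Elt M) → (Fin m → ClassOver M) → Elt M}

theorem DfnTerm.insert (hs : DfnTerm 𝒮 s) (ht : DfnTerm 𝒮 t) :
    DfnTerm 𝒮 fun v V => insert (s v V) (t v V) := by
  refine ⟨fun v V => insert_mem (hs.1 v V) (ht.1 v V), Dfn.congr (P := fun v V => ∀ z : Elt M,
    z.1 ∈ (v (Fin.last n)).1 ↔ z.1 = s (Fin.init v) V ∨ z.1 ∈ t (Fin.init v) V) ?_ fun v V => ?_⟩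
  · exact Dfn.all (P := fun v z V => z.1 ∈ (v (Fin.last n)).1 ↔ z.1 = s (Fin.init v) V ∨
        z.1 ∈ t (Fin.init v) V) ((Dfn.mem (.var _) (.var _)).iff
      ((Dfn.eq (.var _) hs.weaken.weaken).or (Dfn.mem (.var _) ht.weaken.weaken)))
  · constructor
    · intro h z
      rw [h, ZFSet.mem_insert_iff]
    · intro h
      refine elt_ext (v _).2 (insert_mem (hs.1 _ V) (ht.1 _ V)) fun z => ?_
      rw [h, ZFSet.mem_insert_iff]

theorem DfnTerm.empty : DfnTerm (M := M) 𝒮 (n := n) (m := m) fun _ _ => ∅ :=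
  .const' empty_mem

theorem DfnTerm.pair (hs : DfnTerm 𝒮 s) (ht : DfnTerm 𝒮 t) :
    DfnTerm 𝒮 fun v V => (s v V).pair (t v V) := by
  have h := (hs.insert .empty).insert ((hs.insert (ht.insert .empty)).insert .empty)
  exact ⟨h.1, h.2⟩

theorem DfnTerm.epair (hs : DfnTerm 𝒮 fun v V => (x v V).1) (ht : DfnTerm 𝒮 fun v V => (y v V).1) :
    DfnTerm 𝒮 fun v V => (epair (x v V) (y v V)).1 :=
  hs.pair ht

theorem DfnTerm.einsert (hs : DfnTerm 𝒮 fun v V => (x v V).1)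
    (ht : DfnTerm 𝒮 fun v V => (y v V).1) :
    DfnTerm 𝒮 fun v V => (einsert (x v V) (y v V)).1 :=
  hs.insert ht

theorem Dfn.subset (hs : DfnTerm 𝒮 s) (ht : DfnTerm 𝒮 t) : Dfn 𝒮 fun v V => s v V ⊆ t v V := by
  refine Dfn.congr (P := fun v V => ∀ z : Elt M, z.1 ∈ s v V → z.1 ∈ t v V)
    (Dfn.all (P := fun v z V => z.1 ∈ s v V → z.1 ∈ t v V)
    ((Dfn.mem (.var _) hs.weaken).imp (Dfn.mem (.var _) ht.weaken))) fun v V => ?_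
  exact ⟨fun h z hz => h hz, fun h z hz => h ⟨z, mem_of_mem hz (hs.1 v V)⟩ hz⟩

theorem Dfn.rel {R : (Fin n → Elt M) → (Fin m → ClassOver M) → ClassOver M}
    (hR : DfnClass 𝒮 R) (hx : DfnTerm 𝒮 fun v V => (x v V).1) (hy : DfnTerm 𝒮 fun v V => (y v V).1) :
    Dfn 𝒮 fun v V => (R v V).Rel (x v V) (y v V) :=
  (Dfn.memClass (hx.epair hy) hR).congr fun _ _ => rel_iff

theorem Dfn.lt {R : (Fin n → Elt M) → (Fin m → ClassOver M) → ClassOver M}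
    (hR : DfnClass 𝒮 R) (hx : DfnTerm 𝒮 fun v V => (x v V).1) (hy : DfnTerm 𝒮 fun v V => (y v V).1) :
    Dfn 𝒮 fun v V => (R v V).Lt (x v V) (y v V) :=
  (Dfn.rel hR hx hy).and (Dfn.eqElt hx hy).not

end Terms

/-- Proves definability by syntactic decomposition, using the hypotheses in the context. -/
theorem definability {p : Prop} (h : p := by
    repeat' first
      | assumption
      | exact DfnTerm.var _
      | apply_assumption
      | with_reducible apply Dfn.not
      | with_reducible apply Dfn.and
      | with_reducible apply Dfn.or
      | with_reducible apply Dfn.iff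
      | with_reducible apply Dfn.imp
      | with_reducible apply Dfn.all
      | with_reducible apply Dfn.ex
      | with_reducible apply Dfn.memClass
      | with_reducible apply Dfn.mem
      | with_reducible apply Dfn.eqElt
      | with_reducible apply Dfn.eq
      | with_reducible apply Dfn.subset
      | with_reducible apply Dfn.rel
      | with_reducible apply Dfn.lt
      | with_reducible apply DfnTerm.epair
      | with_reducible apply DfnTerm.pair
      | with_reducible apply DfnTerm.einsert
      | with_reducible apply DfnTerm.insert
      | exact DfnClass.var _
      | with_reducible exact DfnTerm.empty
      | with_reducible exact DfnTerm.const _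
      | with_reducible exact DfnTerm.const' (by assumption)
      | with_reducible exact DfnClass.const (by assumption)
      | with_reducible apply DfnClass.set
      | with_reducible exact Dfn.prop _) : p :=
  h

/-! ### Definable orbits -/

section Orbit

variable [hM : TransitiveModel M]

/-- The sequence `f` may be external to `M`; its finite pieces are nevertheless sets of `M`, by
repeated insertion. -/
theorem exists_finite_range (f : ℕ → Elt M) (n : ℕ) :
    ∃ s : Elt M, ∀ z : Elt M, z.1 ∈ s.1 ↔ ∃ i < n, z = f i := by
  induction n with
  | zero => exact ⟨eempty M, by simp⟩
  | succ n ih =>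
    obtain ⟨s, hs⟩ := ih
    refine ⟨einsert (f n) s, fun z => ?_⟩
    rw [mem_einsert, hs]
    constructor
    · rintro (rfl | ⟨i, hi, rfl⟩)
      · exact ⟨n, by omega, rfl⟩
      · exact ⟨i, by omega, rfl⟩
    · rintro ⟨i, hi, rfl⟩
      rcases Nat.lt_succ_iff_lt_or_eq.1 hi with h | rfl
      · exact Or.inr ⟨i, h, rfl⟩
      · exact Or.inl rfl

/-- The orbit of a set under a definable operation is definable as a sequence. -/
theorem dfn_orbit {𝒮 : Set (ClassOver M)} {g : Elt M → Elt M → Prop} (hg : Dfn₂ 𝒮 g)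
    {x : ℕ → Elt M} (hx : ∀ n y, g (x n) y ↔ y = x (n + 1)) :
    Dfn₂ 𝒮 fun c y => ∃ n, c = enat M n ∧ y = x n := by
  -- The substitution form of the hypothesis is put in the context so that the search in
  -- `definability` can apply it to arbitrary terms.
  have hg' := @hg.comp
  -- The witness `s` need not be finite or functional: every member only has to be the initial pair
  -- or the successor of another member. Going backwards lowers the first coordinate in the relation
  -- `∈`, so the descent ends at the initial pair.
  have key : Dfn₂ 𝒮 fun c y => ∃ s : Elt M, (epair c y).1 ∈ s.1 ∧ ∀ z : Elt M, z.1 ∈ s.1 →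
      (z = epair (eempty M) (x 0) ∨ ∃ c' y' y'' : Elt M, (epair c' y').1 ∈ s.1 ∧ g y' y'' ∧
        z = epair (einsert c' c') y'') := definability
  refine key.congr fun v _ => ?_
  constructor
  · rintro ⟨n, hc, hy⟩
    obtain ⟨s, hs⟩ := exists_finite_range (fun i => epair (enat M i) (x i)) (n + 1)
    refine ⟨s, (hs _).2 ⟨n, by omega, by rw [hc, hy]⟩, fun z hz => ?_⟩
    obtain ⟨i, hi, rfl⟩ := (hs z).1 hz
    cases i with
    | zero => exact Or.inl rfl
    | succ i =>
      exact Or.inr ⟨enat M i, x i, x (i + 1), (hs _).2 ⟨i, by omega, rfl⟩, (hx _ _).2 rfl, rfl⟩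
  · rintro ⟨s, hs, hs'⟩
    have main : ∀ c : ZFSet.{u}, ∀ hc : c ∈ M, ∀ y : Elt M, (epair ⟨c, hc⟩ y).1 ∈ s.1 →
        ∃ n, (⟨c, hc⟩ : Elt M) = enat M n ∧ y = x n := by
      intro c
      induction c using ZFSet.inductionOn with
      | _ c ih =>
        intro hc y hy
        rcases hs' _ hy with h | ⟨c', y', y'', h₁, h₂, h₃⟩
        · rw [epair_inj] at h
          exact ⟨0, h⟩
        · rw [epair_inj] at h₃
          obtain ⟨h₃, rfl⟩ := h₃
          obtain ⟨n, h₄, rfl⟩ := ih c'.1 (by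
            rw [Subtype.ext_iff] at h₃
            simp only [einsert_val] at h₃
            rw [h₃]; exact ZFSet.mem_insert _ _) c'.2 y' h₁
          refine ⟨n + 1, ?_, (hx _ _).1 h₂⟩
          rw [h₃]
          have h₄ : c' = enat M n := h₄
          rw [h₄]; rfl
    exact main (v 0).1 (v 0).2 (v 1) hs

theorem dfn_nat {𝒮 : Set (ClassOver M)} : Dfn₁ 𝒮 fun i => ∃ n, i = enat M n :=
  ((dfn_orbit (g := fun i j => j = einsert i i) definability (x := enat M)
    fun _ _ => Iff.rfl).comp (.var 0) (.var 0)).congr fun _ _ => by simp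

end Orbit

/-! ### Models of `GB` -/

namespace IsGBExpansion

variable [hM : TransitiveModel M] {𝒲 : World M} (hW : IsGBExpansion M 𝒲)

include hW

omit hM in
theorem set_mem {P : Elt M → Prop} (hP : Dfn₁ 𝒲 P) : {x | P x} ∈ 𝒲 :=
  hW.comprehension (dfnClass_iff.2 hP)

theorem repl {F : Elt M → Elt M → Prop} (hF : Dfn₂ 𝒲 F)
    (hfun : ∀ x y y', F x y → F x y' → y = y') (a : Elt M) :
    ∃ b : Elt M, ∀ y : Elt M, y.1 ∈ b.1 ↔ ∃ x : Elt M, x.1 ∈ a.1 ∧ F x y := by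
  have hF' := @hF.comp
  have hC : {z : Elt M | ∃ x y : Elt M, z = epair x y ∧ F x y} ∈ 𝒲 := hW.set_mem definability
  have hrel : ∀ x y : Elt M, ClassOver.Rel {z : Elt M | ∃ x y : Elt M, z = epair x y ∧ F x y} x y ↔
      F x y := by
    intro x y
    rw [rel_iff]
    constructor
    · rintro ⟨x', y', h, h'⟩
      obtain ⟨rfl, rfl⟩ := epair_inj.1 h
      exact h'
    · exact fun h => ⟨x, y, rfl, h⟩
  obtain ⟨b, hb⟩ := hW.replacement _ hC (fun x y y' => by simpa only [hrel] using hfun x y y') a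
  exact ⟨b, fun y => by simpa only [hrel] using hb y⟩

theorem sep {P : Elt M → Prop} (hP : Dfn₁ 𝒲 P) (a : Elt M) :
    ∃ b : Elt M, ∀ x : Elt M, x.1 ∈ b.1 ↔ x.1 ∈ a.1 ∧ P x := by
  have hP' := @hP.comp
  obtain ⟨b, hb⟩ := hW.repl (F := fun x y => x = y ∧ P x) definability
    (fun x y y' h h' => h.1.symm.trans h'.1) a
  refine ⟨b, fun x => (hb x).trans ⟨?_, fun h => ⟨x, h.1, rfl, h.2⟩⟩⟩
  rintro ⟨x, h, rfl, h'⟩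
  exact ⟨h, h'⟩

/-- Replacement along a set containing all numerals. That set may contain more, but the definable
sequence is empty elsewhere. -/
theorem orbit {g : Elt M → Elt M → Prop} (hg : Dfn₂ 𝒲 g)
    {x : ℕ → Elt M} (hx : ∀ n y, g (x n) y ↔ y = x (n + 1)) :
    ∃ b : Elt M, ∀ y : Elt M, y.1 ∈ b.1 ↔ ∃ n, y = x n := by
  obtain ⟨w, hw⟩ := exists_natCode_mem M
  obtain ⟨b, hb⟩ := hW.repl (dfn_orbit hg hx) (by
    rintro c y y' ⟨n, rfl, rfl⟩ ⟨n', h, rfl⟩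
    rw [enat_inj.1 h]) w
  refine ⟨b, fun y => (hb y).trans ⟨?_, ?_⟩⟩
  · rintro ⟨_, _, n, _, h⟩
    exact ⟨n, h⟩
  · rintro ⟨n, h⟩
    exact ⟨enat M n, hw n, n, rfl, h⟩

/-- Otherwise the image of a set containing all numerals would be a set with every element of `M` as
a member, including itself. -/
theorem not_surjective {F : ClassOver M} (hF : F ∈ 𝒲)
    (hfun : ∀ x y y' : Elt M, F.Rel x y → F.Rel x y' → y = y') :
    ¬ ∀ y : Elt M, ∃ n : ℕ, F.Rel (enat M n) y := by
  intro hsurj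
  obtain ⟨w, hw⟩ := exists_natCode_mem M
  obtain ⟨b, hb⟩ := hW.replacement F hF hfun w
  obtain ⟨n, hn⟩ := hsurj b
  exact ZFSet.mem_irrefl _ ((hb b).2 ⟨enat M n, hw n, hn⟩)

end IsGBExpansion

/-! ### The cumulative hierarchy and collection -/

/-- `u` is a level of the cumulative hierarchy of `M`. -/
def IsLevel (u : Elt M) : Prop :=
  ∀ x y : Elt M, x.1 ∈ u.1 → y.1.rank ≤ x.1.rank → y.1 ∈ u.1

section Level

variable [hM : TransitiveModel M]

omit hM in
theorem IsLevel.trans {u x y : Elt M} (hu : IsLevel u) (hx : x.1 ∈ u.1) (hy : y.1 ∈ x.1) :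
    y.1 ∈ u.1 :=
  hu x y hx (ZFSet.rank_lt_of_mem hy).le

omit hM in
theorem IsLevel.rank_lt {u x z : Elt M} (hu : IsLevel u) (hz : z.1 ∉ u.1) (hx : x.1 ∈ u.1) :
    x.1.rank < z.1.rank :=
  not_le.1 fun h => hz (hu x z hx h)

theorem IsLevel.rank_le {u z : Elt M} (hu : IsLevel u) (hz : z.1 ∉ u.1) : u.1.rank ≤ z.1.rank :=
  ZFSet.rank_le_iff.2 fun x hx => hu.rank_lt (x := ⟨x, mem_of_mem hx u.2⟩) hz hx

/-- Levels are comparable: a member of `u'` outside `u` has rank at least that of `u`, and `u'` is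
closed downwards in rank. -/
theorem IsLevel.mem_of_not_subset {u u' : Elt M} (hu : IsLevel u) (hu' : IsLevel u')
    (h : ¬ u'.1 ⊆ u.1) : u.1 ∈ u'.1 := by
  obtain ⟨y, hy, hy'⟩ : ∃ y, y ∈ u'.1 ∧ y ∉ u.1 := by
    by_contra hc
    push Not at hc
    exact h fun y hy => hc y hy
  exact hu' ⟨y, mem_of_mem hy u'.2⟩ u hy (hu.rank_le (z := ⟨y, mem_of_mem hy u'.2⟩) hy')

omit hM in
theorem IsLevel.mem_of_subset {u x y : Elt M} (hu : IsLevel u) (hx : x.1 ∈ u.1)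
    (h : y.1 ⊆ x.1) : y.1 ∈ u.1 :=
  hu x y hx (ZFSet.rank_mono h)

/-- The first-order definition of the levels: the members of a history `h`. -/
def IsHistory (h : Elt M) : Prop :=
  ∀ u : Elt M, u.1 ∈ h.1 → ∀ x : Elt M, x.1 ∈ u.1 ↔
    ∃ w : Elt M, w.1 ∈ h.1 ∧ w.1 ∈ u.1 ∧ x.1 ⊆ w.1

/-- By `∈`-induction on `u`. A member `x` of `u` is included in an earlier level `w`. If `y` has
rank at most that of `x`, each element of `y` has rank at most that of some element of `x`, so it
lies in `w`; thus `y ⊆ w` and `y ∈ u`. -/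
theorem IsHistory.isLevel {h : Elt M} (hh : IsHistory h) : ∀ u : Elt M, u.1 ∈ h.1 → IsLevel u := by
  have main : ∀ u : ZFSet.{u}, ∀ hu : u ∈ M, u ∈ h.1 → IsLevel (⟨u, hu⟩ : Elt M) := by
    intro u
    induction u using ZFSet.inductionOn with
    | _ u ih =>
      intro hu huh x y hx hxy
      obtain ⟨w, hw, hwu, hxw⟩ := (hh ⟨u, hu⟩ huh x).1 hx
      refine (hh ⟨u, hu⟩ huh y).2 ⟨w, hw, hwu, fun z hz => ?_⟩
      obtain ⟨x', hx', hzx'⟩ := ZFSet.lt_rank_iff.1 ((ZFSet.rank_lt_of_mem hz).trans_le hxy)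
      exact ih w.1 hwu w.2 hw ⟨x', mem_of_mem hx' x.2⟩ ⟨z, mem_of_mem hz y.2⟩ (hxw hx') hzx'
  exact fun u => main u.1 u.2

/-- Within `M`, the set `V_{rank x}` is the union over `z ∈ x` of the power sets of `V_{rank z}`,
which the induction collects by replacement. -/
theorem exists_rank_level {𝒲 : World M} (hW : IsGBExpansion M 𝒲) (x : Elt M) :
    ∃ v : Elt M, (∃ h : Elt M, IsHistory h ∧ v.1 ∈ h.1) ∧
      ∀ y : Elt M, y.1 ∈ v.1 ↔ y.1.rank < x.1.rank := by
  obtain ⟨x, hx⟩ := x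
  induction x using ZFSet.inductionOn with
  | _ x ih =>
    have hlev : Dfn₁ 𝒲 fun v : Elt M => ∃ h : Elt M, IsHistory h ∧ v.1 ∈ h.1 := by
      unfold IsHistory
      exact definability
    have hlev' := @hlev.comp
    -- The conditions `z ⊆ v` and `z ∉ v` single out `V_{rank z}` among the levels without
    -- mentioning ranks, so the map is definable and functional.
    obtain ⟨b, hb⟩ := hW.repl (F := fun z v => (∃ h : Elt M, IsHistory h ∧ v.1 ∈ h.1) ∧
      z.1 ⊆ v.1 ∧ z.1 ∉ v.1) definability (by
        rintro z v v' ⟨⟨h, hh, hv⟩, h₁, h₂⟩ ⟨⟨h', hh', hv'⟩, h₁', h₂'⟩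
        replace hv := hh.isLevel v hv
        replace hv' := hh'.isLevel v' hv'
        by_contra hne
        have key : ∀ v v' : Elt M, IsLevel v → IsLevel v' → z.1 ⊆ v'.1 → z.1 ∉ v.1 →
            v.1 ⊆ v'.1 := by
          intro v v' hv hv' h₁ h₂ y hy
          obtain ⟨y', hy', hle⟩ := ZFSet.lt_rank_iff.1
            (hv.rank_lt (x := ⟨y, mem_of_mem hy v.2⟩) h₂ hy)
          exact hv' ⟨y', mem_of_mem hy' z.2⟩ ⟨y, mem_of_mem hy v.2⟩ (h₁ hy') hle
        exact hne (Subtype.ext (le_antisymm (key v v' hv hv' h₁' h₂) (key v' v hv' hv h₁ h₂')))) ⟨x, hx⟩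
    have hb' : ∀ v : Elt M, v.1 ∈ b.1 → (∃ h : Elt M, IsHistory h ∧ v.1 ∈ h.1) ∧ IsLevel v ∧
        ∃ z : Elt M, z.1 ∈ x ∧ z.1 ∉ v.1 := by
      intro v hv
      obtain ⟨z, hz, ⟨h, hh, hv⟩, h₁, h₂⟩ := (hb v).1 hv
      exact ⟨⟨h, hh, hv⟩, hh.isLevel v hv, z, hz, h₂⟩
    have hbx : ∀ z : Elt M, z.1 ∈ x → ∃ v : Elt M, v.1 ∈ b.1 ∧
        ∀ y : Elt M, y.1 ∈ v.1 ↔ y.1.rank < z.1.rank := by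
      intro z hz
      obtain ⟨v, hv, hvz⟩ := ih z.1 hz z.2
      exact ⟨v, (hb v).2 ⟨z, hz, hv, fun y hy => (hvz ⟨y, mem_of_mem hy z.2⟩).2
        (ZFSet.rank_lt_of_mem hy), fun h => lt_irrefl _ ((hvz z).1 h)⟩, hvz⟩
    obtain ⟨p, hp⟩ := hM.zfc.powerset ⟨_, sUnion_mem b.2⟩
    obtain ⟨u, hu⟩ := hW.sep (P := fun y => ∃ v : Elt M, v.1 ∈ b.1 ∧ y.1 ⊆ v.1) definability p
    have hu' : ∀ y : Elt M, y.1 ∈ u.1 ↔ y.1.rank < x.rank := by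
      intro y
      rw [hu]
      constructor
      · rintro ⟨-, v, hv, hyv⟩
        obtain ⟨-, hv', z, hz, hzv⟩ := hb' v hv
        exact ((ZFSet.rank_mono hyv).trans (hv'.rank_le hzv)).trans_lt (ZFSet.rank_lt_of_mem hz)
      · intro h
        obtain ⟨z, hz, hyz⟩ := ZFSet.lt_rank_iff.1 h
        obtain ⟨v, hv, hvz⟩ := hbx ⟨z, mem_of_mem hz hx⟩ hz
        have hyv : y.1 ⊆ v.1 := fun w hw => (hvz ⟨w, mem_of_mem hw y.2⟩).2
          ((ZFSet.rank_lt_of_mem hw).trans_le hyz)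
        exact ⟨(hp y).2 fun w hw => ZFSet.mem_sUnion.2 ⟨v, hv, hyv hw⟩, v, hv, hyv⟩
    have hul : IsLevel u := fun y z hy hzy => (hu' z).2 (hzy.trans_lt ((hu' y).1 hy))
    refine ⟨u, ?_, hu'⟩
    -- The history for `u` consists of `u` and all the levels that belong to `u`.
    obtain ⟨h, hh⟩ := hW.sep hlev u
    refine ⟨einsert u h, fun w hw y => ?_, ZFSet.mem_insert _ _⟩
    have hwl : IsLevel w := by
      rcases mem_einsert.1 hw with rfl | hw
      · exact hul
      · obtain ⟨-, k, hk, hwk⟩ := (hh w).1 hw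
        exact hk.isLevel w hwk
    constructor
    · intro hy
      rcases mem_einsert.1 hw with rfl | hw
      · obtain ⟨z, hz, hyz⟩ := ZFSet.lt_rank_iff.1 ((hu' y).1 hy)
        obtain ⟨v, hv, hvz⟩ := hbx ⟨z, mem_of_mem hz hx⟩ hz
        obtain ⟨hv', hvl, -⟩ := hb' v hv
        have hvw : v.1 ∈ w.1 := (hu' v).2 (lt_of_le_of_lt
          (hvl.rank_le (z := ⟨z, mem_of_mem hz hx⟩) fun h => lt_irrefl _ ((hvz _).1 h))
          (ZFSet.rank_lt_of_mem hz))
        exact ⟨v, mem_einsert.2 (Or.inr ((hh v).2 ⟨hvw, hv'⟩)), hvw, fun t ht =>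
          (hvz ⟨t, mem_of_mem ht y.2⟩).2 ((ZFSet.rank_lt_of_mem ht).trans_le hyz)⟩
      · obtain ⟨hwu, k, hk, hwk⟩ := (hh w).1 hw
        obtain ⟨t, ht, htw, hyt⟩ := (hk w hwk y).1 hy
        exact ⟨t, mem_einsert.2 (Or.inr ((hh t).2 ⟨hul.trans hwu htw, k, hk, ht⟩)), htw, hyt⟩
    · rintro ⟨t, -, htw, hyt⟩
      exact hwl.mem_of_subset htw hyt

/-! ### Collection, closure and dependent choice -/

namespace IsGBExpansion

variable {𝒲 : World M} (hW : IsGBExpansion M 𝒲)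

include hW

/-- `IsLevel` refers to ranks, but a level `u` coincides with `V_{rank u}`, and so it is a member of
a history, which is a first-order property. -/
theorem dfn_isLevel : Dfn₁ 𝒲 (IsLevel (M := M)) := by
  have hlev : Dfn₁ 𝒲 fun v : Elt M => ∃ h : Elt M, IsHistory h ∧ v.1 ∈ h.1 := by
    unfold IsHistory
    exact definability
  refine hlev.congr fun v _ => ⟨fun hv => ?_, fun ⟨h, hh, hv⟩ => hh.isLevel _ hv⟩
  generalize v 0 = u at hv
  obtain ⟨u', ⟨h, hh, hu'⟩, hu⟩ := exists_rank_level hW u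
  have hul := hh.isLevel u' hu'
  have : u = u' := by
    by_contra hne
    by_cases hs : u'.1 ⊆ u.1
    · refine hne (Subtype.ext (le_antisymm (fun y hy => ?_) hs))
      exact (hu ⟨y, mem_of_mem hy u.2⟩).2 (ZFSet.rank_lt_of_mem hy)
    · exact lt_irrefl _ ((hu _).1 (hv.mem_of_not_subset hul hs))
  exact this ▸ ⟨h, hh, hu'⟩

theorem exists_level_mem (x : Elt M) : ∃ u : Elt M, IsLevel u ∧ x.1 ∈ u.1 := by
  obtain ⟨u, ⟨h, hh, hu⟩, hu'⟩ := exists_rank_level hW ⟨_, singleton_mem x.2⟩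
  exact ⟨u, hh.isLevel u hu, (hu' x).2 (ZFSet.rank_lt_of_mem (ZFSet.mem_singleton.2 rfl))⟩

/-- Scott's trick: each `x` is sent to the least level that contains a witness, and a level
containing all these levels is taken. -/
theorem collection {R : Elt M → Elt M → Prop} (hR : Dfn₂ 𝒲 R) (a : Elt M)
    (h : ∀ x : Elt M, x.1 ∈ a.1 → ∃ y, R x y) :
    ∃ u : Elt M, IsLevel u ∧ ∀ x : Elt M, x.1 ∈ a.1 → ∃ y : Elt M, y.1 ∈ u.1 ∧ R x y := by
  have hR' := @hR.comp
  have hL := @(hW.dfn_isLevel).comp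
  obtain ⟨b, hb⟩ := hW.repl (F := fun x v => IsLevel v ∧ (∃ y : Elt M, y.1 ∈ v.1 ∧ R x y) ∧
    ∀ v' : Elt M, IsLevel v' → (∃ y : Elt M, y.1 ∈ v'.1 ∧ R x y) → v.1 ⊆ v'.1) definability (by
      rintro x v v' ⟨h₁, h₂, h₃⟩ ⟨h₁', h₂', h₃'⟩
      exact Subtype.ext (le_antisymm (h₃ _ h₁' h₂') (h₃' _ h₁ h₂))) a
  obtain ⟨u, hu, hbu⟩ := hW.exists_level_mem b
  refine ⟨u, hu, fun x hx => ?_⟩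
  obtain ⟨y₀, hy₀⟩ := h x hx
  obtain ⟨v₀, hv₀, hyv₀⟩ := hW.exists_level_mem y₀
  obtain ⟨v, ⟨hv, hv'⟩, hmin⟩ := (InvImage.wf (Subtype.val : Elt M → ZFSet.{u})
    ZFSet.mem_wf).has_min {v : Elt M | IsLevel v ∧ ∃ y : Elt M, y.1 ∈ v.1 ∧ R x y}
    ⟨v₀, hv₀, y₀, hyv₀, hy₀⟩
  have hvb : v.1 ∈ b.1 := by
    refine (hb v).2 ⟨x, hx, hv, hv', fun v' h₁ h₂ => ?_⟩
    by_contra hc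
    exact hmin v' ⟨h₁, h₂⟩ (h₁.mem_of_not_subset hv hc)
  obtain ⟨y, hy, hxy⟩ := hv'
  exact ⟨y, hu.trans (hu.trans hbu hvb) hy, hxy⟩

/-- A set closed under a total definable relation. -/
theorem exists_closed {R : Elt M → Elt M → Prop} (hR : Dfn₂ 𝒲 R) (h : ∀ x, ∃ y, R x y)
    (x₀ : Elt M) : ∃ C : Elt M, x₀.1 ∈ C.1 ∧
      ∀ x : Elt M, x.1 ∈ C.1 → ∃ y : Elt M, y.1 ∈ C.1 ∧ R x y := by
  have hR' := @hR.comp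
  have hL := @(hW.dfn_isLevel).comp
  let Q : Elt M → Elt M → Prop := fun u v => IsLevel v ∧
    ∀ x : Elt M, x.1 ∈ u.1 → ∃ y : Elt M, y.1 ∈ v.1 ∧ R x y
  have hQ : Dfn₂ 𝒲 Q := definability
  have hQ' := @hQ.comp
  -- Taking the least suitable level makes the step functional; its orbit is then a set, and the
  -- union of the orbit is the closed set.
  have hstep : ∀ u : Elt M, ∃ v, Q u v ∧ ∀ v', Q u v' → v.1 ⊆ v'.1 := by
    intro u
    obtain ⟨v₀, hv₀⟩ := hW.collection hR u fun x _ => h x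
    obtain ⟨v, hv, hmin⟩ := (InvImage.wf (Subtype.val : Elt M → ZFSet.{u})
      ZFSet.mem_wf).has_min {v : Elt M | Q u v} ⟨v₀, hv₀⟩
    refine ⟨v, hv, fun v' hv' => ?_⟩
    by_contra hc
    exact hmin v' hv' (hv'.1.mem_of_not_subset hv.1 hc)
  choose f hf hf' using hstep
  let x : ℕ → Elt M := fun n => f^[n] (einsert x₀ (eempty M))
  have hx : ∀ n, x (n + 1) = f (x n) := fun n => Function.iterate_succ_apply' _ _ _
  obtain ⟨b, hb⟩ := hW.orbit (g := fun u v => Q u v ∧ ∀ v', Q u v' → v.1 ⊆ v'.1) definability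
    (x := x) fun n y => by
      rw [hx]
      exact ⟨fun hy => Subtype.ext (le_antisymm (hy.2 _ (hf _)) (hf' _ _ hy.1)),
        fun hy => hy ▸ ⟨hf _, hf' _⟩⟩
  refine ⟨⟨_, sUnion_mem b.2⟩, ZFSet.mem_sUnion.2 ⟨_, (hb (x 0)).2 ⟨0, rfl⟩, ZFSet.mem_insert _ _⟩,
    fun y hy => ?_⟩
  obtain ⟨u, hu, hyu⟩ := ZFSet.mem_sUnion.1 hy
  obtain ⟨n, hn⟩ := (hb ⟨u, mem_of_mem hu b.2⟩).1 hu
  obtain ⟨z, hz, hyz⟩ := (hf (x n)).2 y (hn ▸ hyu)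
  exact ⟨z, ZFSet.mem_sUnion.2 ⟨_, (hb (x (n + 1))).2 ⟨n + 1, rfl⟩, hx n ▸ hz⟩, hyz⟩

/-- Dependent choice for definable relations. -/
theorem dependent_choice {R : Elt M → Elt M → Prop} (hR : Dfn₂ 𝒲 R) (h : ∀ x, ∃ y, R x y)
    (x₀ : Elt M) : ∃ (x : ℕ → Elt M) (b : Elt M), x 0 = x₀ ∧ (∀ n, R (x n) (x (n + 1))) ∧
      ∀ y : Elt M, y.1 ∈ b.1 ↔ ∃ n, y = x n := by
  have hR' := @hR.comp
  obtain ⟨C, hC₀, hC⟩ := hW.exists_closed hR h x₀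
  have hfib : ∀ x : Elt M, ∃ s : Elt M, ∀ z : Elt M, z.1 ∈ s.1 ↔
      ∃ y : Elt M, y.1 ∈ C.1 ∧ R x y ∧ z = epair x y := by
    intro x
    obtain ⟨s, hs⟩ := hW.repl (F := fun y z => R x y ∧ z = epair x y) definability
      (fun _ _ _ h h' => h.2.trans h'.2.symm) C
    exact ⟨s, hs⟩
  -- The members of `a` are the fibres of `R` inside `C`, made disjoint by recording `x`. A choice
  -- set for them is a successor function in `M`, and so the resulting sequence has its range in
  -- `M`.
  obtain ⟨a, ha⟩ := hW.repl (F := fun x s => ∀ z : Elt M, z.1 ∈ s.1 ↔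
      ∃ y : Elt M, y.1 ∈ C.1 ∧ R x y ∧ z = epair x y) definability
      (fun x s s' hs hs' => Subtype.ext (elt_ext s.2 s'.2 fun z => (hs z).trans (hs' z).symm)) C
  obtain ⟨c, hc⟩ := hM.zfc.choice a (by
    intro s hs
    obtain ⟨x, hx, hs⟩ := (ha s).1 hs
    obtain ⟨y, hy, hxy⟩ := hC x hx
    exact ⟨_, (hs _).2 ⟨y, hy, hxy, rfl⟩⟩) (by
    rintro s s' hs hs' hne ⟨z, hz, hz'⟩
    obtain ⟨x, hx, hs⟩ := (ha s).1 hs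
    obtain ⟨x', hx', hs'⟩ := (ha s').1 hs'
    obtain ⟨y, -, -, rfl⟩ := (hs z).1 hz
    obtain ⟨y', -, -, hy'⟩ := (hs' _).1 hz'
    obtain ⟨rfl, rfl⟩ := epair_inj.1 hy'
    exact hne (Subtype.ext (elt_ext s.2 s'.2 fun z => (hs z).trans (hs' z).symm)))
  have hg : ∀ x : Elt M, x.1 ∈ C.1 → ∃ y : Elt M, (y.1 ∈ C.1 ∧ R x y ∧ (epair x y).1 ∈ c.1) ∧
      ∀ y' : Elt M, y'.1 ∈ C.1 ∧ R x y' ∧ (epair x y').1 ∈ c.1 → y' = y := by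
    intro x hx
    obtain ⟨s, hs⟩ := hfib x
    obtain ⟨z, ⟨hz, hzc⟩, huniq⟩ := hc s ((ha s).2 ⟨x, hx, hs⟩)
    obtain ⟨y, hy, hxy, rfl⟩ := (hs z).1 hz
    refine ⟨y, ⟨hy, hxy, hzc⟩, fun y' h' => ?_⟩
    exact (epair_inj.1 (huniq _ ⟨(hs _).2 ⟨y', h'.1, h'.2.1, rfl⟩, h'.2.2⟩)).2
  choose! f hf hf' using hg
  let x : ℕ → Elt M := fun n => f^[n] x₀
  have hx : ∀ n, x (n + 1) = f (x n) := fun n => Function.iterate_succ_apply' _ _ _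
  have hxC : ∀ n, (x n).1 ∈ C.1 := by
    intro n
    induction n with
    | zero => exact hC₀
    | succ n ih => rw [hx]; exact (hf _ ih).1
  obtain ⟨b, hb⟩ := hW.orbit (g := fun x y => y.1 ∈ C.1 ∧ R x y ∧ (epair x y).1 ∈ c.1)
    definability (x := x) fun n y => by
      rw [hx]
      exact ⟨hf' _ (hxC n) y, fun hy => hy ▸ hf _ (hxC n)⟩
  exact ⟨x, b, rfl, fun n => hx n ▸ (hf _ (hxC n)).2.1, hb⟩

end IsGBExpansion

end Level

/-! ### Conditions -/

section Condition

variable [hM : TransitiveModel M]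

theorem rel_setOf {p x y : Elt M} :
    ClassOver.Rel {z : Elt M | z.1 ∈ p.1} x y ↔ (epair x y).1 ∈ p.1 :=
  rel_iff

theorem IsCondition.refl {p x y : Elt M} (hp : IsCondition p) (h : (epair x y).1 ∈ p.1) :
    (epair x x).1 ∈ p.1 ∧ (epair y y).1 ∈ p.1 := by
  simpa only [rel_setOf] using ClassOver.IsWellOrder.refl hp x y (rel_setOf.2 h)

theorem IsCondition.trans {p x y z : Elt M} (hp : IsCondition p) (h : (epair x y).1 ∈ p.1)
    (h' : (epair y z).1 ∈ p.1) : (epair x z).1 ∈ p.1 :=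
  rel_setOf.1 (ClassOver.IsWellOrder.trans hp x y z (rel_setOf.2 h) (rel_setOf.2 h'))

theorem IsCondition.antisymm {p x y : Elt M} (hp : IsCondition p) (h : (epair x y).1 ∈ p.1)
    (h' : (epair y x).1 ∈ p.1) : x = y :=
  ClassOver.IsWellOrder.antisymm hp x y (rel_setOf.2 h) (rel_setOf.2 h')

theorem IsCondition.total {p x y : Elt M} (hp : IsCondition p) (h : (epair x x).1 ∈ p.1)
    (h' : (epair y y).1 ∈ p.1) : (epair x y).1 ∈ p.1 ∨ (epair y x).1 ∈ p.1 := by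
  simpa only [rel_setOf] using
    ClassOver.IsWellOrder.total hp x y (rel_setOf.2 h) (rel_setOf.2 h')

theorem IsCondition.exists_min {p : Elt M} (hp : IsCondition p) {S : Set (Elt M)}
    (hS : S.Nonempty) (h : ∀ x ∈ S, (epair x x).1 ∈ p.1) :
    ∃ m ∈ S, ∀ x ∈ S, (epair m x).1 ∈ p.1 := by
  simpa only [rel_setOf] using
    ClassOver.IsWellOrder.wf hp S hS fun x hx => rel_setOf.2 (h x hx)

omit hM in
theorem EndExtends.refl (p : Elt M) : EndExtends p p :=
  ⟨fun _ h => h, fun _ _ _ h => h⟩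

omit hM in
theorem EndExtends.trans {p q r : Elt M} (h : EndExtends p q) (h' : EndExtends q r) :
    EndExtends p r :=
  ⟨fun _ hz => h.1 (h'.1 hz), fun x y hx hy => h'.2 x y hx (h.2 x y (h'.1 hx) hy)⟩

omit hM in
theorem EndExtends.of_chain {p : ℕ → Elt M} (h : ∀ n, EndExtends (p (n + 1)) (p n)) {m n : ℕ}
    (hmn : m ≤ n) : EndExtends (p n) (p m) := by
  induction n, hmn using Nat.le_induction with
  | base => exact .refl _
  | succ n _ ih => exact (h n).trans ih

theorem mem_of_mem_chain {p : ℕ → Elt M} (h : ∀ n, EndExtends (p (n + 1)) (p n)) {n k : ℕ}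
    {x y : Elt M} (hx : (epair x x).1 ∈ (p n).1) (hy : (epair y x).1 ∈ (p k).1) :
    (epair y x).1 ∈ (p n).1 := by
  rcases le_total n k with hnk | hnk
  · exact (EndExtends.of_chain h hnk).2 x y hx hy
  · exact (EndExtends.of_chain h hnk).1 hy

/-- Later conditions add nothing below an old point. Hence the least element of a set `S` of points
is already found in any `p n` whose field meets `S`. The chain may be external to `M`. -/
theorem isWellOrder_chain {p : ℕ → Elt M} (hp : ∀ n, IsCondition (p n))
    (h : ∀ n, EndExtends (p (n + 1)) (p n)) {R : ClassOver M}
    (hR : ∀ z, z ∈ R ↔ ∃ n, z.1 ∈ (p n).1) : R.IsWellOrder := by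
  have hle := fun {m n : ℕ} (hmn : m ≤ n) => (EndExtends.of_chain h hmn).1
  have hrel : ∀ x y, R.Rel x y ↔ ∃ n, (epair x y).1 ∈ (p n).1 := fun x y => by rw [rel_iff, hR]
  refine ⟨fun z hz => ?_, fun x y hxy => ?_, fun x y hxy hyx => ?_, fun x y z hxy hyz => ?_,
    fun x y hx hy => ?_, fun S ⟨x₀, hx₀⟩ hS => ?_⟩
  · obtain ⟨n, hn⟩ := (hR z).1 hz
    exact (hp n).pairs z hn
  · obtain ⟨n, hn⟩ := (hrel _ _).1 hxy
    exact ⟨(hrel _ _).2 ⟨n, ((hp n).refl hn).1⟩, (hrel _ _).2 ⟨n, ((hp n).refl hn).2⟩⟩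
  · obtain ⟨n, hn⟩ := (hrel _ _).1 hxy
    obtain ⟨k, hk⟩ := (hrel _ _).1 hyx
    exact (hp _).antisymm (hle (le_max_left n k) hn) (hle (le_max_right n k) hk)
  · obtain ⟨n, hn⟩ := (hrel _ _).1 hxy
    obtain ⟨k, hk⟩ := (hrel _ _).1 hyz
    exact (hrel _ _).2 ⟨_, (hp _).trans (hle (le_max_left n k) hn) (hle (le_max_right n k) hk)⟩
  · obtain ⟨n, hn⟩ := (hrel _ _).1 hx
    obtain ⟨k, hk⟩ := (hrel _ _).1 hy
    rw [hrel, hrel]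
    exact ((hp _).total (hle (le_max_left n k) hn) (hle (le_max_right n k) hk)).imp
      (fun h => ⟨_, h⟩) fun h => ⟨_, h⟩
  · obtain ⟨n, hn⟩ := (hrel _ _).1 (hS _ hx₀)
    obtain ⟨m, ⟨hm, hmn⟩, hmin⟩ := (hp n).exists_min (S := {x | x ∈ S ∧ (epair x x).1 ∈ (p n).1})
      ⟨x₀, hx₀, hn⟩ fun x hx => hx.2
    refine ⟨m, hm, fun x hx => (hrel _ _).2 ?_⟩
    by_cases hxn : (epair x x).1 ∈ (p n).1
    · exact ⟨n, hmin x ⟨hx, hxn⟩⟩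
    · obtain ⟨k, hk⟩ := (hrel _ _).1 (hS _ hx)
      refine ⟨max n k, ((hp _).total (hle (le_max_left n k) hmn)
        (hle (le_max_right n k) hk)).resolve_right fun hc => hxn ?_⟩
      exact ((hp n).refl ((EndExtends.of_chain h (le_max_left n k)).2 m x hmn hc)).1

/-- The order `q` is obtained from `p` by adding `t` as the largest element. -/
def IsSnoc (p t q : Elt M) : Prop :=
  ∀ z : Elt M, z.1 ∈ q.1 ↔ z.1 ∈ p.1 ∨ ∃ y : Elt M, z = epair y t ∧ (y = t ∨ (epair y y).1 ∈ p.1)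

theorem IsSnoc.pair_mem {p t q : Elt M} (h : IsSnoc p t q) {x y : Elt M} :
    (epair x y).1 ∈ q.1 ↔ (epair x y).1 ∈ p.1 ∨ y = t ∧ (x = t ∨ (epair x x).1 ∈ p.1) := by
  rw [h]
  refine or_congr_right ⟨?_, fun h => ⟨x, by rw [h.1], h.2⟩⟩
  rintro ⟨x', h₁, h₂⟩
  obtain ⟨rfl, rfl⟩ := epair_inj.1 h₁
  exact ⟨rfl, h₂⟩

theorem IsSnoc.isCondition {p t q : Elt M} (hq : IsSnoc p t q) (hp : IsCondition p)
    (ht : (epair t t).1 ∉ p.1) : IsCondition q := by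
  have hpt : ∀ x, (epair x t).1 ∉ p.1 := fun x hx => ht (hp.refl hx).2
  have htp : ∀ x, (epair t x).1 ∉ p.1 := fun x hx => ht (hp.refl hx).1
  refine ⟨fun z hz => ?_, ?_, ?_, ?_, ?_, ?_⟩
  · rcases (hq z).1 hz with h | ⟨y, rfl, -⟩
    · exact ClassOver.IsWellOrder.pairs hp z h
    · exact ⟨y, t, rfl⟩
  · intro x y
    simp only [rel_setOf, hq.pair_mem]
    rintro (h | ⟨rfl, rfl | h⟩)
    · exact ⟨Or.inl (hp.refl h).1, Or.inl (hp.refl h).2⟩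
    · exact ⟨Or.inr ⟨rfl, Or.inl rfl⟩, Or.inr ⟨rfl, Or.inl rfl⟩⟩
    · exact ⟨Or.inl h, Or.inr ⟨rfl, Or.inl rfl⟩⟩
  · intro x y
    simp only [rel_setOf, hq.pair_mem]
    rintro (h | ⟨rfl, h⟩) (h' | ⟨rfl, h'⟩)
    · exact hp.antisymm h h'
    · exact (htp _ h).elim
    · exact (htp _ h').elim
    · rfl
  · intro x y z
    simp only [rel_setOf, hq.pair_mem]
    rintro (h | ⟨rfl, h⟩) (h' | ⟨rfl, h'⟩)
    · exact Or.inl (hp.trans h h')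
    · exact Or.inr ⟨rfl, Or.inr (hp.refl h).1⟩
    · exact (htp _ h').elim
    · exact Or.inr ⟨rfl, h⟩
  · intro x y
    simp only [rel_setOf, hq.pair_mem]
    rintro (h | ⟨rfl, h⟩) (h' | ⟨rfl, h'⟩)
    · exact (hp.total h h').imp Or.inl Or.inl
    · exact Or.inl (Or.inr ⟨rfl, Or.inr h⟩)
    · exact Or.inr (Or.inr ⟨rfl, Or.inr h'⟩)
    · simp
  · rintro S ⟨x₀, hx₀⟩ hS
    simp only [rel_setOf, hq.pair_mem] at hS ⊢
    by_cases hSp : ∃ x ∈ S, (epair x x).1 ∈ p.1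
    · obtain ⟨x₁, hx₁, hx₁p⟩ := hSp
      obtain ⟨m, ⟨hm, hmp⟩, hmin⟩ := hp.exists_min (S := {x | x ∈ S ∧ (epair x x).1 ∈ p.1})
        ⟨x₁, hx₁, hx₁p⟩ fun x hx => hx.2
      refine ⟨m, hm, fun x hx => ?_⟩
      rcases hS x hx with h | ⟨rfl, -⟩
      · exact Or.inl (hmin x ⟨hx, h⟩)
      · exact Or.inr ⟨rfl, Or.inr hmp⟩
    · push Not at hSp
      have hall : ∀ x ∈ S, x = t := fun x hx => ((hS x hx).resolve_left (hSp x hx)).1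
      refine ⟨x₀, hx₀, fun x hx => Or.inr ⟨hall x hx, Or.inl (hall _ hx₀)⟩⟩

theorem IsSnoc.endExtends {p t q : Elt M} (h : IsSnoc p t q)
    (ht : (epair t t).1 ∉ p.1) : EndExtends q p := by
  refine ⟨fun z hz => (h ⟨z, mem_of_mem hz p.2⟩).2 (Or.inl hz), fun x y hx hy => ?_⟩
  rcases h.pair_mem.1 hy with h | ⟨rfl, -⟩
  · exact h
  · exact (ht hx).elim

theorem isCondition_eempty : IsCondition (eempty M) := by
  have h : ∀ x y : Elt M, ¬ ClassOver.Rel {z : Elt M | z.1 ∈ (eempty M).1} x y :=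
    fun x y hxy => not_mem_eempty _ (rel_setOf.1 hxy)
  exact ⟨fun z hz => (not_mem_eempty z hz).elim, fun _ _ hxy => (h _ _ hxy).elim,
    fun _ _ hxy => (h _ _ hxy).elim, fun _ _ _ hxy => (h _ _ hxy).elim,
    fun _ _ hxy => (h _ _ hxy).elim, fun _ ⟨x₀, hx₀⟩ hS => (h _ _ (hS x₀ hx₀)).elim⟩

theorem dfn_endExtends {𝒮 : Set (ClassOver M)} : Dfn₂ 𝒮 (EndExtends (M := M)) := by
  unfold EndExtends
  exact definability

/-- `h` is an attempt at the transitive collapse of `p`. -/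
def IsCollapse (p h : Elt M) : Prop :=
  ∀ x a : Elt M, (epair x a).1 ∈ h.1 →
    (∀ b : Elt M, b.1 ∈ a.1 ↔ ∃ y : Elt M, y ≠ x ∧ (epair y x).1 ∈ p.1 ∧ (epair y b).1 ∈ h.1) ∧
    ∀ y : Elt M, y ≠ x → (epair y x).1 ∈ p.1 → ∃ b : Elt M, (epair y b).1 ∈ h.1

/-! ### First-order definability of being a condition -/

namespace IsGBExpansion

variable {𝒲 : World M} (hW : IsGBExpansion M 𝒲)

include hW

theorem exists_snoc (p t : Elt M) : ∃ q, IsSnoc p t q := by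
  obtain ⟨b, hb⟩ := hW.repl (F := fun z w => ∃ y : Elt M, z = epair y y ∧ w = epair y t)
    definability (by
      rintro z w w' ⟨y, rfl, rfl⟩ ⟨y', h, rfl⟩
      rw [(epair_inj.1 h).1]) p
  refine ⟨einsert (epair t t) ⟨_, union_mem p.2 b.2⟩, fun z => ?_⟩
  rw [mem_einsert]
  simp only [ZFSet.mem_union, hb]
  constructor
  · rintro (rfl | h | ⟨_, h, y, rfl, rfl⟩)
    · exact Or.inr ⟨t, rfl, Or.inl rfl⟩
    · exact Or.inl h
    · exact Or.inr ⟨y, rfl, Or.inr h⟩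
  · rintro (h | ⟨y, rfl, rfl | h⟩)
    · exact Or.inr (Or.inl h)
    · exact Or.inl rfl
    · exact Or.inr (Or.inr ⟨_, h, y, rfl, rfl⟩)

/-- Recursion along `p`: collapse values are unique, so replacement gathers the values at the
predecessors of `x` into one attempt, to which the value at `x` is added. -/
theorem exists_collapse {p : Elt M} (hp : IsCondition p) (x : Elt M) (hx : (epair x x).1 ∈ p.1) :
    ∃ a h : Elt M, IsCollapse p h ∧ (epair x a).1 ∈ h.1 := by
  have hwf : WellFounded fun x y : Elt M => x ≠ y ∧ (epair x y).1 ∈ p.1 := by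
    rw [WellFounded.wellFounded_iff_has_min]
    rintro S ⟨y₀, hy₀⟩
    by_cases hS : ∃ y ∈ S, (epair y y).1 ∈ p.1
    · obtain ⟨y₁, hy₁, hy₁p⟩ := hS
      obtain ⟨m, ⟨hm, hmp⟩, hmin⟩ := hp.exists_min (S := {x | x ∈ S ∧ (epair x x).1 ∈ p.1})
        ⟨y₁, hy₁, hy₁p⟩ fun x hx => hx.2
      exact ⟨m, hm, fun y hy h => h.1 (hp.antisymm h.2 (hmin y ⟨hy, (hp.refl h.2).1⟩))⟩
    · exact ⟨y₀, hy₀, fun y hy h => hS ⟨y, hy, (hp.refl h.2).1⟩⟩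
  let K : Elt M → Elt M → Prop := fun x a => ∃ h : Elt M, IsCollapse p h ∧ (epair x a).1 ∈ h.1
  have hK : Dfn₂ 𝒲 K := by
    unfold K IsCollapse
    exact definability
  have hK' := @hK.comp
  have huniq : ∀ x a a', K x a → K x a' → a = a' := by
    intro x
    induction x using hwf.induction with
    | _ x ih =>
      have key : ∀ a a', K x a → K x a' → a.1 ⊆ a'.1 := by
        rintro a a' ⟨h, hh, hxa⟩ ⟨h', hh', hxa'⟩ b hb
        obtain ⟨y, hyx, hyp, hyb⟩ := ((hh x a hxa).1 ⟨b, mem_of_mem hb a.2⟩).1 hb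
        obtain ⟨b', hb'⟩ := (hh' x a' hxa').2 y hyx hyp
        obtain rfl := ih y ⟨hyx, hyp⟩ _ b' ⟨h, hh, hyb⟩ ⟨h', hh', hb'⟩
        exact ((hh' x a' hxa').1 _).2 ⟨y, hyx, hyp, hb'⟩
      exact fun a a' h h' => Subtype.ext (le_antisymm (key a a' h h') (key a' a h' h))
  revert hx
  induction x using hwf.induction with
  | _ x ih =>
    intro hx
    have hlow : ∀ y : Elt M, y ≠ x → (epair y x).1 ∈ p.1 → ∃ b, K y b := fun y hyx hyp =>
      ih y ⟨hyx, hyp⟩ (hp.refl hyp).1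
    obtain ⟨a, ha⟩ := hW.repl (F := fun z b => ∃ y : Elt M, y ≠ x ∧ z = epair y x ∧ K y b)
      definability (by
        rintro z b b' ⟨y, -, rfl, h⟩ ⟨y', -, h', h''⟩
        obtain ⟨rfl, -⟩ := epair_inj.1 h'
        exact huniq _ _ _ h h'') p
    obtain ⟨f, hf⟩ := hW.repl (F := fun z w => ∃ y b : Elt M, y ≠ x ∧ z = epair y x ∧ K y b ∧
      w = epair y b)
      definability (by
        rintro z w w' ⟨y, b, -, rfl, h, rfl⟩ ⟨y', b', -, h', h'', rfl⟩
        obtain ⟨rfl, -⟩ := epair_inj.1 h'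
        rw [huniq _ _ _ h h'']) p
    have hf' : ∀ y b : Elt M, (epair y b).1 ∈ f.1 ↔ y ≠ x ∧ (epair y x).1 ∈ p.1 ∧ K y b := by
      intro y b
      rw [hf]
      constructor
      · rintro ⟨_, h, y', b', hne, rfl, hK, h'⟩
        obtain ⟨rfl, rfl⟩ := epair_inj.1 h'
        exact ⟨hne, h, hK⟩
      · rintro ⟨hne, h, hK⟩
        exact ⟨_, h, y, b, hne, rfl, hK, rfl⟩
    have hfa : ∀ y b : Elt M, (epair y b).1 ∈ (einsert (epair x a) f).1 ↔
        (y = x ∧ b = a) ∨ (y ≠ x ∧ (epair y x).1 ∈ p.1 ∧ K y b) := by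
      intro y b
      rw [mem_einsert, epair_inj, hf']
    refine ⟨a, einsert (epair x a) f, fun y b hyb => ?_, ZFSet.mem_insert _ _⟩
    rcases (hfa y b).1 hyb with ⟨rfl, rfl⟩ | ⟨hyx, hyp, hyb⟩
    · refine ⟨fun c => ?_, fun z hzy hz => ?_⟩
      · rw [ha]
        constructor
        · rintro ⟨_, h, z, hzy, rfl, hK⟩
          exact ⟨z, hzy, h, (hfa _ _).2 (Or.inr ⟨hzy, h, hK⟩)⟩
        · rintro ⟨z, hzy, hzp, hz⟩
          obtain ⟨rfl, -⟩ | ⟨-, -, hz⟩ := (hfa _ _).1 hz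
          · exact (hzy rfl).elim
          · exact ⟨_, hzp, z, hzy, rfl, hz⟩
      · obtain ⟨c, hc⟩ := hlow z hzy hz
        exact ⟨c, (hfa _ _).2 (Or.inr ⟨hzy, hz, hc⟩)⟩
    · have hyx' : ∀ z : Elt M, z ≠ y → (epair z y).1 ∈ p.1 → z ≠ x ∧ (epair z x).1 ∈ p.1 := by
        intro z hzy hzp
        refine ⟨?_, hp.trans hzp hyp⟩
        rintro rfl
        exact hyx (hp.antisymm hyp hzp)
      obtain ⟨h, hh, hyb⟩ := hyb
      refine ⟨fun c => ?_, fun z hzy hz => ?_⟩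
      · rw [(hh y b hyb).1]
        refine exists_congr fun z => and_congr_right fun hzy => and_congr_right fun hz => ?_
        rw [hfa]
        have hzx := hyx' z hzy hz
        constructor
        · exact fun hzc => Or.inr ⟨hzx.1, hzx.2, h, hh, hzc⟩
        · rintro (⟨rfl, -⟩ | ⟨-, -, hK⟩)
          · exact (hzx.1 rfl).elim
          · obtain ⟨c', hc'⟩ := (hh y b hyb).2 z hzy hz
            rwa [huniq z c c' hK ⟨h, hh, hc'⟩]
      · have hzx := hyx' z hzy hz
        obtain ⟨c, hc⟩ := hlow z hzx.1 hzx.2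
        exact ⟨c, (hfa _ _).2 (Or.inr ⟨hzx.1, hzx.2, hc⟩)⟩

/-- Well-foundedness of `p` quantifies over all subsets of `M`. It is replaced by the existence in
`M` of a collapse at each point: given a set of points, one with an `∈`-minimal collapse value is
least, since `∈` is genuinely well-founded. -/
theorem dfn_isCondition : Dfn₁ 𝒲 (IsCondition (M := M)) := by
  have key : Dfn₁ 𝒲 fun p : Elt M => (∀ z : Elt M, z.1 ∈ p.1 → ∃ x y : Elt M, z = epair x y) ∧
      (∀ x y : Elt M, (epair x y).1 ∈ p.1 → (epair x x).1 ∈ p.1 ∧ (epair y y).1 ∈ p.1) ∧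
      (∀ x y : Elt M, (epair x y).1 ∈ p.1 → (epair y x).1 ∈ p.1 → x = y) ∧
      (∀ x y z : Elt M, (epair x y).1 ∈ p.1 → (epair y z).1 ∈ p.1 → (epair x z).1 ∈ p.1) ∧
      (∀ x y : Elt M, (epair x x).1 ∈ p.1 → (epair y y).1 ∈ p.1 →
        (epair x y).1 ∈ p.1 ∨ (epair y x).1 ∈ p.1) ∧
      ∀ x : Elt M, (epair x x).1 ∈ p.1 →
        ∃ a h : Elt M, IsCollapse p h ∧ (epair x a).1 ∈ h.1 := by
    unfold IsCollapse
    exact definability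
  refine key.congr fun v _ => ?_
  generalize v 0 = p
  constructor
  · intro hp
    refine ⟨fun z hz => ?_, fun _ _ => hp.refl, fun _ _ => hp.antisymm, fun _ _ _ => hp.trans,
      fun _ _ => hp.total, hW.exists_collapse hp⟩
    obtain ⟨x, y, h⟩ := ClassOver.IsWellOrder.pairs hp z hz
    exact ⟨x, y, Subtype.ext h⟩
  · rintro ⟨h₁, h₂, h₃, h₄, h₅, h₆⟩
    refine ⟨fun z hz => ?_, ?_, ?_, ?_, ?_, ?_⟩
    · obtain ⟨x, y, rfl⟩ := h₁ z hz
      exact ⟨x, y, rfl⟩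
    · simpa only [rel_setOf] using h₂
    · simpa only [rel_setOf] using h₃
    · simpa only [rel_setOf] using h₄
    · simpa only [rel_setOf] using h₅
    · rintro S ⟨x₀, hx₀⟩ hS
      simp only [rel_setOf] at hS ⊢
      obtain ⟨a₀, h₀⟩ := h₆ x₀ (hS x₀ hx₀)
      obtain ⟨a, ⟨m, hm, h, hh, hma⟩, hmin⟩ := (InvImage.wf (Subtype.val : Elt M → ZFSet.{u})
        ZFSet.mem_wf).has_min
        {a : Elt M | ∃ x ∈ S, ∃ h : Elt M, IsCollapse p h ∧ (epair x a).1 ∈ h.1} ⟨a₀, x₀, hx₀, h₀⟩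
      refine ⟨m, hm, fun x hx => ?_⟩
      by_contra hc
      have hxm : (epair x m).1 ∈ p.1 := (h₅ m x (hS m hm) (hS x hx)).resolve_left hc
      have hne : x ≠ m := by
        rintro rfl
        exact hc hxm
      obtain ⟨b, hb⟩ := (hh m a hma).2 x hne hxm
      exact hmin b ⟨x, hx, h, hh, hb⟩ (((hh m a hma).1 b).2 ⟨x, hne, hxm, hb⟩)

end IsGBExpansion

end Condition

/-! ### Forcing with conditions -/

/-- The forcing relation for elementary formulas. The class variable `k` is interpreted by the class
`C` if `c k = some C` and by the generic order if `c k = none`. -/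
def Forces : {n m : ℕ} → ClassFormula n m → (Fin m → Option (ClassOver M)) → Elt M →
    (Fin n → Elt M) → Prop
  | _, _, .mem i j, _, _, v => (v i).1 ∈ (v j).1
  | _, _, .eq i j, _, _, v => v i = v j
  | _, _, .memClass i k, c, p, v => (∃ C, c k = some C ∧ v i ∈ C) ∨ c k = none ∧
      ∀ q, IsCondition q → EndExtends q p → ∃ r, IsCondition r ∧ EndExtends r q ∧ (v i).1 ∈ r.1
  | _, _, .neg φ, c, p, v => ∀ q, IsCondition q → EndExtends q p → ¬ Forces φ c q v
  | _, _, .conj φ ψ, c, p, v => Forces φ c p v ∧ Forces ψ c p v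
  | n, _, .allSet φ, c, p, v =>
      ∀ x : Elt M, Forces φ c p (Fin.snoc (α := fun _ : Fin (n + 1) => Elt M) v x)
  | _, _, .allClass _, _, _, _ => False

section Forcing

variable [hM : TransitiveModel M]

omit hM in
theorem Forces.mono {n m : ℕ} {φ : ClassFormula n m} {c : Fin m → Option (ClassOver M)}
    {p q : Elt M} (hqp : EndExtends q p) {v : Fin n → Elt M} (h : Forces φ c p v) :
    Forces φ c q v := by
  induction φ with
  | mem | eq => exact h
  | memClass i k =>
    exact h.imp id fun h => ⟨h.1, fun r hr hrq => h.2 r hr (hrq.trans hqp)⟩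
  | neg φ ih => exact fun r hr hrq => h r hr (hrq.trans hqp)
  | conj φ ψ ih₁ ih₂ => exact ⟨ih₁ h.1, ih₂ h.2⟩
  | allSet φ ih => exact fun x => ih (h x)
  | allClass => exact h.elim

omit hM in
-- The clause for membership in the generic order is itself a density statement, negation refers to
-- all extensions, and the other clauses inherit the property.
theorem Forces.of_dense {n m : ℕ} {φ : ClassFormula n m} (hφ : φ.IsElementary)
    {c : Fin m → Option (ClassOver M)} {p : Elt M} (hp : IsCondition p) {v : Fin n → Elt M}
    (h : ∀ q, IsCondition q → EndExtends q p →
      ∃ r, IsCondition r ∧ EndExtends r q ∧ Forces φ c r v) :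
    Forces φ c p v := by
  induction φ with
  | mem | eq =>
    obtain ⟨_, _, _, h⟩ := h p hp (.refl p)
    exact h
  | memClass i k =>
    cases hk : c k with
    | some C =>
      obtain ⟨_, _, _, h | h⟩ := h p hp (.refl p)
      · exact Or.inl h
      · exact absurd h.1 (by simp [hk])
    | none =>
      refine Or.inr ⟨hk, fun q hq hqp => ?_⟩
      obtain ⟨r, hr, hrq, h | h⟩ := h q hq hqp
      · exact absurd h (by simp [hk])
      · obtain ⟨s, hs, hsr, h⟩ := h.2 r hr (.refl r)
        exact ⟨s, hs, hsr.trans hrq, h⟩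
  | neg φ ih =>
    intro q hq hqp hφq
    obtain ⟨r, hr, hrq, h⟩ := h q hq hqp
    exact h r hr (.refl r) (hφq.mono hrq)
  | conj φ ψ ih₁ ih₂ =>
    refine ⟨ih₁ hφ.1 fun q hq hqp => ?_, ih₂ hφ.2 fun q hq hqp => ?_⟩
    · obtain ⟨r, hr, hrq, h⟩ := h q hq hqp
      exact ⟨r, hr, hrq, h.1⟩
    · obtain ⟨r, hr, hrq, h⟩ := h q hq hqp
      exact ⟨r, hr, hrq, h.2⟩
  | allSet φ ih =>
    refine fun x => ih hφ fun q hq hqp => ?_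
    obtain ⟨r, hr, hrq, h⟩ := h q hq hqp
    exact ⟨r, hr, hrq, h x⟩
  | allClass => exact hφ.elim

/-! ### The forcing theorem and closure under `ω`-sequences -/

variable {𝒲 : World M} (hW : IsGBExpansion M 𝒲)

include hW

/-- No names are needed, since set variables range over `M` and only the predicate for the order is
new. The relation is therefore defined by recursion on a fixed formula, its base case using
definability of the conditions. -/
theorem dfn_forces {N K : ℕ} {φ : ClassFormula N K} (hφ : φ.IsElementary)
    {c : Fin K → Option (ClassOver M)} (hc : ∀ k C, c k = some C → C ∈ 𝒲) : ∀ {n m : ℕ}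
    {p : (Fin n → Elt M) → (Fin m → ClassOver M) → Elt M} (_ : DfnTerm 𝒲 fun v V => (p v V).1)
    {s : Fin N → (Fin n → Elt M) → (Fin m → ClassOver M) → Elt M}
    (_ : ∀ i, DfnTerm 𝒲 fun v V => (s i v V).1),
    Dfn 𝒲 fun v V => Forces φ c (p v V) fun i => s i v V := by
  have hcond := @(hW.dfn_isCondition).comp
  have hext := @(dfn_endExtends (M := M) (𝒮 := 𝒲)).comp
  induction φ with
  | mem i j =>
    intro n m p hp s hs
    exact Dfn.mem (hs i) (hs j)
  | eq i j =>
    intro n m p hp s hs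
    exact Dfn.eqElt (hs i) (hs j)
  | memClass i k =>
    intro n m p hp s hs
    refine Dfn.or ?_ ((Dfn.prop (c k = none)).and ?_)
    · cases hk : c k with
      | some C =>
        have hC := hc k C hk
        refine (Dfn.memClass (hs i) (DfnClass.const hC)).congr fun v V => ?_
        simp
      | none => exact (Dfn.prop False).congr fun v V => by simp
    · have hp' := hp.weaken
      have hs' := (hs i).weaken.weaken
      exact definability
  | neg φ ih =>
    intro n m p hp s hs
    have := ih hφ hc (DfnTerm.var (𝒮 := 𝒲) (m := m) (Fin.last n)) fun i => (hs i).weaken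
    have hp' := hp.weaken
    refine Dfn.all (P := fun v q V => IsCondition q → EndExtends q (p v V) →
      ¬ Forces φ c q fun i => s i v V) ?_
    exact definability
  | conj φ ψ ih₁ ih₂ =>
    intro n m p hp s hs
    exact (ih₁ hφ.1 hc hp hs).and (ih₂ hφ.2 hc hp hs)
  | @allSet N K φ ih =>
    intro n m p hp s hs
    refine Dfn.all (P := fun v x V => Forces φ c (p v V)
      (Fin.snoc (α := fun _ : Fin (N + 1) => Elt M) (fun i => s i v V) x)) ?_
    refine (ih hφ hc hp.weaken (s := Fin.snoc (α := fun _ => (Fin (n + 1) → Elt M) →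
      (Fin m → ClassOver M) → Elt M) (fun i v V => s i (Fin.init v) V) fun v _ => v (Fin.last n))
      (fun i => ?_)).congr fun v V => ?_
    · refine Fin.lastCases ?_ (fun i => ?_) i
      · simpa using DfnTerm.var (Fin.last n)
      · simpa using (hs i).weaken
    · apply iff_of_eq
      congr 1
      funext i
      refine Fin.lastCases ?_ (fun i => ?_) i <;> simp
  | allClass => exact hφ.elim

theorem IsGenericFilter.exists_mem_of_dense {G : ClassOver M} (hG : IsGenericFilter 𝒲 G)
    {P : Elt M → Prop} (hP : Dfn₁ 𝒲 P) {p : Elt M} (hp : p ∈ G)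
    (hd : ∀ q, IsCondition q → EndExtends q p → ∃ r, IsCondition r ∧ EndExtends r q ∧ P r) :
    ∃ r ∈ G, P r := by
  have hcond := @(hW.dfn_isCondition).comp
  have hext := @(dfn_endExtends (M := M) (𝒮 := 𝒲)).comp
  have hP' := @hP.comp
  -- Density below `p` becomes density everywhere once the conditions incompatible with `p` are
  -- added. Directedness of `G` excludes meeting one of those.
  have hD : {r : Elt M | IsCondition r ∧
      (P r ∨ ∀ s : Elt M, IsCondition s → EndExtends s r → ¬ EndExtends s p)} ∈ 𝒲 :=
    hW.set_mem definability
  have hdense : IsDenseClass {r : Elt M | IsCondition r ∧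
      (P r ∨ ∀ s : Elt M, IsCondition s → EndExtends s r → ¬ EndExtends s p)} := by
    refine ⟨fun r hr => hr.1, fun q hq => ?_⟩
    by_cases h : ∃ s : Elt M, IsCondition s ∧ EndExtends s q ∧ EndExtends s p
    · obtain ⟨s, hs, hsq, hsp⟩ := h
      obtain ⟨r, hr, hrs, hPr⟩ := hd s hs hsp
      exact ⟨r, ⟨hr, Or.inl hPr⟩, hrs.trans hsq⟩
    · exact ⟨q, ⟨hq, Or.inr fun s hs hsq hsp => h ⟨s, hs, hsq, hsp⟩⟩, .refl q⟩
  obtain ⟨r, hr, -, h | h⟩ := hG.generic _ hD hdense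
  · exact ⟨r, hr, h⟩
  · obtain ⟨s, hs, hsr, hsp⟩ := hG.directed r hr p hp
    exact (h s (hG.conditions s hs) hsr hsp).elim

theorem IsGenericFilter.exists_mem {G : ClassOver M} (hG : IsGenericFilter 𝒲 G)
    {P : Elt M → Prop} (hP : Dfn₁ 𝒲 P)
    (hd : ∀ q, IsCondition q → ∃ r, IsCondition r ∧ EndExtends r q ∧ P r) : ∃ r ∈ G, P r := by
  have hcond := @(hW.dfn_isCondition).comp
  have hP' := @hP.comp
  have hD : {r : Elt M | IsCondition r ∧ P r} ∈ 𝒲 := hW.set_mem definability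
  obtain ⟨r, hr, -, h⟩ := hG.generic _ hD ⟨fun r hr => hr.1, fun q hq => by
    obtain ⟨r, hr, hrq, h⟩ := hd q hq
    exact ⟨r, ⟨hr, h⟩, hrq⟩⟩
  exact ⟨r, hr, h⟩

/-- The truth lemma. -/
theorem elemSat_iff_forces {G : ClassOver M} (hG : IsGenericFilter 𝒲 G) {n m : ℕ}
    {φ : ClassFormula n m} (hφ : φ.IsElementary) {c : Fin m → Option (ClassOver M)}
    (hc : ∀ k C, c k = some C → C ∈ 𝒲) (v : Fin n → Elt M) :
    ElemSat φ v (fun k => (c k).getD {z | ∃ p ∈ G, z.1 ∈ p.1}) ↔ ∃ p ∈ G, Forces φ c p v := by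
  have hD : ∀ {n m : ℕ} {φ : ClassFormula n m} (_ : φ.IsElementary)
      {c : Fin m → Option (ClassOver M)} (_ : ∀ k C, c k = some C → C ∈ 𝒲) (v : Fin n → Elt M),
      Dfn₁ 𝒲 fun p => Forces φ c p v :=
    fun hφ _ hc v => dfn_forces hW hφ hc (.var _) fun i => DfnTerm.const (v i)
  obtain ⟨p₀, hp₀, -⟩ := hG.exists_mem hW (Dfn.prop True) fun q hq => ⟨q, hq, .refl q, trivial⟩
  induction φ with
  | mem i j => exact ⟨fun h => ⟨p₀, hp₀, h⟩, fun ⟨_, _, h⟩ => h⟩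
  | eq i j => exact ⟨fun h => ⟨p₀, hp₀, h⟩, fun ⟨_, _, h⟩ => h⟩
  | memClass i k =>
    cases hk : c k with
    | some C =>
      simp only [ElemSat, Sat, hk, Option.getD_some, Forces]
      exact ⟨fun h => ⟨p₀, hp₀, Or.inl ⟨C, rfl, h⟩⟩, fun ⟨_, _, h⟩ => by simpa using h⟩
    | none =>
      simp only [ElemSat, Sat, hk, Option.getD_none, Forces]
      constructor
      · rintro ⟨p, hp, h⟩
        exact ⟨p, hp, Or.inr ⟨trivial, fun q hq hqp => ⟨q, hq, .refl q, hqp.1 h⟩⟩⟩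
      · rintro ⟨p, hp, h | ⟨-, h⟩⟩
        · simp at h
        · exact hG.exists_mem_of_dense hW (P := fun r => (v i).1 ∈ r.1) definability hp h
  | neg φ ih =>
    have ih := ih hφ hc v
    refine (not_congr ih).trans ⟨fun h => ?_, ?_⟩
    · have h₁ := hD (φ := φ) hφ hc v
      have h₂ := hD (φ := φ.neg) hφ hc v
      obtain ⟨r, hr, h' | h'⟩ := hG.exists_mem hW
          (P := fun p => Forces φ c p v ∨ Forces φ.neg c p v) (h₁.or h₂) fun q hq => by
        by_cases hs : ∃ s, IsCondition s ∧ EndExtends s q ∧ Forces φ c s v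
        · obtain ⟨s, hs, hsq, h⟩ := hs
          exact ⟨s, hs, hsq, Or.inl h⟩
        · exact ⟨q, hq, .refl q, Or.inr fun s hs' hsq h => hs ⟨s, hs', hsq, h⟩⟩
      · exact (h ⟨r, hr, h'⟩).elim
      · exact ⟨r, hr, h'⟩
    · rintro ⟨p, hp, h⟩ ⟨q, hq, h'⟩
      obtain ⟨r, hr, hrp, hrq⟩ := hG.directed p hp q hq
      exact h r (hG.conditions r hr) hrp (h'.mono hrq)
  | conj φ ψ ih₁ ih₂ =>
    refine (and_congr (ih₁ hφ.1 hc v) (ih₂ hφ.2 hc v)).trans ⟨?_, ?_⟩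
    · rintro ⟨⟨p, hp, h⟩, q, hq, h'⟩
      obtain ⟨r, hr, hrp, hrq⟩ := hG.directed p hp q hq
      exact ⟨r, hr, h.mono hrp, h'.mono hrq⟩
    · rintro ⟨p, hp, h, h'⟩
      exact ⟨⟨p, hp, h⟩, p, hp, h'⟩
  | @allSet n m φ ih =>
    refine (forall_congr' fun x => ih hφ hc _).trans ⟨fun h => ?_, ?_⟩
    · have h₁ := hD (φ := φ.allSet) hφ hc v
      have h₂ : Dfn₁ 𝒲 fun p => ∃ x : Elt M, Forces φ.neg c p
          (Fin.snoc (α := fun _ : Fin (n + 1) => Elt M) v x) := by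
        refine Dfn.ex (P := fun w x V => Forces φ.neg c (w 0)
          (Fin.snoc (α := fun _ : Fin (n + 1) => Elt M) v x)) ?_
        refine (dfn_forces hW (φ := φ.neg) hφ hc (.var (0 : Fin 2)) (s := Fin.snoc (α := fun _ =>
          (Fin 2 → Elt M) → (Fin 0 → ClassOver M) → Elt M) (fun i _ _ => v i) fun w _ => w 1)
          fun i => ?_).congr fun w V => ?_
        · refine Fin.lastCases ?_ (fun i => ?_) i
          · simpa using DfnTerm.var (1 : Fin 2)
          · simpa using DfnTerm.const (v i)
        · apply iff_of_eq
          congr 1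
          funext i
          refine Fin.lastCases ?_ (fun i => ?_) i <;> simp
      obtain ⟨r, hr, h' | ⟨x, h'⟩⟩ := hG.exists_mem hW
          (P := fun p => Forces φ.allSet c p v ∨ ∃ x : Elt M, Forces φ.neg c p
            (Fin.snoc (α := fun _ : Fin (n + 1) => Elt M) v x)) (h₁.or h₂) fun q hq => by
        by_cases hq' : Forces φ.allSet c q v
        · exact ⟨q, hq, .refl q, Or.inl hq'⟩
        · obtain ⟨x, hx⟩ : ∃ x, ¬ Forces φ c q
              (Fin.snoc (α := fun _ : Fin (n + 1) => Elt M) v x) := by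
            by_contra hc
            push Not at hc
            exact hq' hc
          by_contra hcon
          -- If the instance at `x` is not forced by `q`, its forcing is not dense below `q`, so
          -- some extension of `q` forces its negation.
          refine hx (Forces.of_dense (φ := φ) hφ hq fun r hr hrq => ?_)
          by_contra hr'
          refine hcon ⟨r, hr, hrq, Or.inr ⟨x, fun s hs hsr h => hr' ⟨s, hs, hsr, h⟩⟩⟩
      · exact ⟨r, hr, h'⟩
      · obtain ⟨q, hq, hx⟩ := h x
        obtain ⟨s, hs, hsr, hsq⟩ := hG.directed r hr q hq
        exact (h' s (hG.conditions s hs) hsr (hx.mono hsq)).elim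
    · rintro ⟨p, hp, h⟩ x
      exact ⟨p, hp, h x⟩
  | allClass => exact hφ.elim

/-- Closure of the forcing under `ω`-sequences: dependent choice produces a descending sequence
whose range is a set of `M`, and the union of this range is again a condition. -/
theorem exists_condition_of_dense_sequence {D : Elt M → Elt M → Prop} (hD : Dfn₂ 𝒲 D)
    (hmono : ∀ i p q, EndExtends q p → D i p → D i q)
    (hdense : ∀ i p, IsCondition p → ∃ q, IsCondition q ∧ EndExtends q p ∧ D i q)
    {p : Elt M} (hp : IsCondition p) :
    ∃ q, IsCondition q ∧ EndExtends q p ∧ ∀ n : ℕ, D (enat M n) q := by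
  have hcond := @(hW.dfn_isCondition).comp
  have hext := @(dfn_endExtends (M := M) (𝒮 := 𝒲)).comp
  have hD' := @hD.comp
  -- The stage is carried as first coordinate, so that step `i` enters the `i`-th dense set. Sets
  -- that are not pairs of a stage and a condition are unconstrained, which makes the relation
  -- total.
  obtain ⟨x, b, hx₀, hx, hb⟩ := hW.dependent_choice (R := fun z z' =>
    ∀ i q : Elt M, z = epair i q → IsCondition q → ∃ q' : Elt M, z' = epair (einsert i i) q' ∧
      IsCondition q' ∧ EndExtends q' q ∧ D i q') definability (fun z => by
        by_cases hz : ∃ i q : Elt M, z = epair i q ∧ IsCondition q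
        · obtain ⟨i, q, rfl, hq⟩ := hz
          obtain ⟨q', h₁, h₂, h₃⟩ := hdense i q hq
          refine ⟨epair (einsert i i) q', fun i' r h _ => ?_⟩
          obtain ⟨rfl, rfl⟩ := epair_inj.1 h
          exact ⟨q', rfl, h₁, h₂, h₃⟩
        · exact ⟨z, fun i q h hq => (hz ⟨i, q, h, hq⟩).elim⟩) (epair (enat M 0) p)
  have hseq : ∀ n, ∃ q, x n = epair (enat M n) q ∧ IsCondition q := by
    intro n
    induction n with
    | zero => exact ⟨p, hx₀, hp⟩
    | succ n ih =>
      obtain ⟨q, hq, hq'⟩ := ih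
      obtain ⟨q', h₁, h₂, -⟩ := hx n _ q hq hq'
      exact ⟨q', h₁, h₂⟩
  choose q hq hq' using hseq
  have hstep : ∀ n, EndExtends (q (n + 1)) (q n) ∧ D (enat M n) (q (n + 1)) := by
    intro n
    obtain ⟨q', h₁, -, h₂⟩ := hx n _ (q n) (hq n) (hq' n)
    rw [hq (n + 1)] at h₁
    obtain rfl := (epair_inj.1 h₁).2
    exact h₂
  have hq₀ : q 0 = p := (epair_inj.1 ((hq 0).symm.trans hx₀)).2
  obtain ⟨b', hb'⟩ := hW.repl (F := fun z r => ∃ i : Elt M, z = epair i r) definability (by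
    rintro z r r' ⟨i, rfl⟩ ⟨i', h⟩
    exact (epair_inj.1 h).2) b
  have hb'' : ∀ r : Elt M, r.1 ∈ b'.1 ↔ ∃ n, r = q n := by
    intro r
    rw [hb']
    constructor
    · rintro ⟨z, hz, i, rfl⟩
      obtain ⟨n, hn⟩ := (hb _).1 hz
      rw [hq n] at hn
      exact ⟨n, (epair_inj.1 hn).2⟩
    · rintro ⟨n, rfl⟩
      exact ⟨x n, (hb _).2 ⟨n, rfl⟩, enat M n, hq n⟩
  have hr : ∀ z : Elt M, z.1 ∈ (ZFSet.sUnion b'.1) ↔ ∃ n, z.1 ∈ (q n).1 := by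
    intro z
    rw [ZFSet.mem_sUnion]
    constructor
    · rintro ⟨y, hy, hz⟩
      obtain ⟨n, hn⟩ := (hb'' ⟨y, mem_of_mem hy b'.2⟩).1 hy
      exact ⟨n, hn ▸ hz⟩
    · rintro ⟨n, hn⟩
      exact ⟨_, (hb'' (q n)).2 ⟨n, rfl⟩, hn⟩
  have hchain := fun n => (hstep n).1
  have hend : ∀ n, EndExtends (⟨ZFSet.sUnion b'.1, sUnion_mem b'.2⟩ : Elt M) (q n) := by
    intro n
    refine ⟨fun z hz => (hr ⟨z, mem_of_mem hz (q n).2⟩).2 ⟨n, hz⟩, fun y z hy hz => ?_⟩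
    obtain ⟨k, hk⟩ := (hr (epair z y)).1 hz
    exact mem_of_mem_chain hchain hy hk
  refine ⟨⟨_, sUnion_mem b'.2⟩, isWellOrder_chain hq' hchain hr, hq₀ ▸ hend 0, fun n => ?_⟩
  exact hmono _ _ _ (hend (n + 1)) (hstep n).2

/-- Adding a generic global well-order adds no enumeration of `M` in order type `ω`. -/
theorem not_surjective_of_generic {H : ClassOver M} (hH : IsGenericGlobalWellOrder 𝒲 H)
    {F : ClassOver M} (hF : F ∈ adjoinClass 𝒲 H)
    (hfun : ∀ x y y' : Elt M, F.Rel x y → F.Rel x y' → y = y') :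
    ¬ ∀ y : Elt M, ∃ n : ℕ, F.Rel (enat M n) y := by
  obtain ⟨G, hG, rfl⟩ := hH
  have hF' := DfnClass.of_mem_definableFrom (n := 2) (m := 0) hF
  have hrel : Dfn₂ (insert {z : Elt M | ∃ p ∈ G, z.1 ∈ p.1} 𝒲) fun x y => F.Rel x y := definability
  obtain ⟨k, l, w, C, φ, hφ, hC, h⟩ := hrel
  have hc : ∀ i, ∃ o : Option (ClassOver M), (∀ C, o = some C → C ∈ 𝒲) ∧
      o.getD {z : Elt M | ∃ p ∈ G, z.1 ∈ p.1} = Fin.append Fin.elim0 C i := by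
    intro i
    refine Fin.addCases (fun i => i.elim0) (fun i => ?_) i
    rcases hC i with h | h
    · exact ⟨none, by simp, by simp [h]⟩
    · exact ⟨some (C i), by simpa using h, by simp⟩
  choose c hc hcC using hc
  have htruth : ∀ x y : Elt M, F.Rel x y ↔ ∃ p ∈ G, Forces φ c p (Fin.append w ![x, y]) := by
    intro x y
    rw [← elemSat_iff_forces hW hG hφ hc]
    refine (h ![x, y] Fin.elim0).trans (iff_of_eq ?_)
    congr 1
    funext i
    exact (hcC i).symm
  have hT : Dfn₃ 𝒲 fun p x y => Forces φ c p (Fin.append w ![x, y]) := by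
    refine (dfn_forces hW hφ hc (.var (0 : Fin 3)) (s := Fin.append (fun i _ _ => w i)
      ![fun v _ => v 1, fun v _ => v 2]) fun i => ?_).congr fun v V => ?_
    · refine Fin.addCases (fun i => ?_) (fun i => ?_) i
      · simpa using DfnTerm.const (w i)
      · fin_cases i
        · simpa using DfnTerm.var (1 : Fin 3)
        · simpa using DfnTerm.var (2 : Fin 3)
    · refine iff_of_eq (congrArg (Forces φ c (v 0)) (funext fun i => ?_))
      refine Fin.addCases (fun i => ?_) (fun i => ?_) i
      · simp
      · fin_cases i <;> simp
  have hTmono : ∀ p q x y, EndExtends q p → Forces φ c p (Fin.append w ![x, y]) →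
      Forces φ c q (Fin.append w ![x, y]) := fun p q x y h h' => h'.mono h
  -- From here on only definability, monotonicity and the truth lemma for this forcing relation
  -- matter.
  generalize hTdef : (fun p x y => Forces φ c p (Fin.append w ![x, y])) = T at hT
  replace htruth : ∀ x y : Elt M, F.Rel x y ↔ ∃ p ∈ G, T p x y := by
    simpa only [← hTdef] using htruth
  replace hTmono : ∀ p q x y, EndExtends q p → T p x y → T q x y := by
    simpa only [← hTdef] using hTmono
  clear hTdef h
  have hcond := @(hW.dfn_isCondition).comp
  have hext := @(dfn_endExtends (M := M) (𝒮 := 𝒲)).comp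
  have hT' := @hT.comp
  -- Here `D i p` says that `p` decides `F` at `i`: it forces a value, or no extension of it forces
  -- one.
  let D : Elt M → Elt M → Prop := fun i p => (∃ x, T p i x) ∨
    ∀ x q, IsCondition q → EndExtends q p → ¬ T q i x
  have hD : Dfn₂ 𝒲 D := definability
  have hDmono : ∀ i p q, EndExtends q p → D i p → D i q := by
    rintro i p q hqp (⟨x, h⟩ | h)
    · exact Or.inl ⟨x, hTmono _ _ _ _ hqp h⟩
    · exact Or.inr fun x r hr hrq => h x r hr (hrq.trans hqp)
  have hDdense : ∀ i p, IsCondition p → ∃ q, IsCondition q ∧ EndExtends q p ∧ D i q := by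
    intro i p hp
    by_cases h : ∃ x q, IsCondition q ∧ EndExtends q p ∧ T q i x
    · obtain ⟨x, q, hq, hqp, h⟩ := h
      exact ⟨q, hq, hqp, Or.inl ⟨x, h⟩⟩
    · exact ⟨p, hp, .refl p, Or.inr fun x q hq hqp hT => h ⟨x, q, hq, hqp, hT⟩⟩
  obtain ⟨w, hw⟩ := exists_natCode_mem M
  have hnat' := @(dfn_nat (M := M) (𝒮 := 𝒲)).comp
  -- By closure, a single condition in the filter decides `F` at all numerals, so the restriction of
  -- `F` to the numerals is already a class of the ground world `𝒲`.
  obtain ⟨p, hp, hpD⟩ := hG.exists_mem hW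
    (P := fun p => ∀ i : Elt M, (∃ n : ℕ, i = enat M n) → D i p)
    (by have hD' := @hD.comp; exact definability) fun q hq => by
      obtain ⟨r, hr, hrq, h⟩ := exists_condition_of_dense_sequence hW hD hDmono hDdense hq
      exact ⟨r, hr, hrq, fun i ⟨n, hn⟩ => hn ▸ h n⟩
  have hF₁ : ∀ (n : ℕ) (y : Elt M), F.Rel (enat M n) y ↔ T p (enat M n) y := by
    refine fun n y => ⟨fun h => ?_, fun h => (htruth _ _).2 ⟨p, hp, h⟩⟩
    rcases hpD _ ⟨n, rfl⟩ with ⟨x, hx⟩ | h'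
    · rwa [hfun _ _ _ h ((htruth _ _).2 ⟨p, hp, hx⟩)]
    · obtain ⟨q, hq, hqT⟩ := (htruth _ _).1 h
      obtain ⟨r, hr, hrp, hrq⟩ := hG.directed p hp q hq
      exact (h' y r (hG.conditions r hr) hrp (hTmono _ _ _ _ hrq hqT)).elim
  have hF₂ : {z : Elt M | ∃ i y : Elt M, z = epair i y ∧
      (∃ n : ℕ, i = enat M n) ∧ T p i y} ∈ 𝒲 := hW.set_mem definability
  have hF₃ : ∀ x y : Elt M, ClassOver.Rel {z : Elt M | ∃ i y : Elt M, z = epair i y ∧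
      (∃ n : ℕ, i = enat M n) ∧ T p i y} x y ↔
      (∃ n : ℕ, x = enat M n) ∧ F.Rel x y := by
    intro x y
    rw [rel_iff]
    constructor
    · rintro ⟨i, y', h, ⟨n, hn⟩, hT⟩
      obtain ⟨rfl, rfl⟩ := epair_inj.1 h
      subst hn
      exact ⟨⟨n, rfl⟩, (hF₁ _ _).2 hT⟩
    · rintro ⟨⟨n, rfl⟩, h⟩
      exact ⟨_, _, rfl, ⟨n, rfl⟩, (hF₁ _ _).1 h⟩
  intro hsurj
  refine hW.not_surjective hF₂ (fun x y y' => ?_) fun y => ?_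
  · rw [hF₃, hF₃]
    exact fun h h' => hfun _ _ _ h.2 h'.2
  · obtain ⟨n, hn⟩ := hsurj y
    exact ⟨n, (hF₃ _ _).2 ⟨⟨n, rfl⟩, hn⟩⟩

end Forcing

/-! ### Codes of formulas and tuples -/

/-- Codes do not record the numbers of variables, so both are fixed here. In a coded pair of a
formula and a tuple, `n` is recovered from the length of the tuple. -/
theorem ClassFormula.code_injective {n m : ℕ} :
    Function.Injective (ClassFormula.code : ClassFormula n m → ZFSet.{u}) := by
  intro φ
  induction φ with
  | mem i j =>
    intro ψ h
    cases ψ <;> simp [code, ZFSet.pair_inj, natCode_injective.eq_iff, Fin.val_inj] at h ⊢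
    exact h
  | eq i j =>
    intro ψ h
    cases ψ <;> simp [code, ZFSet.pair_inj, natCode_injective.eq_iff, Fin.val_inj] at h ⊢
    exact h
  | memClass i j =>
    intro ψ h
    cases ψ <;> simp [code, ZFSet.pair_inj, natCode_injective.eq_iff, Fin.val_inj] at h ⊢
    exact h
  | neg φ ih =>
    intro ψ h
    cases ψ <;> simp [code, ZFSet.pair_inj, natCode_injective.eq_iff] at h ⊢
    exact ih h
  | conj φ ψ ih₁ ih₂ =>
    intro ψ h
    cases ψ <;> simp [code, ZFSet.pair_inj, natCode_injective.eq_iff] at h ⊢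
    exact ⟨ih₁ h.1, ih₂ h.2⟩
  | allSet φ ih =>
    intro ψ h
    cases ψ <;> simp [code, ZFSet.pair_inj, natCode_injective.eq_iff] at h ⊢
    exact ih h
  | allClass φ ih =>
    intro ψ h
    cases ψ <;> simp [code, ZFSet.pair_inj, natCode_injective.eq_iff] at h ⊢
    exact ih h

theorem mem_tupleCode {n : ℕ} {a : Fin n → ZFSet.{u}} {z : ZFSet.{u}} :
    z ∈ tupleCode a ↔ ∃ i : Fin n, z = (natCode i).pair (a i) := by
  induction n with
  | zero => simp [tupleCode]
  | succ n ih =>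
    rw [tupleCode, ZFSet.mem_insert_iff, ih, Fin.exists_fin_succ', or_comm]
    simp

theorem tupleCode_injective {n n' : ℕ} {a : Fin n → ZFSet.{u}} {a' : Fin n' → ZFSet.{u}}
    (h : tupleCode a = tupleCode a') : n = n' ∧ HEq a a' := by
  have key : ∀ {n n' : ℕ} {a : Fin n → ZFSet.{u}} {a' : Fin n' → ZFSet.{u}},
      tupleCode a = tupleCode a' → n ≤ n' := by
    intro n n' a a' h
    by_contra! hlt
    obtain ⟨i, hi⟩ := mem_tupleCode.1 (h ▸ mem_tupleCode.2 ⟨⟨n', hlt⟩, rfl⟩)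
    have := natCode_injective (ZFSet.pair_inj.1 hi).1
    simp only at this
    exact absurd i.2 (by omega)
  obtain rfl := le_antisymm (key h) (key h.symm)
  refine ⟨rfl, heq_of_eq (funext fun i => ?_)⟩
  obtain ⟨j, hj⟩ := mem_tupleCode.1 (h ▸ mem_tupleCode.2 ⟨i, rfl⟩)
  obtain ⟨h₁, h₂⟩ := ZFSet.pair_inj.1 hj
  rw [h₂, Fin.ext (natCode_injective h₁)]

section Codes

variable [hM : TransitiveModel M]

theorem ClassFormula.code_mem {n m : ℕ} (φ : ClassFormula n m) : φ.code ∈ M := by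
  induction φ with
  | mem i j => exact pair_mem (natCode_mem _) (pair_mem (natCode_mem _) (natCode_mem _))
  | eq i j => exact pair_mem (natCode_mem _) (pair_mem (natCode_mem _) (natCode_mem _))
  | memClass i j => exact pair_mem (natCode_mem _) (pair_mem (natCode_mem _) (natCode_mem _))
  | neg φ ih => exact pair_mem (natCode_mem _) ih
  | conj φ ψ ih₁ ih₂ => exact pair_mem (natCode_mem _) (pair_mem ih₁ ih₂)
  | allSet φ ih => exact pair_mem (natCode_mem _) ih
  | allClass φ ih => exact pair_mem (natCode_mem _) ih

theorem tupleCode_mem {n : ℕ} (a : Fin n → Elt M) : tupleCode (fun i => (a i).1) ∈ M := by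
  induction n with
  | zero => exact empty_mem
  | succ n ih =>
    exact insert_mem (pair_mem (natCode_mem _) (a _).2) (ih fun i => a i.castSucc)

variable (M) in
/-- The code of a formula, as an element of `M`. -/
noncomputable def ecode {n m : ℕ} (φ : ClassFormula n m) : Elt M := ⟨φ.code, φ.code_mem⟩

/-- The code of a tuple, as an element of `M`. -/
noncomputable def etuple {n : ℕ} (a : Fin n → Elt M) : Elt M := ⟨_, tupleCode_mem a⟩

theorem etuple_snoc {n : ℕ} (a : Fin n → Elt M) (x : Elt M) :
    etuple (Fin.snoc (α := fun _ : Fin (n + 1) => Elt M) a x) =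
      einsert (epair (enat M n) x) (etuple a) := by
  apply Subtype.ext
  simp [etuple, tupleCode]

theorem etuple_injective {n n' : ℕ} {a : Fin n → Elt M} {a' : Fin n' → Elt M}
    (h : etuple a = etuple a') : n = n' ∧ HEq a a' := by
  obtain ⟨rfl, h⟩ := tupleCode_injective (Subtype.ext_iff.1 h)
  exact ⟨rfl, heq_of_eq (funext fun i => Subtype.ext (congrFun (eq_of_heq h) i))⟩

variable (M) in
theorem ecode_injective {n m : ℕ} : Function.Injective (ecode M : ClassFormula n m → Elt M) :=
  fun _ _ h => ClassFormula.code_injective (Subtype.ext_iff.1 h)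

/-- `T` correctly decides all first-order formulas about `(M, ∈, B)`. -/
def DecidesTruth (B T : ClassOver M) : Prop :=
  ∀ (n : ℕ) (φ : ClassFormula n 1) (a : Fin n → Elt M), φ.IsElementary →
    (epair (ecode M φ) (etuple a) ∈ T ↔ ElemSat φ a ![B])

theorem decidesTruth_truthPredicate (B : ClassOver M) : DecidesTruth B (truthPredicate B) := by
  intro n φ a hφ
  constructor
  · rintro ⟨n', φ', a', -, h, h'⟩
    obtain ⟨h₁, h₂⟩ := (epair_inj (x := ecode M φ) (y := etuple a) (x' := ecode M φ')
      (y' := etuple a')).1 (Subtype.ext h)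
    obtain ⟨rfl, h₂⟩ := etuple_injective h₂
    obtain rfl := ecode_injective M h₁
    rwa [eq_of_heq h₂]
  · exact fun h => ⟨n, φ, a, hφ, rfl, h⟩

end Codes

/-! ### Initial segments of conditions -/

section Segments

variable [hM : TransitiveModel M]

/-- `r` is an initial segment of `p`, as an order. -/
def IsSegment (p r : Elt M) : Prop :=
  EndExtends p r ∧ ∀ x y : Elt M, (epair x y).1 ∈ r.1 → (epair x x).1 ∈ r.1 ∧ (epair y y).1 ∈ r.1

theorem IsSegment.trans {p q r : Elt M} (h : IsSegment p q) (h' : IsSegment q r) :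
    IsSegment p r :=
  ⟨h.1.trans h'.1, h'.2⟩

theorem IsSegment.isCondition {p r : Elt M} (hp : IsCondition p) (h : IsSegment p r) :
    IsCondition r := by
  have hr : ∀ x y : Elt M, (epair x y).1 ∈ r.1 ↔ (epair y y).1 ∈ r.1 ∧ (epair x y).1 ∈ p.1 :=
    fun x y => ⟨fun hxy => ⟨(h.2 x y hxy).2, h.1.1 hxy⟩, fun hxy => h.1.2 y x hxy.1 hxy.2⟩
  refine ⟨fun z hz => ClassOver.IsWellOrder.pairs hp z (h.1.1 hz), ?_, ?_, ?_, ?_, ?_⟩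
  · simpa only [rel_setOf] using h.2
  · simp only [rel_setOf]
    exact fun x y hxy hyx => hp.antisymm (h.1.1 hxy) (h.1.1 hyx)
  · simp only [rel_setOf]
    exact fun x y z hxy hyz => (hr _ _).2 ⟨(h.2 _ _ hyz).2, hp.trans (h.1.1 hxy) (h.1.1 hyz)⟩
  · simp only [rel_setOf]
    exact fun x y hx hy => (hp.total (h.1.1 hx) (h.1.1 hy)).imp (fun h' => (hr _ _).2 ⟨hy, h'⟩)
      fun h' => (hr _ _).2 ⟨hx, h'⟩
  · simp only [rel_setOf]
    intro S hS hSr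
    obtain ⟨m, hm, hmin⟩ := hp.exists_min hS fun x hx => h.1.1 (hSr x hx)
    exact ⟨m, hm, fun x hx => (hr _ _).2 ⟨hSr x hx, hmin x hx⟩⟩

/-- Take the `p`-least point `m` omitted by some segment with `P`, and let `r` be such a segment. A
smaller segment of this kind would omit a point of `r`; that point lies above `m`, which would put
`m` into `r`. If no point is ever omitted, `p` itself works. -/
theorem IsCondition.exists_minimal_segment {p : Elt M} (hp : IsCondition p) {P : Elt M → Prop}
    (hP : P p) : ∃ r, IsSegment p r ∧ P r ∧ ∀ r', IsSegment r r' → P r' → r.1 ⊆ r'.1 := by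
  have hpairs : ∀ z ∈ p.1, ∃ x y : Elt M, z = (epair x y).1 := fun z hz =>
    ClassOver.IsWellOrder.pairs hp ⟨z, mem_of_mem hz p.2⟩ hz
  let S : Set (Elt M) := {x | (epair x x).1 ∈ p.1 ∧ ∃ r, IsSegment p r ∧ P r ∧ (epair x x).1 ∉ r.1}
  by_cases hS : S.Nonempty
  · obtain ⟨m, ⟨-, r, hr, hPr, hmr⟩, hmin⟩ := hp.exists_min hS fun x hx => hx.1
    refine ⟨r, hr, hPr, fun r' hr' hPr' z hz => ?_⟩
    obtain ⟨x, y, rfl⟩ := hpairs z (hr.1.1 hz)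
    have hy := (hr.2 x y hz).2
    by_cases hyr' : (epair y y).1 ∈ r'.1
    · exact hr'.1.2 y x hyr' hz
    · have hmy := hmin y ⟨hr.1.1 hy, r', hr.trans hr', hPr', hyr'⟩
      exact (hmr (hr.2 m y (hr.1.2 y m hy hmy)).1).elim
  · refine ⟨p, ⟨.refl p, fun x y => hp.refl⟩, hP, fun r hr hPr z hz => ?_⟩
    obtain ⟨x, y, rfl⟩ := hpairs z hz
    by_contra hzr
    refine hS ⟨y, (hp.refl hz).2, r, hr, hPr, fun hy => hzr (hr.1.2 y x hy hz)⟩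

end Segments

/-! ### Catastrophic generic orders -/

section Catastrophe

variable [hM : TransitiveModel M]

/-- A formula with parameters about `(M, ∈, B)`. -/
abbrev ClassCode (M : ZFSet.{u}) : Type _ :=
  Σ k : ℕ, {φ : ClassFormula (k + 1) 1 // φ.IsElementary} × (Fin k → Elt M)

/-- The predicate defined over `(M, ∈, B)` by a formula with parameters. -/
def ClassCode.Holds (B : ClassOver M) (d : ClassCode M) (x : Elt M) : Prop :=
  ElemSat d.2.1.1 (Fin.snoc (α := fun _ : Fin (d.1 + 1) => Elt M) d.2.2 x) ![B]

omit hM in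
-- All class parameters are equal to `B`, so the class variables can be identified.
theorem exists_classCode {B D : ClassOver M} (hD : D ∈ definableFrom {B}) :
    ∃ d : ClassCode M, ∀ x, x ∈ D ↔ d.Holds B x := by
  obtain ⟨n, m, φ, v, V, hφ, hV, rfl⟩ := hD
  refine ⟨⟨n, ⟨φ.rename id fun _ => 0, hφ.rename _ _⟩, v⟩, fun x => ?_⟩
  simp only [ClassCode.Holds, elemSat_rename, Set.mem_ofPred_eq]
  apply iff_of_eq
  congr 1
  funext k
  simpa using hV k

instance [Countable (Elt M)] : Countable (ClassCode M) := by
  have : ∀ n m, Countable (ClassFormula n m) := fun n m => (ecode_injective M).countable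
  infer_instance

/-- The element which is appended to the condition `p` in order to code `d` and `m`. -/
noncomputable def marker (p : Elt M) (d : ClassCode M) (m : Elt M) : Elt M :=
  epair p (epair (ecode M d.2.1.1) (epair (enat M d.1) (epair (etuple d.2.2) m)))

/-- The marker contains `p` as a component, so its rank exceeds that of `p`, and it cannot occur in
the field of `p`. -/
theorem marker_not_mem (p : Elt M) (d : ClassCode M) (m : Elt M) :
    (epair (marker p d m) (marker p d m)).1 ∉ p.1 := by
  have hl : ∀ x y : ZFSet.{u}, x.rank < (x.pair y).rank := fun x y =>
    (ZFSet.rank_lt_of_mem (ZFSet.mem_singleton.2 rfl)).trans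
      (ZFSet.rank_lt_of_mem (ZFSet.mem_pair.2 (Or.inl rfl)))
  intro h
  exact lt_irrefl _ (((hl _ _).trans (ZFSet.rank_lt_of_mem h)).trans
    (hl p.1 (epair (ecode M d.2.1.1) (epair (enat M d.1) (epair (etuple d.2.2) m))).1))

/-- The condition `p'` extends `p` by the marker `t` and is minimal with this property and `P`. -/
structure IsNextStage (P : Elt M → Prop) (p t p' : Elt M) : Prop where
  isCondition : IsCondition p'
  endExtends : EndExtends p' p
  not_mem : (epair t t).1 ∉ p.1
  mem : (epair t t).1 ∈ p'.1
  below : ∀ y : Elt M, (epair y t).1 ∈ p'.1 ↔ y = t ∨ (epair y y).1 ∈ p.1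
  holds : P p'
  minimal : ∀ r, IsSegment p' r → (epair t t).1 ∈ r.1 → P r → p'.1 ⊆ r.1

/-- Append `t`, extend into `P` by density, and cut back to a minimal segment that contains `t` and
satisfies `P`. The cut loses nothing of the old order, all of which lies below `t`. -/
theorem exists_nextStage {𝒲 : World M} (hW : IsGBExpansion M 𝒲) {P : Elt M → Prop}
    (hP : ∀ q, IsCondition q → ∃ p, IsCondition p ∧ EndExtends p q ∧ P p) {p t : Elt M}
    (hp : IsCondition p) (ht : (epair t t).1 ∉ p.1) : ∃ p', IsNextStage P p t p' := by
  obtain ⟨q, hq⟩ := hW.exists_snoc p t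
  have hqc := hq.isCondition hp ht
  obtain ⟨p₁, hp₁, hp₁q, hPp₁⟩ := hP q hqc
  have htq : (epair t t).1 ∈ q.1 := hq.pair_mem.2 (Or.inr ⟨rfl, Or.inl rfl⟩)
  obtain ⟨r, hr, ⟨htr, hPr⟩, hmin⟩ := hp₁.exists_minimal_segment
    (P := fun r => (epair t t).1 ∈ r.1 ∧ P r) ⟨hp₁q.1 htq, hPp₁⟩
  have hrq : EndExtends r q := by
    refine ⟨fun z hz => ?_, fun x y hx hy => hp₁q.2 x y hx (hr.1.1 hy)⟩
    obtain ⟨x, y, h⟩ := ClassOver.IsWellOrder.pairs hqc ⟨z, mem_of_mem hz q.2⟩ hz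
    obtain rfl : z = (epair x y).1 := h
    have hyt : (epair y t).1 ∈ q.1 := by
      refine hq.pair_mem.2 (Or.inr ⟨rfl, ?_⟩)
      rcases hq.pair_mem.1 (hqc.refl hz).2 with h | h
      · exact Or.inr h
      · exact Or.inl h.1
    exact hr.1.2 y x (hr.2 _ _ (hr.1.2 t y htr (hp₁q.1 hyt))).1 (hp₁q.1 hz)
  refine ⟨r, hr.isCondition hp₁, hrq.trans (hq.endExtends ht), ht, htr, fun y => ?_, hPr,
    fun r' h₁ h₂ h₃ => hmin r' h₁ ⟨h₂, h₃⟩⟩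
  constructor
  · intro hy
    rcases hq.pair_mem.1 (hrq.2 t y htq hy) with h | h
    · exact (ht (hp.refl h).2).elim
    · exact h.2
  · exact fun hy => hrq.1 (hq.pair_mem.2 (Or.inr ⟨rfl, hy⟩))

/-- `t` is the element of the field of `H` which follows the initial segment `p`. -/
def IsNextElt (H : ClassOver M) (p t : Elt M) : Prop :=
  epair t t ∈ H ∧ (epair t t).1 ∉ p.1 ∧ ∀ y, epair y t ∈ H ↔ y = t ∨ (epair y y).1 ∈ p.1

/-- `r` is a set-sized initial segment of `H`. -/
def IsClassSegment (H : ClassOver M) (r : Elt M) : Prop :=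
  (∀ z : Elt M, z.1 ∈ r.1 → z ∈ H) ∧
  (∀ x y : Elt M, (epair x x).1 ∈ r.1 → epair y x ∈ H → (epair y x).1 ∈ r.1) ∧
  ∀ x y : Elt M, (epair x y).1 ∈ r.1 → (epair x x).1 ∈ r.1 ∧ (epair y y).1 ∈ r.1

/-- According to `T`, the formula coded by the marker `t` holds of `r`. -/
def MarkerHolds (T : ClassOver M) (t r : Elt M) : Prop :=
  ∃ p c k a m : Elt M, t = epair p (epair c (epair k (epair a m))) ∧
    epair c (einsert (epair k r) a) ∈ T

/-- The coded formula takes the condition as its last variable, so evaluating it at `r` amounts to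
inserting the pair of the tuple's length and `r` into the coded tuple. -/
theorem DecidesTruth.markerHolds_iff {B T : ClassOver M} (hT : DecidesTruth B T) {p m r : Elt M}
    {d : ClassCode M} : MarkerHolds T (marker p d m) r ↔ d.Holds B r := by
  have h := hT _ d.2.1.1 (Fin.snoc (α := fun _ : Fin (d.1 + 1) => Elt M) d.2.2 r) d.2.1.2
  rw [etuple_snoc] at h
  refine Iff.trans ?_ h
  constructor
  · rintro ⟨p', c, k, a, m', h₁, h₂⟩
    simp only [marker, epair_inj] at h₁
    obtain ⟨rfl, rfl, rfl, rfl, rfl⟩ := h₁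
    exact h₂
  · exact fun h => ⟨p, _, _, _, m, rfl, h⟩

/-- A generic global well-order `H` over `𝒢` from which, together with the truths about `B`, an
enumeration of `M` in order type `ω` is definable. -/
theorem exists_catastrophic_generic [Countable (Elt M)] {𝒢 : World M} (h𝒢 : IsGBExpansion M 𝒢)
    {B : ClassOver M} (hB : 𝒢 ⊆ definableFrom {B}) :
    ∃ H, IsGenericGlobalWellOrder 𝒢 H ∧ ∀ 𝒵 : World M, definableFrom 𝒵 ⊆ 𝒵 → H ∈ 𝒵 →
      ∀ T ∈ 𝒵, DecidesTruth B T → ∃ F ∈ 𝒵, (∀ x y y' : Elt M, F.Rel x y → F.Rel x y' → y = y') ∧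
        ∀ y : Elt M, ∃ n : ℕ, F.Rel (enat M n) y := by
  -- Every dense class of `𝒢` is definable from `B`. Countably many codes with a dense property
  -- therefore suffice for genericity.
  let Valid : ClassCode M → Prop := fun d =>
    ∀ q, IsCondition q → ∃ p, IsCondition p ∧ EndExtends p q ∧ d.Holds B p
  -- The trivial property `x₀ = x₀` is dense.
  have hne : Nonempty {d // Valid d} := ⟨⟨0, ⟨.eq 0 0, trivial⟩, Fin.elim0⟩,
    fun q hq => ⟨q, hq, .refl q, rfl⟩⟩
  obtain ⟨d, hd⟩ := exists_surjective_nat {d // Valid d}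
  have : Nonempty (Elt M) := ⟨eempty M⟩
  obtain ⟨e, he⟩ := exists_surjective_nat (Elt M)
  have hnext : ∀ (n : ℕ) (p : {p : Elt M // IsCondition p}), ∃ p' : {p : Elt M // IsCondition p},
      IsNextStage ((d n).1.Holds B) p.1 (marker p.1 (d n).1 (e n)) p'.1 := fun n p => by
    obtain ⟨p', hp'⟩ := exists_nextStage h𝒢 (d n).2 p.2 (marker_not_mem p.1 (d n).1 (e n))
    exact ⟨⟨p', hp'.isCondition⟩, hp'⟩
  choose f hf using hnext
  obtain ⟨p, hpc, hp⟩ : ∃ p : ℕ → Elt M, (∀ n, IsCondition (p n)) ∧ ∀ n,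
      IsNextStage ((d n).1.Holds B) (p n) (marker (p n) (d n).1 (e n)) (p (n + 1)) :=
    ⟨fun n => (Nat.rec ⟨eempty M, isCondition_eempty⟩ f n : {p : Elt M // IsCondition p}).1,
      fun n => (Nat.rec _ f n : {p : Elt M // IsCondition p}).2, fun n => hf n _⟩
  let t : ℕ → Elt M := fun n => marker (p n) (d n).1 (e n)
  have hchain : ∀ n, EndExtends (p (n + 1)) (p n) := fun n => (hp n).endExtends
  have hle := fun {m n : ℕ} (hmn : m ≤ n) => (EndExtends.of_chain hchain hmn).1
  let G : ClassOver M := {q | IsCondition q ∧ ∃ n, EndExtends (p n) q}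
  let H : ClassOver M := {z | ∃ q ∈ G, z.1 ∈ q.1}
  have hH : ∀ z, z ∈ H ↔ ∃ n, z.1 ∈ (p n).1 := fun z =>
    ⟨fun ⟨q, ⟨_, n, hn⟩, hz⟩ => ⟨n, hn.1 hz⟩, fun ⟨n, hz⟩ => ⟨p n, ⟨hpc n, n, .refl _⟩, hz⟩⟩
  have hHp : ∀ {n : ℕ} {x y : Elt M}, (epair x x).1 ∈ (p n).1 → epair y x ∈ H →
      (epair y x).1 ∈ (p n).1 := fun hx hy => by
    obtain ⟨k, hk⟩ := (hH _).1 hy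
    exact mem_of_mem_chain hchain hx hk
  have hHtotal : ∀ x y : Elt M, epair x x ∈ H → epair y y ∈ H → epair x y ∈ H ∨ epair y x ∈ H := by
    intro x y hx hy
    have := (isWellOrder_chain hpc hchain hH).total x y
    simp only [rel_iff] at this
    exact this hx hy
  refine ⟨H, ⟨G, ⟨fun q hq => hq.1, fun q ⟨_, n, hn⟩ q' hq' hqq' => ⟨hq', n, hn.trans hqq'⟩,
    fun q ⟨_, n, hn⟩ q' ⟨_, n', hn'⟩ => ⟨p (max n n'), ⟨hpc _, _, .refl _⟩,
      (EndExtends.of_chain hchain (le_max_left n n')).trans hn,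
      (EndExtends.of_chain hchain (le_max_right n n')).trans hn'⟩, fun D hD hDd => ?_⟩, rfl⟩, ?_⟩
  · obtain ⟨c, hc⟩ := exists_classCode (hB hD)
    obtain ⟨n, hn⟩ := hd ⟨c, fun q hq => by
      obtain ⟨r, hr, hrq⟩ := hDd.2 q hq
      exact ⟨r, hDd.1 r hr, hrq, (hc r).1 hr⟩⟩
    refine ⟨p (n + 1), ⟨hpc _, _, .refl _⟩, (hc _).2 ?_⟩
    have := (hp n).holds
    rwa [hn] at this
  · intro 𝒵 h𝒵 hHZ T hTZ hT
    have hnextElt : ∀ n s, IsNextElt H (p n) s ↔ s = t n := by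
      have h₁ : ∀ n, IsNextElt H (p n) (t n) := fun n =>
        ⟨(hH _).2 ⟨n + 1, (hp n).mem⟩, (hp n).not_mem, fun y =>
          ⟨fun hy => ((hp n).below y).1 (hHp (hp n).mem hy),
            fun hy => (hH _).2 ⟨n + 1, ((hp n).below y).2 hy⟩⟩⟩
      refine fun n s => ⟨fun h => ?_, fun h => h ▸ h₁ n⟩
      rcases hHtotal s (t n) h.1 (h₁ n).1 with h' | h'
      · exact (((h₁ n).2.2 s).1 h').resolve_right h.2.1
      · exact ((h.2.2 _).1 h').elim Eq.symm fun h' => ((h₁ n).2.1 h').elim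
    have hseg : ∀ n, IsClassSegment H (p n) := fun n =>
      ⟨fun z hz => (hH z).2 ⟨n, hz⟩, fun x y => hHp, fun x y => (hpc n).refl⟩
    -- A segment of `H` that does not include `p (n + 1)` is a segment of `p (n + 1)`, where
    -- minimality of the stage applies.
    have hsub : ∀ n r, IsClassSegment H r → (epair (t n) (t n)).1 ∈ r.1 → (d n).1.Holds B r →
        (p (n + 1)).1 ⊆ r.1 := by
      intro n r hr htr hdr
      by_contra hc
      obtain ⟨z, hz, hzr⟩ : ∃ z, z ∈ (p (n + 1)).1 ∧ z ∉ r.1 := by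
        by_contra hcon
        push Not at hcon
        exact hc fun z hz => hcon z hz
      obtain ⟨x, y, h⟩ := ClassOver.IsWellOrder.pairs (hpc (n + 1)) ⟨z, mem_of_mem hz (p _).2⟩ hz
      obtain rfl : z = (epair x y).1 := h
      have hyr : (epair y y).1 ∉ r.1 := fun hy => hzr (hr.2.1 y x hy ((hH _).2 ⟨_, hz⟩))
      have hyp := ((hpc _).refl hz).2
      refine hc ((hp n).minimal r ⟨⟨fun w hw => ?_, fun x' y' hx' hy' =>
        hr.2.1 x' y' hx' ((hH _).2 ⟨_, hy'⟩)⟩, hr.2.2⟩ htr hdr)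
      have hwH := hr.1 ⟨w, mem_of_mem hw r.2⟩ hw
      obtain ⟨k, hk⟩ := (hH _).1 hwH
      obtain ⟨x', y', h⟩ := ClassOver.IsWellOrder.pairs (hpc k) ⟨w, mem_of_mem hw r.2⟩ hk
      obtain rfl : w = (epair x' y').1 := h
      have hy'r := (hr.2.2 _ _ hw).2
      rcases hHtotal y y' ((hH _).2 ⟨_, hyp⟩) (hr.1 _ hy'r) with h' | h'
      · exact (hyr (hr.2.2 _ _ (hr.2.1 _ _ hy'r h')).1).elim
      · exact hHp ((hpc _).refl (hHp hyp h')).1 hwH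
    -- The passage from `p n` to `p (n + 1)`, expressed with `H` and `T` alone. The formula to be
    -- met varies with `n` and is read from the marker, which is why a truth predicate is required.
    let g : Elt M → Elt M → Prop := fun q q' => ∃ s, IsNextElt H q s ∧ IsClassSegment H q' ∧
      (epair s s).1 ∈ q'.1 ∧ MarkerHolds T s q' ∧
      ∀ r, IsClassSegment H r → (epair s s).1 ∈ r.1 → MarkerHolds T s r → q'.1 ⊆ r.1
    have hN : Dfn₂ 𝒵 (IsNextElt H) := by
      unfold IsNextElt
      exact definability
    have hg : Dfn₂ 𝒵 g := by
      have hN' := @hN.comp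
      unfold g IsClassSegment MarkerHolds
      exact definability
    have hgp : ∀ n y, g (p n) y ↔ y = p (n + 1) := by
      have h₁ : ∀ n, g (p n) (p (n + 1)) := fun n => ⟨t n, (hnextElt n _).2 rfl, hseg _,
        (hp n).mem, hT.markerHolds_iff.2 (hp n).holds, fun r hr htr hdr =>
          hsub n r hr htr (hT.markerHolds_iff.1 hdr)⟩
      refine fun n y => ⟨fun h => ?_, fun h => h ▸ h₁ n⟩
      obtain ⟨s, hs, hy, hsy, hdy, hmin⟩ := h
      obtain rfl := (hnextElt n s).1 hs
      exact Subtype.ext (le_antisymm (hmin _ (hseg _) (hp n).mem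
        (hT.markerHolds_iff.2 (hp n).holds)) (hsub n y hy hsy (hT.markerHolds_iff.1 hdy)))
    have horb := @(dfn_orbit hg hgp).comp
    have hN' := @hN.comp
    -- The enumeration sends `n` to `e n`, the last component of the marker that follows `p n` in
    -- `H`.
    refine ⟨{z | ∃ i y : Elt M, z = epair i y ∧ ∃ q, (∃ n, i = enat M n ∧ q = p n) ∧ ∃ s,
      IsNextElt H q s ∧ ∃ q' c k a : Elt M, s = epair q' (epair c (epair k (epair a y)))},
      h𝒵 (dfnClass_iff.2 definability), ?_⟩
    have hrel : ∀ x y, ClassOver.Rel {z : Elt M | ∃ i y : Elt M, z = epair i y ∧ ∃ q,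
        (∃ n, i = enat M n ∧ q = p n) ∧ ∃ s, IsNextElt H q s ∧
        ∃ q' c k a : Elt M, s = epair q' (epair c (epair k (epair a y)))} x y ↔
        ∃ n, x = enat M n ∧ y = e n := by
      intro x y
      rw [rel_iff]
      constructor
      · rintro ⟨i, y', h, q, ⟨n, hi, rfl⟩, s, hs, q', c, k, a, h'⟩
        obtain ⟨rfl, rfl⟩ := epair_inj.1 h
        rw [(hnextElt n s).1 hs] at h'
        simp only [t, marker, epair_inj] at h'
        exact ⟨n, hi, h'.2.2.2.2.symm⟩
      · rintro ⟨n, rfl, rfl⟩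
        exact ⟨_, _, rfl, p n, ⟨n, rfl, rfl⟩, t n, (hnextElt n _).2 rfl, _, _, _, _, rfl⟩
    refine ⟨fun x y y' => ?_, fun y => ?_⟩
    · rw [hrel, hrel]
      rintro ⟨n, rfl, rfl⟩ ⟨n', h, rfl⟩
      rw [enat_inj.1 h]
    · obtain ⟨n, rfl⟩ := he y
      exact ⟨n, (hrel _ _).2 ⟨n, rfl, rfl⟩⟩

end Catastrophe

/-! ### Definability of the iterated truth predicates -/

section FormulaCodes

variable [hM : TransitiveModel M]

theorem pair_mem_etuple {n : ℕ} {a : Fin n → Elt M} {i : Fin n} {x : Elt M} :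
    (epair (enat M i) x).1 ∈ (etuple a).1 ↔ x = a i := by
  constructor
  · intro h
    obtain ⟨j, hj⟩ := mem_tupleCode.1 h
    obtain ⟨h₁, h₂⟩ := ZFSet.pair_inj.1 hj
    rw [Fin.ext (natCode_injective h₁)]
    exact Subtype.ext h₂
  · rintro rfl
    exact mem_tupleCode.2 ⟨i, rfl⟩

theorem mem_enat {x : Elt M} {n : ℕ} : x.1 ∈ (enat M n).1 ↔ ∃ i : Fin n, x = enat M i := by
  rw [enat_val, mem_natCode]
  exact ⟨fun ⟨i, hi, h⟩ => ⟨⟨i, hi⟩, Subtype.ext h⟩, fun ⟨i, h⟩ => ⟨i, i.2, congrArg _ h⟩⟩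

/-- `t` codes a tuple whose length is the number `k`. -/
def IsTupleCode (k t : Elt M) : Prop :=
  ∃ (n : ℕ) (a : Fin n → Elt M), k = enat M n ∧ t = etuple a

theorem dfn_isTupleCode {𝒮 : Set (ClassOver M)} : Dfn₂ 𝒮 (IsTupleCode (M := M)) := by
  have hnat := @(dfn_nat (M := M) (𝒮 := 𝒮)).comp
  have key : Dfn₂ 𝒮 fun k t => (∃ n, k = enat M n) ∧
      (∀ i : Elt M, i.1 ∈ k.1 → ∃ x, (epair i x).1 ∈ t.1 ∧
        ∀ x', (epair i x').1 ∈ t.1 → x' = x) ∧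
      ∀ z : Elt M, z.1 ∈ t.1 → ∃ i x : Elt M, i.1 ∈ k.1 ∧ z = epair i x := definability
  refine key.congr fun v _ => ?_
  generalize v 0 = k
  generalize v 1 = t
  constructor
  · rintro ⟨n, a, rfl, rfl⟩
    refine ⟨⟨n, rfl⟩, fun i hi => ?_, fun z hz => ?_⟩
    · obtain ⟨i, rfl⟩ := mem_enat.1 hi
      exact ⟨a i, pair_mem_etuple.2 rfl, fun x' hx' => pair_mem_etuple.1 hx'⟩
    · obtain ⟨i, hi⟩ := mem_tupleCode.1 hz
      exact ⟨enat M i, a i, mem_enat.2 ⟨i, rfl⟩, Subtype.ext hi⟩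
  · rintro ⟨⟨n, rfl⟩, h₁, h₂⟩
    choose a ha ha' using fun i : Fin n => h₁ (enat M i) (mem_enat.2 ⟨i, rfl⟩)
    refine ⟨n, a, rfl, Subtype.ext (elt_ext t.2 (etuple a).2 fun z => ⟨fun hz => ?_, fun hz => ?_⟩)⟩
    · obtain ⟨i, x, hi, rfl⟩ := h₂ z hz
      obtain ⟨i, rfl⟩ := mem_enat.1 hi
      exact pair_mem_etuple.2 (ha' i x hz)
    · obtain ⟨i, hi⟩ := mem_tupleCode.1 hz
      obtain rfl : z = epair (enat M i) (a i) := Subtype.ext hi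
      exact ha i

/-- `c` codes an elementary formula with `k` free set variables and two class variables. -/
def IsFormulaCode (k c : Elt M) : Prop :=
  ∃ (n : ℕ) (φ : ClassFormula n 2), φ.IsElementary ∧ k = enat M n ∧ c = ecode M φ

/-- The formula coded by `c` is built from subformulas in `s`. -/
def IsBuiltFrom (s k c : Elt M) : Prop :=
  (∃ i j : Elt M, i.1 ∈ k.1 ∧ j.1 ∈ k.1 ∧ c = epair (enat M 0) (epair i j)) ∨
  (∃ i j : Elt M, i.1 ∈ k.1 ∧ j.1 ∈ k.1 ∧ c = epair (enat M 1) (epair i j)) ∨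
  (∃ i j : Elt M, i.1 ∈ k.1 ∧ (j = enat M 0 ∨ j = enat M 1) ∧
    c = epair (enat M 2) (epair i j)) ∨
  (∃ c₁ : Elt M, (epair k c₁).1 ∈ s.1 ∧ c = epair (enat M 3) c₁) ∨
  (∃ c₁ c₂ : Elt M, (epair k c₁).1 ∈ s.1 ∧ (epair k c₂).1 ∈ s.1 ∧
    c = epair (enat M 4) (epair c₁ c₂)) ∨
  ∃ c₁ : Elt M, (epair (einsert k k) c₁).1 ∈ s.1 ∧ c = epair (enat M 5) c₁

theorem IsBuiltFrom.mono {s s' k c : Elt M} (hs : s.1 ⊆ s'.1) (h : IsBuiltFrom s k c) :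
    IsBuiltFrom s' k c :=
  h.imp id (Or.imp id (Or.imp id (Or.imp (fun ⟨c₁, h₁, h⟩ => ⟨c₁, hs h₁, h⟩)
    (Or.imp (fun ⟨c₁, c₂, h₁, h₂, h⟩ => ⟨c₁, c₂, hs h₁, hs h₂, h⟩)
      fun ⟨c₁, h₁, h⟩ => ⟨c₁, hs h₁, h⟩))))

/-- `s` is a set of codes of formulas which is closed under subformulas. -/
def IsFormation (s : Elt M) : Prop :=
  ∀ z : Elt M, z.1 ∈ s.1 → ∃ k c : Elt M, z = epair k c ∧ (∃ n, k = enat M n) ∧ IsBuiltFrom s k c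

theorem IsFormation.einsert {s c : Elt M} {n : ℕ} (hs : IsFormation s)
    (h : IsBuiltFrom s (enat M n) c) : IsFormation (einsert (epair (enat M n) c) s) := by
  have hsub : s.1 ⊆ (_root_.einsert (epair (enat M n) c) s).1 := fun z hz =>
    ZFSet.mem_insert_of_mem _ hz
  intro z hz
  rcases mem_einsert.1 hz with rfl | hz
  · exact ⟨_, _, rfl, ⟨n, rfl⟩, h.mono hsub⟩
  · obtain ⟨k, c, hk, hn, h⟩ := hs z hz
    exact ⟨k, c, hk, hn, h.mono hsub⟩

theorem exists_isFormation {n : ℕ} (φ : ClassFormula n 2) (hφ : φ.IsElementary) :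
    ∃ s : Elt M, IsFormation s ∧ (epair (enat M n) (ecode M φ)).1 ∈ s.1 := by
  have h₀ : IsFormation (eempty M) := fun z hz => (not_mem_eempty z hz).elim
  -- The number of class variables is abstracted because the induction needs a free index.
  generalize hm : 2 = m at φ
  induction φ with
  | mem i j =>
    exact ⟨_, h₀.einsert (Or.inl ⟨enat M i, enat M j, mem_enat.2 ⟨i, rfl⟩, mem_enat.2 ⟨j, rfl⟩,
      rfl⟩), ZFSet.mem_insert _ _⟩
  | eq i j =>
    exact ⟨_, h₀.einsert (Or.inr (Or.inl ⟨enat M i, enat M j, mem_enat.2 ⟨i, rfl⟩,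
      mem_enat.2 ⟨j, rfl⟩, rfl⟩)), ZFSet.mem_insert _ _⟩
  | memClass i k =>
    subst hm
    refine ⟨_, h₀.einsert (Or.inr (Or.inr (Or.inl ⟨enat M i, enat M k, mem_enat.2 ⟨i, rfl⟩, ?_,
      rfl⟩))), ZFSet.mem_insert _ _⟩
    fin_cases k
    · exact Or.inl rfl
    · exact Or.inr rfl
  | neg φ ih =>
    obtain ⟨s, hs, hφs⟩ := ih hm hφ
    exact ⟨_, hs.einsert (Or.inr (Or.inr (Or.inr (Or.inl ⟨_, hφs, rfl⟩)))), ZFSet.mem_insert _ _⟩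
  | conj φ ψ ih₁ ih₂ =>
    obtain ⟨s, hs, hφs⟩ := ih₁ hm hφ.1
    obtain ⟨s', hs', hψs'⟩ := ih₂ hm hφ.2
    have hu : IsFormation (⟨s.1 ∪ s'.1, union_mem s.2 s'.2⟩ : Elt M) := by
      intro z hz
      rcases ZFSet.mem_union.1 hz with hz | hz
      · obtain ⟨k, c, hk, hn, h⟩ := hs z hz
        exact ⟨k, c, hk, hn, h.mono fun w hw => ZFSet.mem_union.2 (Or.inl hw)⟩
      · obtain ⟨k, c, hk, hn, h⟩ := hs' z hz
        exact ⟨k, c, hk, hn, h.mono fun w hw => ZFSet.mem_union.2 (Or.inr hw)⟩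
    exact ⟨_, hu.einsert (Or.inr (Or.inr (Or.inr (Or.inr (Or.inl ⟨_, _,
      ZFSet.mem_union.2 (Or.inl hφs), ZFSet.mem_union.2 (Or.inr hψs'), rfl⟩))))),
      ZFSet.mem_insert _ _⟩
  | allSet φ ih =>
    obtain ⟨s, hs, hφs⟩ := ih hm hφ
    exact ⟨_, hs.einsert (Or.inr (Or.inr (Or.inr (Or.inr (Or.inr ⟨_, hφs, rfl⟩))))),
      ZFSet.mem_insert _ _⟩
  | allClass => exact hφ.elim

/-- The numerals of a formation are standard and components of a pair have smaller rank, so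
induction on the rank of `c` decodes it into an actual formula. -/
theorem IsFormation.isFormulaCode {s : Elt M} (hs : IsFormation s) :
    ∀ c k : Elt M, (epair k c).1 ∈ s.1 → IsFormulaCode k c := by
  have hr : ∀ x y : Elt M, y.1.rank < (epair x y).1.rank := fun x y =>
    (ZFSet.rank_lt_of_mem (ZFSet.mem_pair.2 (Or.inr rfl))).trans
      (ZFSet.rank_lt_of_mem (ZFSet.mem_pair.2 (Or.inr rfl)))
  have hl : ∀ x y : Elt M, x.1.rank < (epair x y).1.rank := fun x y =>
    (ZFSet.rank_lt_of_mem (ZFSet.mem_singleton.2 rfl)).trans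
      (ZFSet.rank_lt_of_mem (ZFSet.mem_pair.2 (Or.inl rfl)))
  intro c
  induction c using (InvImage.wf (fun c : Elt M => c.1.rank) wellFounded_lt).induction with
  | _ c ih =>
    intro k hk
    obtain ⟨k', c', h, ⟨n, rfl⟩, h'⟩ := hs _ hk
    obtain ⟨rfl, rfl⟩ := epair_inj.1 h
    rcases h' with ⟨i, j, hi, hj, rfl⟩ | ⟨i, j, hi, hj, rfl⟩ | ⟨i, j, hi, hj, rfl⟩ |
      ⟨c₁, h₁, rfl⟩ | ⟨c₁, c₂, h₁, h₂, rfl⟩ | ⟨c₁, h₁, rfl⟩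
    · obtain ⟨i, rfl⟩ := mem_enat.1 hi
      obtain ⟨j, rfl⟩ := mem_enat.1 hj
      exact ⟨n, .mem i j, trivial, rfl, rfl⟩
    · obtain ⟨i, rfl⟩ := mem_enat.1 hi
      obtain ⟨j, rfl⟩ := mem_enat.1 hj
      exact ⟨n, .eq i j, trivial, rfl, rfl⟩
    · obtain ⟨i, rfl⟩ := mem_enat.1 hi
      rcases hj with rfl | rfl
      · exact ⟨n, .memClass i 0, trivial, rfl, rfl⟩
      · exact ⟨n, .memClass i 1, trivial, rfl, rfl⟩
    · obtain ⟨n', φ, hφ, h₃, rfl⟩ := ih c₁ (hr _ _) _ h₁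
      obtain rfl := enat_inj.1 h₃
      exact ⟨n, .neg φ, hφ, rfl, rfl⟩
    · obtain ⟨n', φ, hφ, h₃, rfl⟩ := ih c₁ ((hl _ _).trans (hr _ _)) _ h₁
      obtain rfl := enat_inj.1 h₃
      obtain ⟨n', ψ, hψ, h₃, rfl⟩ := ih c₂ ((hr _ _).trans (hr _ _)) _ h₂
      obtain rfl := enat_inj.1 h₃
      exact ⟨n, .conj φ ψ, ⟨hφ, hψ⟩, rfl, rfl⟩
    · obtain ⟨n', φ, hφ, h₃, rfl⟩ := ih c₁ (hr _ _) _ h₁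
      obtain rfl := (enat_inj (i := n + 1)).1 h₃
      exact ⟨n, .allSet φ, hφ, rfl, rfl⟩

theorem dfn_isFormulaCode {𝒮 : Set (ClassOver M)} : Dfn₂ 𝒮 (IsFormulaCode (M := M)) := by
  have hnat := @(dfn_nat (M := M) (𝒮 := 𝒮)).comp
  have hbuilt : Dfn₃ 𝒮 (IsBuiltFrom (M := M)) := by
    unfold IsBuiltFrom
    exact definability
  have hbuilt' := @hbuilt.comp
  have hform : Dfn₁ 𝒮 (IsFormation (M := M)) := by
    unfold IsFormation
    exact definability
  have hform' := @hform.comp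
  have key : Dfn₂ 𝒮 fun k c => ∃ s : Elt M, IsFormation s ∧ (epair k c).1 ∈ s.1 := definability
  refine key.congr fun v _ => ⟨?_, fun ⟨s, hs, h⟩ => hs.isFormulaCode _ _ h⟩
  rintro ⟨n, φ, hφ, h₁, h₂⟩
  rw [h₁, h₂]
  exact exists_isFormation φ hφ

/-- The Tarski clauses at stage `ξ` for the `Γ`-iterated truth predicate `Θ` over `A`. -/
def TarskiClauses (Γ A Θ : ClassOver M) (ξ k c t : Elt M) : Prop :=
  (∀ i j : Elt M, c = epair (enat M 0) (epair i j) → (epair ξ (epair c t) ∈ Θ ↔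
    ∃ x y : Elt M, (epair i x).1 ∈ t.1 ∧ (epair j y).1 ∈ t.1 ∧ x.1 ∈ y.1)) ∧
  (∀ i j : Elt M, c = epair (enat M 1) (epair i j) → (epair ξ (epair c t) ∈ Θ ↔
    ∃ x : Elt M, (epair i x).1 ∈ t.1 ∧ (epair j x).1 ∈ t.1)) ∧
  (∀ i : Elt M, c = epair (enat M 2) (epair i (enat M 0)) → (epair ξ (epair c t) ∈ Θ ↔
    ∃ x : Elt M, (epair i x).1 ∈ t.1 ∧ x ∈ A)) ∧
  (∀ i : Elt M, c = epair (enat M 2) (epair i (enat M 1)) → (epair ξ (epair c t) ∈ Θ ↔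
    ∃ x : Elt M, (epair i x).1 ∈ t.1 ∧ x ∈ Θ ∧ ∃ η w : Elt M, Γ.Lt η ξ ∧ x = epair η w)) ∧
  (∀ c₁ : Elt M, c = epair (enat M 3) c₁ → (epair ξ (epair c t) ∈ Θ ↔
    ¬ epair ξ (epair c₁ t) ∈ Θ)) ∧
  (∀ c₁ c₂ : Elt M, c = epair (enat M 4) (epair c₁ c₂) → (epair ξ (epair c t) ∈ Θ ↔
    epair ξ (epair c₁ t) ∈ Θ ∧ epair ξ (epair c₂ t) ∈ Θ)) ∧
  ∀ c₁ : Elt M, c = epair (enat M 5) c₁ → (epair ξ (epair c t) ∈ Θ ↔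
    ∀ x : Elt M, epair ξ (epair c₁ (einsert (epair k x) t)) ∈ Θ)

/-- The part of `Θ` below stage `ξ`. -/
def stagesBelow (Γ Θ : ClassOver M) (ξ : Elt M) : ClassOver M :=
  {t | t ∈ Θ ∧ ∃ (η : Elt M) (w : ZFSet.{u}), Γ.Lt η ξ ∧ t.1 = η.1.pair w}

theorem mem_stagesBelow {Γ Θ : ClassOver M} {ξ t : Elt M} :
    t ∈ stagesBelow Γ Θ ξ ↔ t ∈ Θ ∧ ∃ η w : Elt M, Γ.Lt η ξ ∧ t = epair η w := by
  refine and_congr_right fun _ => ⟨?_, fun ⟨η, w, h₁, h₂⟩ => ⟨η, w.1, h₁, congrArg _ h₂⟩⟩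
  rintro ⟨η, w, h₁, h₂⟩
  exact ⟨η, ⟨w, right_mem_of_pair_mem (h₂ ▸ t.2)⟩, h₁, Subtype.ext h₂⟩

theorem IsIteratedTruthPredicate.mem_iff {Γ A Θ : ClassOver M}
    (h : IsIteratedTruthPredicate Γ A Θ) {ξ : Elt M} (hξ : Γ.Rel ξ ξ) {n : ℕ}
    {φ : ClassFormula n 2} (hφ : φ.IsElementary) (a : Fin n → Elt M) :
    epair ξ (epair (ecode M φ) (etuple a)) ∈ Θ ↔ ElemSat φ a ![A, stagesBelow Γ Θ ξ] := by
  refine (h _).trans ⟨?_, fun h' => ⟨ξ, n, φ, a, hξ, hφ, rfl, h'⟩⟩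
  rintro ⟨ξ', n', φ', a', -, -, h₁, h₂⟩
  have h₄ : epair ξ (epair (ecode M φ) (etuple a)) = epair ξ' (epair (ecode M φ') (etuple a')) :=
    Subtype.ext h₁
  obtain ⟨rfl, h₆⟩ := epair_inj.1 h₄
  obtain ⟨h₅, h₃⟩ := (epair_inj (M := M)).1 h₆
  obtain ⟨rfl, h₃⟩ := etuple_injective h₃
  obtain rfl := ecode_injective M h₅
  rw [eq_of_heq h₃]
  exact h₂

/-- The definition refers to satisfaction of actual formulas; the right-hand side is elementary in
the three classes. The Tarski clauses determine truth by induction on the formula, which is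
legitimate because all codes in `M` are codes of actual formulas. -/
theorem isIteratedTruthPredicate_iff {Γ A Θ : ClassOver M} :
    IsIteratedTruthPredicate Γ A Θ ↔
      (∀ z, z ∈ Θ → ∃ ξ k c t : Elt M, Γ.Rel ξ ξ ∧ IsFormulaCode k c ∧ IsTupleCode k t ∧
        z = epair ξ (epair c t)) ∧
      ∀ ξ k c t : Elt M, Γ.Rel ξ ξ → IsFormulaCode k c → IsTupleCode k t →
        TarskiClauses Γ A Θ ξ k c t := by
  constructor
  · intro h
    refine ⟨fun z hz => ?_, ?_⟩
    · obtain ⟨ξ, n, φ, a, hξ, hφ, hz, -⟩ := (h z).1 hz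
      exact ⟨ξ, enat M n, ecode M φ, etuple a, hξ, ⟨n, φ, hφ, rfl, rfl⟩, ⟨n, a, rfl, rfl⟩,
        Subtype.ext hz⟩
    · rintro ξ _ _ _ hξ ⟨n, φ, hφ, rfl, rfl⟩ ⟨n', a, hn, rfl⟩
      obtain rfl := enat_inj.1 hn
      have key := h.mem_iff hξ hφ a
      cases φ with
      | mem i j =>
        have hc : ecode M (.mem i j : ClassFormula n 2) =
          epair (enat M 0) (epair (enat M i) (enat M j)) := rfl
        rw [hc] at key ⊢
        refine ⟨?_, ?_, ?_, ?_, ?_, ?_, ?_⟩ <;> simp [key, -Subtype.forall, -Subtype.exists, -epair_val]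

        simp only [pair_mem_etuple, exists_eq_left]
        rfl
      | eq i j => 
        have hc : ecode M (.eq i j : ClassFormula n 2) =
          epair (enat M 1) (epair (enat M i) (enat M j)) := rfl
        rw [hc] at key ⊢
        refine ⟨?_, ?_, ?_, ?_, ?_, ?_, ?_⟩ <;> simp [key, -Subtype.forall, -Subtype.exists, -epair_val]

        simp only [pair_mem_etuple, exists_eq_left]
        rfl
      | memClass i k => 
        have hc : ecode M (.memClass i k : ClassFormula n 2) =
          epair (enat M 2) (epair (enat M i) (enat M k)) := rfl
        rw [hc] at key ⊢
        refine ⟨?_, ?_, ?_, ?_, ?_, ?_, ?_⟩ <;> simp [key, -Subtype.forall, -Subtype.exists, -epair_val]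
        · rintro rfl
          simp only [pair_mem_etuple, exists_eq_left]
          rfl
        · intro hk
          obtain rfl : k = 1 := Fin.ext hk
          simp only [pair_mem_etuple]
          refine Iff.trans (mem_stagesBelow (Γ := Γ) (Θ := Θ) (ξ := ξ) (t := a i)) ⟨?_, ?_⟩
          · rintro ⟨h₁, η, w, h₂, h₃⟩
            exact ⟨η, w, h₃.symm, h₃ ▸ h₁, h₂⟩
          · rintro ⟨η, w, h₃, h₁, h₂⟩
            exact ⟨h₃ ▸ h₁, η, w, h₂, h₃.symm⟩
      | neg φ => 
        have hc : ecode M (.neg φ : ClassFormula n 2) = epair (enat M 3) (ecode M φ) := rfl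
        rw [hc] at key ⊢
        refine ⟨?_, ?_, ?_, ?_, ?_, ?_, ?_⟩ <;> simp [key, -Subtype.forall, -Subtype.exists, -epair_val]

        rw [h.mem_iff hξ (φ := φ) hφ]
        rfl
      | conj φ ψ =>
        have hc : ecode M (.conj φ ψ : ClassFormula n 2) =
          epair (enat M 4) (epair (ecode M φ) (ecode M ψ)) := rfl
        rw [hc] at key ⊢
        refine ⟨?_, ?_, ?_, ?_, ?_, ?_, ?_⟩ <;> simp [key, -Subtype.forall, -Subtype.exists, -epair_val]

        rw [h.mem_iff hξ (φ := φ) hφ.1, h.mem_iff hξ (φ := ψ) hφ.2]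
        rfl
      | allSet φ => 
        have hc : ecode M (.allSet φ : ClassFormula n 2) = epair (enat M 5) (ecode M φ) := rfl
        rw [hc] at key ⊢
        refine ⟨?_, ?_, ?_, ?_, ?_, ?_, ?_⟩ <;> simp [key, -Subtype.forall, -Subtype.exists, -epair_val]

        refine forall_congr' fun x => ?_
        rw [← etuple_snoc, h.mem_iff hξ (φ := φ) hφ]
        rfl
      | allClass => exact hφ.elim
  · rintro ⟨h₁, h₂⟩
    have key : ∀ {ξ : Elt M}, Γ.Rel ξ ξ → ∀ {n m : ℕ} (hm : m = 2) (φ : ClassFormula n m),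
        φ.IsElementary → ∀ a : Fin n → Elt M, (epair ξ (epair (ecode M φ) (etuple a)) ∈ Θ ↔
          ElemSat φ a fun k => (![A, stagesBelow Γ Θ ξ] : Fin 2 → ClassOver M) (Fin.cast hm k)) := by
      intro ξ hξ
      have hcl : ∀ {n : ℕ} (φ : ClassFormula n 2), φ.IsElementary → ∀ a : Fin n → Elt M,
          TarskiClauses Γ A Θ ξ (enat M n) (ecode M φ) (etuple a) := fun {n} φ hφ a =>
        h₂ ξ _ _ _ hξ ⟨n, φ, hφ, rfl, rfl⟩ ⟨n, a, rfl, rfl⟩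
      intro n m hm φ
      induction φ with
      | @mem n m i j =>
        intro hφ a
        subst hm
        refine ((hcl (.mem i j) hφ a).1 (enat M i) (enat M j) rfl).trans ?_
        simp only [pair_mem_etuple, exists_and_left, exists_eq_left]
        rfl
      | @eq n m i j =>
        intro hφ a
        subst hm
        refine ((hcl (.eq i j) hφ a).2.1 (enat M i) (enat M j) rfl).trans ?_
        simp only [pair_mem_etuple, exists_eq_left]
        rfl
      | @memClass n m i k =>
        intro hφ a
        subst hm
        have hc := hcl (.memClass i k) hφ a
        fin_cases k
        · refine (hc.2.2.1 (enat M i) rfl).trans ?_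
          simp only [pair_mem_etuple, exists_eq_left]
          rfl
        · refine (hc.2.2.2.1 (enat M i) rfl).trans ?_
          simp only [pair_mem_etuple, exists_eq_left]
          exact mem_stagesBelow.symm
      | @neg n m φ ih =>
        intro hφ a
        subst hm
        exact ((hcl (.neg φ) hφ a).2.2.2.2.1 (ecode M φ) rfl).trans
          (not_congr (ih rfl hφ a))
      | @conj n m φ ψ ih₁ ih₂ =>
        intro hφ a
        subst hm
        exact ((hcl (.conj φ ψ) hφ a).2.2.2.2.2.1 (ecode M φ) (ecode M ψ) rfl).trans
          (and_congr (ih₁ rfl hφ.1 a) (ih₂ rfl hφ.2 a))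
      | @allSet n m φ ih =>
        intro hφ a
        subst hm
        refine ((hcl (.allSet φ) hφ a).2.2.2.2.2.2 (ecode M φ) rfl).trans
          (forall_congr' fun x => ?_)
        rw [← etuple_snoc]
        exact ih rfl hφ _
      | allClass => exact fun hφ => hφ.elim
    intro z
    constructor
    · intro hz
      obtain ⟨ξ, _, _, _, hξ, ⟨n, φ, hφ, rfl, rfl⟩, ⟨n', a, hn, rfl⟩, rfl⟩ := h₁ z hz
      obtain rfl := enat_inj.1 hn
      exact ⟨ξ, n, φ, a, hξ, hφ, rfl, (key hξ rfl φ hφ a).1 hz⟩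
    · rintro ⟨ξ, n, φ, a, hξ, hφ, hz, h⟩
      obtain rfl : z = epair ξ (epair (ecode M φ) (etuple a)) := Subtype.ext hz
      exact (key hξ rfl φ hφ a).2 h

theorem dfn_isIteratedTruthPredicate {𝒮 : Set (ClassOver M)} :
    Dfn 𝒮 (n := 0) (m := 3) fun _ V => IsIteratedTruthPredicate (M := M) (V 0) (V 1) (V 2) := by
  have hf := @(dfn_isFormulaCode (M := M) (𝒮 := 𝒮)).comp
  have ht := @(dfn_isTupleCode (M := M) (𝒮 := 𝒮)).comp
  simp only [isIteratedTruthPredicate_iff, TarskiClauses]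
  exact definability

end FormulaCodes

/-! ### Uniqueness of iterated truth predicates -/

theorem ClassOver.below_rel {R : ClassOver M} {ξ x y : Elt M} :
    (R.below ξ).Rel x y ↔ R.Rel x y ∧ R.Lt x ξ ∧ R.Lt y ξ := by
  constructor
  · rintro ⟨z, ⟨hz, x', y', hx, hy, h⟩, h'⟩
    obtain ⟨h₁, h₂⟩ := ZFSet.pair_inj.1 (h'.symm.trans h)
    obtain rfl : x = x' := Subtype.ext h₁
    obtain rfl : y = y' := Subtype.ext h₂
    exact ⟨⟨z, hz, h'⟩, hx, hy⟩
  · rintro ⟨⟨z, hz, h⟩, hx, hy⟩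
    exact ⟨z, ⟨hz, x, y, hx, hy, h⟩, h⟩

theorem ClassOver.IsWellOrder.wellFounded {R : ClassOver M} (hR : R.IsWellOrder) :
    WellFounded R.Lt := by
  refine WellFounded.wellFounded_iff_has_min.2 fun s ⟨x₀, hx₀⟩ => ?_
  by_cases hs : ∃ x ∈ s, R.Rel x x
  · obtain ⟨m, ⟨hm, -⟩, hmin⟩ := hR.wf {x | x ∈ s ∧ R.Rel x x} hs fun x hx => hx.2
    exact ⟨m, hm, fun x hx h => h.2 (hR.antisymm _ _ h.1 (hmin x ⟨hx, (hR.refl _ _ h.1).1⟩))⟩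
  · exact ⟨x₀, hx₀, fun x hx h => hs ⟨x, hx, (hR.refl _ _ h.1).1⟩⟩

theorem ClassOver.IsWellOrder.wellFounded_below {R : ClassOver M} (hR : R.IsWellOrder)
    (ξ : Elt M) : WellFounded (R.below ξ).Lt :=
  Subrelation.wf (fun h => ⟨(ClassOver.below_rel.1 h.1).1, h.2⟩) hR.wellFounded

section Uniqueness

variable [hM : TransitiveModel M]

/-- Stage `η` depends only on the part of the class below `η`, so these parts agree by induction
along `Γ`. -/
theorem IsIteratedTruthPredicate.unique {Γ A Θ Θ' : ClassOver M} (hΓ : WellFounded Γ.Lt)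
    (h : IsIteratedTruthPredicate Γ A Θ) (h' : IsIteratedTruthPredicate Γ A Θ') : Θ = Θ' := by
  have hstage : ∀ ξ : Elt M, stagesBelow Γ Θ ξ = stagesBelow Γ Θ' ξ := by
    intro ξ
    induction ξ using hΓ.induction with
    | _ ξ ih =>
      ext t
      rw [mem_stagesBelow, mem_stagesBelow]
      refine and_congr_left ?_
      rintro ⟨η, w, hη, rfl⟩
      rw [h, h']
      refine exists_congr fun ξ' => exists_congr fun n => exists_congr fun φ =>
        exists_congr fun a => and_congr_right fun _ => and_congr_right fun _ =>
        and_congr_right fun hw => ?_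
      obtain rfl : η = ξ' := Subtype.ext (ZFSet.pair_inj.1 hw).1
      have := ih η hη
      unfold stagesBelow at this
      rw [this]
  ext z
  rw [h, h']
  unfold stagesBelow at hstage
  simp only [hstage]

end Uniqueness

/-! ### The least system -/

/-- The worlds which belong to every `<Λ` truth potentialist system. -/
def generatedWorlds (M : ZFSet.{u}) (Λ : ClassOver M) : Set (World M) :=
  {𝒳 | ∀ 𝔗, IsTruthPotentialistSystemLT M Λ 𝔗 → 𝒳 ∈ 𝔗}

theorem Covers.refl (𝔄 : Set (World M)) : Covers 𝔄 𝔄 := fun 𝒳 h => ⟨𝒳, h, subset_rfl⟩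

theorem Covers.trans {𝔄 𝔅 ℭ : Set (World M)} (h : Covers 𝔄 𝔅) (h' : Covers 𝔅 ℭ) : Covers 𝔄 ℭ := by
  intro 𝒳 hX
  obtain ⟨𝒴, hY, hXY⟩ := h' 𝒳 hX
  obtain ⟨𝒵, hZ, hYZ⟩ := h 𝒴 hY
  exact ⟨𝒵, hZ, hXY.trans hYZ⟩

theorem Covers.mono {𝔄 𝔄' 𝔅 : Set (World M)} (h : Covers 𝔄 𝔅) (hA : 𝔄 ⊆ 𝔄') : Covers 𝔄' 𝔅 :=
  fun 𝒳 hX => (h 𝒳 hX).imp fun _ hY => ⟨hA hY.1, hY.2⟩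

section Least

variable [hM : TransitiveModel M] {Λ : ClassOver M}

/-- Different systems have to adjoin the same class `Θ`, by uniqueness; hence the intersection is
closed as well. -/
theorem isTruthPotentialistSystemLT_generatedWorlds (hΛ : Λ.IsWellOrder)
    (hex : ∃ 𝔗, IsTruthPotentialistSystemLT M Λ 𝔗) :
    IsTruthPotentialistSystemLT M Λ (generatedWorlds M Λ) := by
  obtain ⟨𝔗₀, h𝔗₀⟩ := hex
  refine ⟨fun 𝔗 h => h.base, fun 𝒳 hX => h𝔗₀.gb 𝒳 (hX _ h𝔗₀), fun 𝒳 hX ξ hξ A hA => ?_⟩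
  obtain ⟨Θ, hΘ, -⟩ := h𝔗₀.truth 𝒳 (hX _ h𝔗₀) ξ hξ A hA
  refine ⟨Θ, hΘ, fun 𝔗 h𝔗 => ?_⟩
  obtain ⟨Θ', hΘ', h⟩ := h𝔗.truth 𝒳 (hX _ h𝔗) ξ hξ A hA
  rwa [hΘ.unique (hΛ.wellFounded_below ξ) hΘ']

theorem IsLeastUpToCovering.covers_generatedWorlds (hΛ : Λ.IsWellOrder) {𝔄 : Set (World M)}
    (h : IsLeastUpToCovering M Λ 𝔄) : Covers (generatedWorlds M Λ) 𝔄 :=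
  h.2 _ (isTruthPotentialistSystemLT_generatedWorlds hΛ ⟨𝔄, h.1⟩)

theorem existsUnique_isSmallest (hΛ : Λ.IsWellOrder)
    (hex : ∃ 𝔗, IsTruthPotentialistSystemLT M Λ 𝔗) : ∃! 𝔄, IsSmallest M Λ 𝔄 := by
  have hgen := isTruthPotentialistSystemLT_generatedWorlds hΛ hex
  set 𝔊 := generatedWorlds M Λ with h𝔊
  -- The union of all systems covered by the intersection: adding more worlds would leave the
  -- covered ones, so this is the refined representative.
  set 𝔄 : Set (World M) :=
    {𝒳 | ∃ 𝔗, IsTruthPotentialistSystemLT M Λ 𝔗 ∧ Covers 𝔊 𝔗 ∧ 𝒳 ∈ 𝔗} with h𝔄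
  have hle : ∀ {𝔗}, IsTruthPotentialistSystemLT M Λ 𝔗 → 𝔊 ⊆ 𝔗 := fun h 𝒳 hX => hX _ h
  have hsub : ∀ {𝔗}, IsTruthPotentialistSystemLT M Λ 𝔗 → Covers 𝔊 𝔗 → 𝔗 ⊆ 𝔄 :=
    fun h h' 𝒳 hX => ⟨_, h, h', hX⟩
  have hcov : Covers 𝔊 𝔄 := fun 𝒳 ⟨𝔗, _, h, hX⟩ => h 𝒳 hX
  have hsys : IsTruthPotentialistSystemLT M Λ 𝔄 := by
    refine ⟨hsub hgen (.refl _) hgen.base, fun 𝒳 ⟨𝔗, h, _, hX⟩ => h.gb 𝒳 hX, ?_⟩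
    rintro 𝒳 ⟨𝔗, h, h', hX⟩ ξ hξ A hA
    obtain ⟨Θ, hΘ, hΘ'⟩ := h.truth 𝒳 hX ξ hξ A hA
    exact ⟨Θ, hΘ, hsub h h' hΘ'⟩
  refine ⟨𝔄, ⟨⟨hsys, fun 𝔗 h => hcov.mono (hle h)⟩, fun 𝔗 h h₁ h₂ =>
    (hsub h (hcov.trans h₂)).antisymm h₁⟩, fun 𝔅 ⟨h, h'⟩ => ?_⟩
  exact (h' 𝔄 hsys (hsub h.1 (h.2 _ hgen)) (hcov.mono (hle h.1))).symm

end Least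

/-! ### Generators -/

/-- The class `U` is implicitly definable by an elementary formula with set parameters. -/
def ImplicitlyDefinable (U : ClassOver M) : Prop :=
  Dfn ∅ (n := 0) (m := 1) fun _ V => V 0 = U

theorem implicitlyDefinable_empty : ImplicitlyDefinable (∅ : ClassOver M) := by
  have : Dfn (M := M) ∅ (n := 0) (m := 1) fun _ V => ∀ x : Elt M, ¬ x ∈ V 0 := definability
  exact this.congr fun _ V => Set.eq_empty_iff_forall_notMem

/-- A class definable from `U` depends definably on `U`. -/
theorem exists_dfnClass_of_mem_definableFrom {U A : ClassOver M} (hA : A ∈ definableFrom {U}) :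
    ∃ c : ClassOver M → ClassOver M,
      DfnClass ∅ (n := 0) (m := 1) (fun _ V => c (V 0)) ∧ c U = A := by
  obtain ⟨n, m, φ, v, V, hφ, hV, rfl⟩ := hA
  refine ⟨fun W => {x | ElemSat φ (Fin.snoc (α := fun _ : Fin (n + 1) => Elt M) v x) fun _ => W},
    ?_, ?_⟩
  · refine (Dfn.sat φ hφ (n := 1) (m := 1) (s := Fin.snoc (α := fun _ =>
      (Fin 1 → Elt M) → (Fin 1 → ClassOver M) → Elt M) (fun i _ _ => v i) fun w _ => w 0)
      (fun i => ?_) (c := fun k _ W => W 0) fun k => .var _).congr fun w W => ?_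
    · refine Fin.lastCases ?_ (fun i => ?_) i
      · simpa using DfnTerm.var (0 : Fin 1)
      · simpa using DfnTerm.const (v i)
    · simp only [Set.mem_ofPred_eq]
      apply iff_of_eq
      congr 1
      funext i
      refine Fin.lastCases ?_ (fun i => ?_) i <;> simp
  · obtain rfl : V = fun _ => U := funext hV
    rfl

section Generators

variable [hM : TransitiveModel M] {Λ : ClassOver M}

/-- The disjoint union of two classes. -/
def ClassOver.sum (A B : ClassOver M) : ClassOver M :=
  {z | (∃ x, x ∈ A ∧ z = epair (enat M 0) x) ∨ ∃ x, x ∈ B ∧ z = epair (enat M 1) x}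

/-- The `k`-th section of a class. -/
def ClassOver.section (A : ClassOver M) (k : Elt M) : ClassOver M := {x | epair k x ∈ A}

theorem ClassOver.section_sum_zero (A B : ClassOver M) : (A.sum B).section (enat M 0) = A := by
  ext x
  simp [ClassOver.section, ClassOver.sum, -Subtype.exists]

theorem ClassOver.section_sum_one (A B : ClassOver M) : (A.sum B).section (enat M 1) = B := by
  ext x
  simp [ClassOver.section, ClassOver.sum, -Subtype.exists]

theorem DfnClass.section {𝒮 : Set (ClassOver M)} {n m : ℕ}
    {c : (Fin n → Elt M) → (Fin m → ClassOver M) → ClassOver M} (hc : DfnClass 𝒮 c) (k : Elt M) :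
    DfnClass 𝒮 fun v V => (c v V).section k :=
  DfnClass.set (t := fun v V x => epair k x ∈ c v V)
    (Dfn.memClass (DfnTerm.epair (.const k) (.var _)) hc.weaken)

theorem section_mem_definableFrom {𝒮 : Set (ClassOver M)} {A : ClassOver M}
    (hA : A ∈ definableFrom 𝒮) (k : Elt M) : A.section k ∈ definableFrom 𝒮 :=
  mem_definableFrom_iff.2 ((mem_definableFrom_iff.1 hA).section k)

theorem sum_mem_definableFrom {𝒮 : Set (ClassOver M)} {A B : ClassOver M}
    (hA : A ∈ definableFrom 𝒮) (hB : B ∈ definableFrom 𝒮) : A.sum B ∈ definableFrom 𝒮 := by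
  rw [dfnClass_iff] at *
  have hA' := @hA.comp
  have hB' := @hB.comp
  change Dfn₁ 𝒮 fun z => (∃ x, x ∈ A ∧ z = epair (enat M 0) x) ∨
    ∃ x, x ∈ B ∧ z = epair (enat M 1) x
  exact definability

theorem definableFrom_sum (A B : ClassOver M) : definableFrom {A.sum B} = definableFrom {A, B} := by
  apply subset_antisymm
  · refine definableFrom_definableFrom (Set.singleton_subset_iff.2 (sum_mem_definableFrom ?_ ?_))
    · exact subset_definableFrom _ (by simp)
    · exact subset_definableFrom _ (by simp)
  · refine definableFrom_definableFrom (Set.insert_subset ?_ (Set.singleton_subset_iff.2 ?_))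
    · have := section_mem_definableFrom (subset_definableFrom {A.sum B} rfl) (enat M 0)
      rwa [ClassOver.section_sum_zero] at this
    · have := section_mem_definableFrom (subset_definableFrom {A.sum B} rfl) (enat M 1)
      rwa [ClassOver.section_sum_one] at this

/-- A class is this disjoint union exactly if its `0`-section is `U`, its `1`-section is the
iterated truth predicate over the class defined from the `0`-section as `A` is from `U`, and it has
no other elements. -/
theorem ImplicitlyDefinable.sum {Γ U A Θ : ClassOver M} (hΓ : WellFounded Γ.Lt)
    (hdef : Γ ∈ defClasses M) (hU : ImplicitlyDefinable U) (hA : A ∈ definableFrom {U})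
    (hΘ : IsIteratedTruthPredicate Γ A Θ) : ImplicitlyDefinable (U.sum Θ) := by
  obtain ⟨c, hc, rfl⟩ := exists_dfnClass_of_mem_definableFrom hA
  have hsec : ∀ k : Elt M, DfnClass ∅ (n := 0) (m := 1) fun _ V => (V 0).section k :=
    fun k => (DfnClass.var 0).section k
  have h₁ : Dfn ∅ (n := 0) (m := 1) fun _ V => (V 0).section (enat M 0) = U :=
    Dfn.subst (K := 1) hU (fun _ => .const) (fun i => i.elim0)
      (fun _ _ V => (V 0).section (enat M 0)) (fun i => i.elim0) fun _ => hsec _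
  have h₂ : DfnClass ∅ (n := 0) (m := 1) fun _ V => c ((V 0).section (enat M 0)) :=
    Dfn.subst (n := 1) (m := 1) (K := 1) hc (fun _ => .const) (fun _ v _ => v 0)
      (fun _ _ V => (V 0).section (enat M 0)) (fun _ => .var _) fun _ => (hsec _).weaken
  have h₃ : Dfn ∅ (n := 0) (m := 1) fun _ V => IsIteratedTruthPredicate Γ
      (c ((V 0).section (enat M 0))) ((V 0).section (enat M 1)) :=
    Dfn.subst dfn_isIteratedTruthPredicate (fun _ => .const) (fun i => i.elim0)
      ![fun _ _ => Γ, fun _ V => c ((V 0).section (enat M 0)), fun _ V => (V 0).section (enat M 1)]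
      (fun i => i.elim0) fun k => by
        fin_cases k
        exacts [.of_mem_definableFrom hdef, h₂, hsec _]
  have h₄ : Dfn ∅ (n := 0) (m := 1) fun _ V => ∀ z : Elt M, z ∈ V 0 → ∃ x,
      z = epair (enat M 0) x ∨ z = epair (enat M 1) x := definability
  refine (h₁.and (h₃.and h₄)).congr fun _ V => ?_
  generalize V 0 = W
  constructor
  · rintro rfl
    rw [ClassOver.section_sum_zero, ClassOver.section_sum_one]
    refine ⟨rfl, hΘ, fun z hz => ?_⟩
    rcases hz with ⟨x, -, rfl⟩ | ⟨x, -, rfl⟩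
    · exact ⟨x, Or.inl rfl⟩
    · exact ⟨x, Or.inr rfl⟩
  · rintro ⟨rfl, h₂, h₃⟩
    obtain rfl := h₂.unique hΓ hΘ
    ext z
    constructor
    · intro hz
      obtain ⟨x, rfl | rfl⟩ := h₃ z hz
      · exact Or.inl ⟨x, hz, rfl⟩
      · exact Or.inr ⟨x, hz, rfl⟩
    · rintro (⟨x, hx, rfl⟩ | ⟨x, hx, rfl⟩) <;> exact hx

theorem below_mem_defClasses (hΛ : Λ ∈ defClasses M) (ξ : Elt M) : Λ.below ξ ∈ defClasses M := by
  have hΛ' : ∀ {n m : ℕ}, DfnClass ∅ (n := n) (m := m) fun _ _ => Λ := .of_mem_definableFrom hΛ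
  refine dfnClass_iff.2 (Dfn.congr (P := fun v _ => v 0 ∈ Λ ∧ ∃ x y : Elt M, Λ.Lt x ξ ∧ Λ.Lt y ξ ∧
    v 0 = epair x y) definability fun v _ => ?_)
  simp only [Subtype.ext_iff (a1 := v 0)]
  rfl

/-- The world `𝒳` is generated by a single implicitly definable class `U`. -/
structure IsGenerator (𝒳 : World M) (U : ClassOver M) : Prop where
  mem : U ∈ 𝒳
  subset : 𝒳 ⊆ definableFrom {U}
  implicitlyDefinable : ImplicitlyDefinable U

theorem IsGenerator.adjoin {𝒳 : World M} {U A Θ : ClassOver M} {ξ : Elt M} (h : IsGenerator 𝒳 U)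
    (hΛdef : Λ ∈ defClasses M) (hΛ : Λ.IsWellOrder) (hA : A ∈ 𝒳)
    (hΘ : IsIteratedTruthPredicate (Λ.below ξ) A Θ) :
    IsGenerator (adjoinClass 𝒳 Θ) (U.sum Θ) where
  mem := sum_mem_definableFrom (subset_definableFrom _ (Set.mem_insert_of_mem _ h.mem))
    (subset_definableFrom _ (Set.mem_insert _ _))
  subset := by
    rw [definableFrom_sum]
    refine definableFrom_definableFrom (Set.insert_subset (subset_definableFrom _ (by simp))
      (h.subset.trans (definableFrom_definableFrom ?_)))
    exact Set.singleton_subset_iff.2 (subset_definableFrom _ (by simp))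
  implicitlyDefinable := h.implicitlyDefinable.sum (hΛ.wellFounded_below ξ)
    (below_mem_defClasses hΛdef ξ) (h.subset hA) hΘ

/-- The worlds of the intersection with a generator form a `<Λ` system, so they are all of them:
minimality serves as an induction principle, with `∅` as generator of `Def(M)`. -/
theorem exists_isGenerator (hΛdef : Λ ∈ defClasses M) (hΛ : Λ.IsWellOrder)
    (hex : ∃ 𝔗, IsTruthPotentialistSystemLT M Λ 𝔗) {𝒳 : World M} (hX : 𝒳 ∈ generatedWorlds M Λ) :
    ∃ U, IsGenerator 𝒳 U := by
  have hgen := isTruthPotentialistSystemLT_generatedWorlds hΛ hex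
  refine (hX {𝒳 | 𝒳 ∈ generatedWorlds M Λ ∧ ∃ U, IsGenerator 𝒳 U}
    ⟨⟨hgen.base, ∅, ?_, ?_, implicitlyDefinable_empty⟩, fun 𝒳 h => hgen.gb 𝒳 h.1, ?_⟩).2
  · refine mem_definableFrom_iff.2 (Dfn.prop False)
  · exact definableFrom_definableFrom (Set.empty_subset _)
  · rintro 𝒳 ⟨h, U, hU⟩ ξ hξ A hA
    obtain ⟨Θ, hΘ, hΘ'⟩ := hgen.truth 𝒳 h ξ hξ A hA
    exact ⟨Θ, hΘ, hΘ', _, hU.adjoin hΛdef hΛ hA hΘ⟩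

end Generators

/-! ### The main theorem -/

theorem liftFin_id {n : ℕ} : liftFin (id : Fin n → Fin n) = id := by
  funext i
  refine Fin.lastCases ?_ (fun i => ?_) i <;> simp [liftFin]

/-- A formula about `A` alone keeps its code when it is read as a formula with two predicates; this
compares `Tr` with the stages of `Tr_ξ`. -/
theorem ClassFormula.code_rename {n m m' : ℕ} (φ : ClassFormula n m) (hφ : φ.IsElementary)
    (g : Fin m → Fin m') (hg : ∀ k, (g k : ℕ) = k) : (φ.rename id g).code = φ.code := by
  induction φ with
  | mem | eq => rfl
  | memClass i k => simp [rename, code, hg]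
  | neg φ ih => simp [rename, code, ih hφ g hg]
  | conj φ ψ ih₁ ih₂ => simp [rename, code, ih₁ hφ.1 g hg, ih₂ hφ.2 g hg]
  | allSet φ ih => simp [rename, code, liftFin_id, ih hφ g hg]
  | allClass => exact hφ.elim

/-- A formula with a single class variable which defines `U` outright. -/
theorem ImplicitlyDefinable.exists_formula {U : ClassOver M} (hU : ImplicitlyDefinable U) :
    ∃ (n : ℕ) (δ : ClassFormula n 1) (w : Fin n → Elt M), δ.IsElementary ∧
      ∀ V, ElemSat δ w ![V] ↔ V = U := by
  obtain ⟨k, l, w, C, δ, hδ, hC, h⟩ := hU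
  cases l with
  | succ l => exact (hC 0).elim
  | zero =>
    refine ⟨k, δ, w, hδ, fun V => ?_⟩
    have := h Fin.elim0 ![V]
    rw [Subsingleton.elim C Fin.elim0] at this
    simpa using this.symm

theorem definableFrom_subset_of_mem_addGenericWellOrders {𝒳 : World M} {𝔄 : Set (World M)}
    (h : ∀ 𝒳 ∈ 𝔄, IsGBExpansion M 𝒳) (hX : 𝒳 ∈ addGenericWellOrders 𝔄) :
    definableFrom 𝒳 ⊆ 𝒳 := by
  rcases hX with hX | ⟨𝒲, -, H, -, rfl⟩
  · exact (h 𝒳 hX).comprehension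
  · exact definableFrom_definableFrom subset_rfl

section Main

variable [hM : TransitiveModel M] {Λ : ClassOver M}

theorem IsIteratedTruthPredicate.decidesTruth {Γ A Θ : ClassOver M}
    (h : IsIteratedTruthPredicate Γ A Θ) {ξ : Elt M} (hξ : Γ.Rel ξ ξ) :
    DecidesTruth A (Θ.section ξ) := by
  intro n φ a hφ
  have hcode : ecode M (φ.rename id Fin.castSucc) = ecode M φ :=
    Subtype.ext (φ.code_rename hφ _ fun _ => rfl)
  have := h.mem_iff hξ (hφ.rename id Fin.castSucc) a
  rw [hcode, elemSat_rename] at this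
  refine this.trans (iff_of_eq ?_)
  congr 1
  funext k
  fin_cases k
  rfl

/-- For the generic extensions this is obtained from forcing directly, without first showing that
they satisfy `GB`. -/
theorem not_surjective_of_mem_addGenericWellOrders {𝔄 : Set (World M)} {𝒳 : World M}
    (h : ∀ 𝒳 ∈ 𝔄, IsGBExpansion M 𝒳) (hX : 𝒳 ∈ addGenericWellOrders 𝔄) {F : ClassOver M}
    (hF : F ∈ 𝒳) (hfun : ∀ x y y' : Elt M, F.Rel x y → F.Rel x y' → y = y') :
    ¬ ∀ y : Elt M, ∃ n : ℕ, F.Rel (enat M n) y := by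
  rcases hX with hX | ⟨𝒲, hW, H, hH, rfl⟩
  · exact (h 𝒳 hX).not_surjective hF hfun
  · exact not_surjective_of_generic (h 𝒲 hW) hH hF hfun

/-- Above every world there are a world with a generator `U` and a generic global well-order which
cannot coexist with a truth predicate for `U`. -/
theorem exists_generic_incompatible [Countable (Elt M)] (hΛdef : Λ ∈ defClasses M)
    (hΛ : Λ.IsWellOrder) {𝔄 : Set (World M)} (h𝔄 : IsLeastUpToCovering M Λ 𝔄) {𝒳 : World M}
    (hX : 𝒳 ∈ 𝔄) : ∃ 𝒢 ∈ generatedWorlds M Λ, 𝒳 ⊆ 𝒢 ∧ ∃ U, IsGenerator 𝒢 U ∧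
      ∃ 𝒴 ∈ addGenericWellOrders 𝔄, 𝒢 ⊆ 𝒴 ∧ ∀ 𝒵, definableFrom 𝒵 ⊆ 𝒵 → 𝒴 ⊆ 𝒵 → ∀ T ∈ 𝒵,
        DecidesTruth U T → ∃ F ∈ 𝒵, (∀ x y y' : Elt M, F.Rel x y → F.Rel x y' → y = y') ∧
          ∀ y : Elt M, ∃ n : ℕ, F.Rel (enat M n) y := by
  obtain ⟨𝒢, hG, hXG⟩ := h𝔄.covers_generatedWorlds hΛ 𝒳 hX
  obtain ⟨U, hU⟩ := exists_isGenerator hΛdef hΛ ⟨𝔄, h𝔄.1⟩ hG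
  have hG𝔄 := hG 𝔄 h𝔄.1
  obtain ⟨H, hH, hcat⟩ := exists_catastrophic_generic (h𝔄.1.gb _ hG𝔄) hU.subset
  exact ⟨𝒢, hG, hXG, U, hU, adjoinClass 𝒢 H, Or.inr ⟨𝒢, hG𝔄, H, hH, rfl⟩,
    (Set.subset_insert _ _).trans (subset_definableFrom _), fun 𝒵 hZ hYZ =>
      hcat 𝒵 hZ (hYZ (subset_definableFrom _ (Set.mem_insert _ _)))⟩

/-- The failing formula asserts the existence of `U.sum Θ` with `Θ = Tr_ξ(U)`: it is permanent once
this class is adjoined, and unattainable above the catastrophic world `𝒴`. -/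
theorem not_dotTwoValidAt [Countable (Elt M)] (hΛdef : Λ ∈ defClasses M) (hΛ : Λ.IsWellOrder)
    (hΛlim : Λ.HasLimitLength) {𝔄 : Set (World M)} (h𝔄 : IsLeastUpToCovering M Λ 𝔄)
    {𝒳 : World M} (hX : 𝒳 ∈ 𝔄) : ¬ DotTwoValidAt (addGenericWellOrders 𝔄) 𝒳 := by
  intro hval
  obtain ⟨𝒢, hG, hXG, U, hU, 𝒴, hY, hGY, hcat⟩ := exists_generic_incompatible hΛdef hΛ h𝔄 hX
  obtain ⟨⟨ξ₀, hξ₀⟩, hlim⟩ := hΛlim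
  -- The stage `ξ₀` must lie strictly below `ξ`, since `Tr_ξ` has only the stages below `ξ`; stage
  -- `ξ₀` then contains the truths about `U`.
  obtain ⟨ξ, hξ⟩ := hlim ξ₀ hξ₀
  have hgen := isTruthPotentialistSystemLT_generatedWorlds hΛ ⟨𝔄, h𝔄.1⟩
  obtain ⟨Θ, hΘ, hΘG⟩ := hgen.truth 𝒢 hG ξ (hΛ.refl _ _ hξ.1).2 U hU.mem
  have hgenΘ := hU.adjoin hΛdef hΛ hU.mem hΘ
  obtain ⟨n, δ, w, hδ, hδ'⟩ := hgenΘ.implicitlyDefinable.exists_formula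
  -- Implicit definability is essential here: `U` need not belong to `𝒳`, so it is described by set
  -- parameters only.
  have hsat : ∀ 𝒵 : World M, Sat 𝒵 (.neg (.allClass (.neg δ))) w Fin.elim0 ↔ U.sum Θ ∈ 𝒵 := by
    intro 𝒵
    have hsnoc : ∀ V : ClassOver M,
        Fin.snoc (α := fun _ : Fin (0 + 1) => ClassOver M) Fin.elim0 V = ![V] := fun V => by
      funext k
      fin_cases k
      rfl
    have h : ∀ V : ClassOver M, Sat 𝒵 δ w (Fin.snoc (α := fun _ : Fin (0 + 1) => ClassOver M)
        Fin.elim0 V) ↔ V = U.sum Θ := fun V => by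
      rw [hsnoc, sat_iff_elemSat 𝒵 δ hδ, hδ']
    simp [Sat, h]
  obtain ⟨𝒵, hZ, hYZ, hZsat⟩ := hval n 0 (.neg (.allClass (.neg δ))) w Fin.elim0
    (fun k => k.elim0) ⟨_, Or.inl (hΘG 𝔄 h𝔄.1),
      hXG.trans ((Set.subset_insert _ _).trans (subset_definableFrom _)),
      fun 𝒵 _ hsub => (hsat 𝒵).2 (hsub hgenΘ.mem)⟩ 𝒴 hY (hXG.trans hGY)
  have hclosed := definableFrom_subset_of_mem_addGenericWellOrders h𝔄.1.gb hZ
  have hΘZ : Θ ∈ 𝒵 := by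
    rw [← ClassOver.section_sum_one U Θ]
    exact hclosed (section_mem_definableFrom (subset_definableFrom _ ((hsat 𝒵).1 hZsat)) _)
  obtain ⟨F, hF, hfun, hsurj⟩ := hcat 𝒵 hclosed hYZ _
    (hclosed (section_mem_definableFrom (subset_definableFrom _ hΘZ) ξ₀))
    (hΘ.decidesTruth (ClassOver.below_rel.2 ⟨hξ₀, hξ, hξ⟩))
  exact not_surjective_of_mem_addGenericWellOrders h𝔄.1.gb hZ hF hfun hsurj

theorem exists_no_truthPredicate [Countable (Elt M)] (hΛdef : Λ ∈ defClasses M)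
    (hΛ : Λ.IsWellOrder) {𝔄 : Set (World M)} (h𝔄 : IsLeastUpToCovering M Λ 𝔄) {𝒳 : World M}
    (hX : 𝒳 ∈ 𝔄) : ∃ 𝒴 ∈ addGenericWellOrders 𝔄, 𝒳 ⊆ 𝒴 ∧ ∃ A ∈ 𝒴,
      ∀ 𝒵, IsGBExpansion M 𝒵 → 𝒴 ⊆ 𝒵 → truthPredicate A ∉ 𝒵 := by
  obtain ⟨𝒢, -, hXG, U, hU, 𝒴, hY, hGY, hcat⟩ := exists_generic_incompatible hΛdef hΛ h𝔄 hX
  refine ⟨𝒴, hY, hXG.trans hGY, U, hGY hU.mem, fun 𝒵 hZ hYZ hT => ?_⟩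
  obtain ⟨F, hF, hfun, hsurj⟩ := hcat 𝒵 hZ.comprehension hYZ _ hT (decidesTruth_truthPredicate U)
  exact hZ.not_surjective hF hfun hsurj

end Main

theorem mainTheorem11 (M : ZFSet.{u}) (hM : M.IsTransitive) (hcount : Countable (Elt M))
    (hZFC : ModelsZFC M) (Λ : ClassOver M) (hΛdef : Λ ∈ defClasses M) (hΛwo : Λ.IsWellOrder)
    (hΛlim : Λ.HasLimitLength) (hadmits : ∃ 𝔗, IsTruthPotentialistSystemLT M Λ 𝔗) :
    (∃! 𝔄, IsSmallest M Λ 𝔄) ∧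
    ∀ 𝔄, IsLeastUpToCovering M Λ 𝔄 →
      (∀ 𝒳 ∈ 𝔄, ¬ DotTwoValidAt (addGenericWellOrders 𝔄) 𝒳) ∧
      (∀ 𝒳 ∈ 𝔄, ∃ 𝒴 ∈ addGenericWellOrders 𝔄, 𝒳 ⊆ 𝒴 ∧ ∃ A ∈ 𝒴,
        ∀ 𝒵, IsGBExpansion M 𝒵 → 𝒴 ⊆ 𝒵 → truthPredicate A ∉ 𝒵) ∧
      ¬ ∃ 𝔗, IsTruthPotentialistSystem M 𝔗 ∧ addGenericWellOrders 𝔄 ⊆ 𝔗 := by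
  have : TransitiveModel M := ⟨hM, hZFC⟩
  refine ⟨existsUnique_isSmallest hΛwo hadmits, fun 𝔄 h𝔄 => ⟨fun 𝒳 hX =>
    not_dotTwoValidAt hΛdef hΛwo hΛlim h𝔄 hX, fun 𝒳 hX =>
    exists_no_truthPredicate hΛdef hΛwo h𝔄 hX, ?_⟩⟩
  rintro ⟨𝔗, h𝔗, hsub⟩
  -- Any world of `𝔄` would do; `Def(M)` is one. A truth potentialist system containing `𝒴` would
  -- also contain the `GB`-expansion `𝒴[Tr(A)]`.
  obtain ⟨𝒴, hY, -, A, hA, h⟩ := exists_no_truthPredicate hΛdef hΛwo h𝔄 h𝔄.1.base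
  exact h _ (h𝔗.gb _ (h𝔗.truth 𝒴 (hsub hY) A hA))
    ((Set.subset_insert _ _).trans (subset_definableFrom _))
    (subset_definableFrom _ (Set.mem_insert _ _))
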